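/- Let $M$ be a smooth four-dimensional manifold with a smooth Lorentzian metric $g$ of signature $(-,+,+,+)$. A smooth vector field $K$ on $M$ is called an HSO timelike Killing field if $g(K,K)<0$ everywhere, $\mathcal L_K g=0$, and $K$ is hypersurface-orthogonal, i.e. $K^\flat\wedge dK^\flat=0$ for the one-form $K^\flat=g(K,\cdot)$. Suppose that $(M,g)$ is a generic multi-static metric: there are two HSO timelike Killing fields $K,\xi$ on $M$, neither of which is a constant multiple of the other, such that the local group generated by $K$, $\xi$ and their iterated commutators has two-dimensional orbits, i.e. for every $x\in M$ the values at $x$ of the vector fields in the Lie algebra generated by $K$ and $\xi$ form a two-dimensional subspace of $T_xM$. Then $g$ is locally a warped product: every point of $M$ has an open neighbourhood $U$ with a diffeomorphism $U\cong S_0\times S_1$ under which $$g=e^{w}\gamma_0+\gamma_1,$$ where $S_0,S_1\subseteq\mathbb R^2$ are open, $\gamma_0$ is a smooth Lorentzian metric of constant curvature on $S_0$, $\gamma_1$ is a smooth Riemannian metric on $S_1$, and $w:S_1\to\mathbb R$ is a smooth function. -/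

import Mathlib

open scoped Manifold ContDiff

/-- The model space `ℝ⁴` of a four-dimensional manifold. -/
abbrev E4 : Type := EuclideanSpace ℝ (Fin 4)

/-- The coordinate plane `ℝ²`. -/
abbrev E2 : Type := EuclideanSpace ℝ (Fin 2)

/-- A symmetric bilinear form of Lorentzian signature `(-, +, …, +)`: some vector `v` has negative
square, and the form is positive definite on the orthogonal complement of `v`. -/
def IsLorentzForm {V : Type*} [AddCommGroup V] [Module ℝ V] [TopologicalSpace V]
    (B : V →L[ℝ] V →L[ℝ] ℝ) : Prop :=
  (∀ u v, B u v = B v u) ∧ ∃ v, B v v < 0 ∧ ∀ u, B v u = 0 → u ≠ 0 → 0 < B u u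

/-- A symmetric positive definite bilinear form. -/
def IsEuclideanForm {V : Type*} [AddCommGroup V] [Module ℝ V] [TopologicalSpace V]
    (B : V →L[ℝ] V →L[ℝ] ℝ) : Prop :=
  (∀ u v, B u v = B v u) ∧ ∀ u, u ≠ 0 → 0 < B u u

section Spacetime

variable (M : Type*) [TopologicalSpace M] [ChartedSpace E4 M] [IsManifold 𝓘(ℝ, E4) ∞ M]

/-- A smooth Lorentzian metric on a smooth four-dimensional manifold. -/
structure LorentzMetric where
  /-- The scalar product on each tangent space. -/
  inner (x : M) : TangentSpace 𝓘(ℝ, E4) x →L[ℝ] TangentSpace 𝓘(ℝ, E4) x →L[ℝ] ℝ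
  lorentz (x : M) : IsLorentzForm (inner x)
  contMDiff : ContMDiff 𝓘(ℝ, E4) (𝓘(ℝ, E4).prod 𝓘(ℝ, E4 →L[ℝ] E4 →L[ℝ] ℝ)) ∞
    (fun x ↦ Bundle.TotalSpace.mk' (E4 →L[ℝ] E4 →L[ℝ] ℝ)
      (E := fun x : M ↦ TangentSpace 𝓘(ℝ, E4) x →L[ℝ] TangentSpace 𝓘(ℝ, E4) x →L[ℝ] ℝ)
      x (inner x))

/-- A (not necessarily smooth) vector field on `M`. -/
abbrev VField : Type _ := (x : M) → TangentSpace 𝓘(ℝ, E4) x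

variable {M}

/-- Smoothness of a vector field at a point. -/
def VField.SmoothAt (X : VField M) (x : M) : Prop :=
  ContMDiffAt 𝓘(ℝ, E4) 𝓘(ℝ, E4).tangent ∞
    (fun y ↦ (⟨y, X y⟩ : TangentBundle 𝓘(ℝ, E4) M)) x

/-- The Lie bracket `[X, Y]` of vector fields. -/
noncomputable def VField.bracket (X Y : VField M) : VField M :=
  VectorField.mlieBracket 𝓘(ℝ, E4) X Y

/-- The derivative `X f` of a function `f` along a vector field `X`, at the point `x`. -/
noncomputable def VField.deriv (X : VField M) (f : M → ℝ) (x : M) : ℝ :=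
  mvfderiv 𝓘(ℝ, E4) f x (X x)

namespace LorentzMetric

variable (g : LorentzMetric M)

/-- `K` is a Killing field: `(L_K g)(Y, Z) = K (g(Y, Z)) - g([K, Y], Z) - g(Y, [K, Z])` vanishes at
every point, for all vector fields `Y`, `Z` that are smooth there. -/
def IsKilling (K : VField M) : Prop :=
  ∀ (x : M) (Y Z : VField M), Y.SmoothAt x → Z.SmoothAt x →
    K.deriv (fun y ↦ g.inner y (Y y) (Z y)) x
      - g.inner x (K.bracket Y x) (Z x) - g.inner x (Y x) (K.bracket Z x) = 0

/-- The exterior derivative `(d K♭)(X, Y) = X (K♭ Y) - Y (K♭ X) - K♭ [X, Y]` of the one-form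
`K♭ = g(K, ·)`, at the point `x`. -/
noncomputable def dFlat (K X Y : VField M) (x : M) : ℝ :=
  X.deriv (fun y ↦ g.inner y (K y) (Y y)) x - Y.deriv (fun y ↦ g.inner y (K y) (X y)) x
    - g.inner x (K x) (X.bracket Y x)

/-- `K` is hypersurface-orthogonal: `K♭ ∧ d K♭ = 0`, in indices `K_[a ∇_b K_c] = 0`. -/
def IsHypersurfaceOrthogonal (K : VField M) : Prop :=
  ∀ (x : M) (X Y Z : VField M), X.SmoothAt x → Y.SmoothAt x → Z.SmoothAt x →
    g.inner x (K x) (X x) * g.dFlat K Y Z x + g.inner x (K x) (Y x) * g.dFlat K Z X x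
      + g.inner x (K x) (Z x) * g.dFlat K X Y x = 0

/-- A smooth hypersurface-orthogonal (HSO) timelike Killing vector field. -/
structure IsStaticField (K : VField M) : Prop where
  smooth : ∀ x, K.SmoothAt x
  timelike : ∀ x, g.inner x (K x) (K x) < 0
  killing : g.IsKilling K
  hso : g.IsHypersurfaceOrthogonal K

end LorentzMetric

/-- The Lie algebra of vector fields generated by `K` and `ξ`: the least set of vector fields that
contains both and is closed under linear combinations and Lie brackets. -/
inductive InGeneratedAlgebra (K ξ : VField M) : VField M → Prop
  | left : InGeneratedAlgebra K ξ K
  | right : InGeneratedAlgebra K ξ ξ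
  | add {X Y : VField M} : InGeneratedAlgebra K ξ X → InGeneratedAlgebra K ξ Y →
      InGeneratedAlgebra K ξ (fun x ↦ X x + Y x)
  | smul (c : ℝ) {X : VField M} : InGeneratedAlgebra K ξ X →
      InGeneratedAlgebra K ξ (fun x ↦ c • X x)
  | bracket {X Y : VField M} : InGeneratedAlgebra K ξ X → InGeneratedAlgebra K ξ Y →
      InGeneratedAlgebra K ξ (X.bracket Y)

/-- The tangent space at `x` of the orbit through `x` of the (local) group generated by the flows
of `K`, `ξ` and their iterated commutators. -/
noncomputable def orbitTangent (K ξ : VField M) (x : M) : Submodule ℝ (TangentSpace 𝓘(ℝ, E4) x) :=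
  Submodule.span ℝ {v | ∃ X : VField M, InGeneratedAlgebra K ξ X ∧ X x = v}

/-- One of the two vector fields is a constant multiple of the other. -/
def VField.Proportional (K ξ : VField M) : Prop :=
  (∃ c : ℝ, ∀ x, ξ x = c • K x) ∨ ∃ c : ℝ, ∀ x, K x = c • ξ x

/-- `g` admits two non-proportional HSO timelike Killing fields such that the group that they (and
their commutators) generate has two-dimensional orbits. -/
def LorentzMetric.IsGenericMultiStatic (g : LorentzMetric M) : Prop :=
  ∃ K ξ : VField M, g.IsStaticField K ∧ g.IsStaticField ξ ∧ ¬ VField.Proportional K ξ ∧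
    ∀ x, Module.finrank ℝ (orbitTangent K ξ x) = 2

end Spacetime

section Surface

/-- A smooth field of bilinear forms on an open set of the plane, for metrics of surfaces. -/
abbrev PlaneForm : Type := E2 → E2 →L[ℝ] E2 →L[ℝ] ℝ

/-- `γ` is a smooth Lorentzian metric on the open set `S`. -/
def PlaneForm.IsLorentzianOn (γ : PlaneForm) (S : Set E2) : Prop :=
  ContDiffOn ℝ ∞ γ S ∧ ∀ a ∈ S, IsLorentzForm (γ a)

/-- `γ` is a smooth Riemannian metric on the open set `S`. -/
def PlaneForm.IsRiemannianOn (γ : PlaneForm) (S : Set E2) : Prop :=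
  ContDiffOn ℝ ∞ γ S ∧ ∀ a ∈ S, IsEuclideanForm (γ a)

/-- The coordinate vector `∂ᵢ`. -/
noncomputable def coordVec (i : Fin 2) : E2 := EuclideanSpace.single i 1

/-- The partial derivative `∂ᵢ f`. -/
noncomputable def partialD (i : Fin 2) (f : E2 → ℝ) (a : E2) : ℝ := fderiv ℝ f a (coordVec i)

namespace PlaneForm

variable (γ : PlaneForm)

/-- The matrix `γᵢⱼ` of the metric. -/
noncomputable def gram (a : E2) : Matrix (Fin 2) (Fin 2) ℝ :=
  Matrix.of fun i j ↦ γ a (coordVec i) (coordVec j)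

/-- The Christoffel symbols `Γᵏᵢⱼ = ½ γᵏˡ (∂ᵢ γⱼₗ + ∂ⱼ γᵢₗ - ∂ₗ γᵢⱼ)`. -/
noncomputable def christoffel (k i j : Fin 2) (a : E2) : ℝ :=
  (1 / 2 : ℝ) * ∑ l, (γ.gram a)⁻¹ k l *
    (partialD i (fun b ↦ γ.gram b j l) a + partialD j (fun b ↦ γ.gram b i l) a
      - partialD l (fun b ↦ γ.gram b i j) a)

/-- The components of the Riemann tensor, `R(∂ᵢ, ∂ⱼ) ∂ₖ = ∑ l, (riemann l k i j) ∂ₗ`. -/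
noncomputable def riemann (l k i j : Fin 2) (a : E2) : ℝ :=
  partialD i (γ.christoffel l j k) a - partialD j (γ.christoffel l i k) a
    + ∑ m, (γ.christoffel l i m a * γ.christoffel m j k a
      - γ.christoffel l j m a * γ.christoffel m i k a)

/-- The curvature `γ(R(∂₀, ∂₁) ∂₁, ∂₀) / det γ` of the surface (half of its scalar curvature). -/
noncomputable def gaussCurvature (a : E2) : ℝ :=
  (∑ l, γ.gram a 0 l * γ.riemann l 1 0 1 a) / (γ.gram a).det

/-- The surface `(S, γ)` has constant curvature. -/
def HasConstantCurvatureOn (S : Set E2) : Prop :=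
  ∃ c : ℝ, ∀ a ∈ S, γ.gaussCurvature a = c

end PlaneForm

/-- The warped product `e^w γ₀ + γ₁` on `ℝ² × ℝ²`, with `w` a function on the second factor: its
value at the point `q`, on the tangent vectors `u` and `v`. -/
noncomputable def warpedProduct (w : E2 → ℝ) (γ₀ γ₁ : PlaneForm) (q u v : E2 × E2) : ℝ :=
  Real.exp (w q.2) * γ₀ q.1 u.1 v.1 + γ₁ q.2 u.2 v.2

end Surface

/-!
The orbits of `K` and `ξ` are Lorentzian surfaces. The proof completes `K` to a frame of their tangent
planes and shows that this frame consists of two coordinate fields of a chart in which the metric is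
visibly a warped product.

**The frame.** Near a point, let `F` be tangent to the orbits, orthogonal to `K`, with
`g(F, F) = -g(K, K) = P`, and write `ξ = a F + b K`. On an open set where `a = 0`, `ξ` is a
constant multiple of `K` (`fderiv_eq_zero_of_isKillingOn_smul`), and then so is every field that `K`
and `ξ` generate, which contradicts two-dimensionality (`exists_ne_smul_of_finrank`). So `a ≠ 0` on a
dense set, and identities between continuous functions need to be checked only there. This is the
structure `AdaptedFrame`, and `exists_adaptedFrame` constructs it.

**The frame is integrable, and so is its normal bundle.** For a hypersurface-orthogonal Killing field
`X`, the one-form `X♭ / g(X, X)` is closed (`fderiv_normalized_flat_symm`). For `X = K` it is the form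
`τ` dual to `K`, and for `X = ξ` it is a combination of `τ` and of the form `θ` dual to `F`, with
coefficients depending on `a` and `b`. As `b` is constant in normal directions because `ξ` is Killing
(`AdaptedFrame.normal_b`), this makes `θ` closed too and `a` constant in normal directions
(`AdaptedFrame.theta_closed`, `AdaptedFrame.normal_a`). Moreover `K` and `F` commute
(`AdaptedFrame.commute`). Primitives of `τ` and `θ` are two coordinates `t` and `x`, and two first
integrals `y` of the commuting fields (`exists_first_integrals`) complete them to a chart with
`K = ∂ₜ`, `F = ∂ₓ` and `∂_y` normal to both (`AdaptedFrame.exists_chart`). The first integrals require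
flows that depend smoothly on the initial point; `exists_commuting_flow` obtains the flow of both
fields at once, by the inverse function theorem in the Banach space of curves on `[0, 1]`.

**The metric.** In this chart `g = P (-dt² + dx²) + γ₁`. The function `∂ₓ log P` equals `-2 ∂ₓ a / a`
where `a ≠ 0`, so it is independent of `y`; as `∂ₜ P = 0`, `log P` is the sum of a function of `x` and
of a function `w` of `y` (`IsAdaptedChart.log_P_eq`). The Killing equations on normal vectors give that
`γ₁` depends on `y` only (`IsAdaptedChart.normal_metric_eq`). On a slice of constant `y`, `ξ` is a
Killing field of `P (-dt² + dx²)`. With `ℓ = ∂ₓ log P`, compatibility of the Killing equations is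
`ℓ'' = ℓ ℓ'` (`killing_compatibility`), which says that `ℓ' / P`, and with it the curvature, is constant
(`hasConstantCurvatureOn_conformalForm`, `IsAdaptedChart.constantCurvature`).

All of this takes place in an open set of a vector space; the translation of the hypotheses to a chart
of the manifold is the content of the lemmas on `IsSmoothChart`.
-/

/-! ### Composition operators on spaces of curves -/

section Superposition

open Set

variable {X : Type*} [TopologicalSpace X] [CompactSpace X]
  {E F : Type} [NormedAddCommGroup E] [NormedSpace ℝ E] [NormedAddCommGroup F] [NormedSpace ℝ F]

/-- Pointwise application of a curve of operators to a curve of vectors, as a continuous bilinear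
map. -/
noncomputable def pointwiseApply (X E F : Type*) [TopologicalSpace X] [CompactSpace X]
    [NormedAddCommGroup E] [NormedSpace ℝ E] [NormedAddCommGroup F] [NormedSpace ℝ F] :
    C(X, E →L[ℝ] F) →L[ℝ] C(X, E) →L[ℝ] C(X, F) :=
  LinearMap.mkContinuous₂
    (LinearMap.mk₂ ℝ (fun (A : C(X, E →L[ℝ] F)) (β : C(X, E)) ↦
        (⟨fun s ↦ A s (β s), A.continuous.clm_apply β.continuous⟩ : C(X, F)))
      (fun A B β ↦ by ext s; simp) (fun c A β ↦ by ext s; simp)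
      (fun A β γ ↦ by ext s; simp) (fun c A β ↦ by ext s; simp)) 1 (fun A β ↦ by
        rw [one_mul, ContinuousMap.norm_le _ (by positivity)]
        exact fun s ↦ ((A s).le_opNorm _).trans
          (by gcongr <;> exact ContinuousMap.norm_coe_le_norm _ s))

@[simp] lemma pointwiseApply_apply (A : C(X, E →L[ℝ] F)) (β : C(X, E)) (s : X) :
    pointwiseApply X E F A β s = A s (β s) := rfl

/-- Composition with a differentiable map is differentiable, and its derivative is pointwise
application of the derivative of the map. -/
lemma hasFDerivAt_superposition {f : C(E, F)} (hf : ContDiff ℝ 1 f) (α : C(X, E)) :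
    HasFDerivAt (fun β : C(X, E) ↦ f.comp β)
      (pointwiseApply X E F
        ((⟨fderiv ℝ f, hf.continuous_fderiv one_ne_zero⟩ : C(E, E →L[ℝ] F)).comp α)) α := by
  have hc : ContinuousAt (fun β : C(X, E) ↦
      (⟨fderiv ℝ f, hf.continuous_fderiv one_ne_zero⟩ : C(E, E →L[ℝ] F)).comp β) α :=
    (ContinuousMap.continuous_postcomp _).continuousAt
  rw [hasFDerivAt_iff_isLittleO, Asymptotics.isLittleO_iff]
  intro c hc0
  obtain ⟨δ, hδ, H⟩ := (Metric.continuousAt_iff (α := C(X, E)) (β := C(X, E →L[ℝ] F))).1 hc c hc0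
  filter_upwards [Metric.ball_mem_nhds α hδ] with β hβ
  rw [ContinuousMap.norm_le _ (by positivity)]
  intro s
  have hball : ∀ y ∈ Metric.ball (α s) δ, ‖fderiv ℝ f y - fderiv ℝ f (α s)‖ ≤ c := by
    intro y hy
    -- translating the whole curve reduces a pointwise bound to continuity of composition
    have h1 : dist (α + ContinuousMap.const X (y - α s)) α < δ := by
      rw [dist_eq_norm, add_sub_cancel_left, ContinuousMap.norm_lt_iff _ hδ]
      intro _
      simpa [dist_eq_norm] using hy
    have h2 := (ContinuousMap.dist_apply_le_dist s).trans_lt (H h1)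
    simpa [dist_eq_norm] using h2.le
  have hβs : β s ∈ Metric.ball (α s) δ := (ContinuousMap.dist_apply_le_dist s).trans_lt hβ
  have := (convex_ball (α s) δ).norm_image_sub_le_of_norm_hasFDerivWithin_le' (f := f)
    (f' := fderiv ℝ f) (φ := fderiv ℝ f (α s)) (C := c)
    (fun y _ ↦ ((hf.differentiable one_ne_zero) y).hasFDerivAt.hasFDerivWithinAt) hball
    (Metric.mem_ball_self hδ) hβs
  calc _ ≤ c * ‖β s - α s‖ := by simpa using this
    _ ≤ c * ‖β - α‖ := by
      gcongr
      exact (β - α).norm_coe_le_norm s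

/-- Composition with a smooth map is a smooth operator on the space of continuous curves. -/
lemma contDiff_superposition (n : ℕ) : ∀ {F : Type} [NormedAddCommGroup F] [NormedSpace ℝ F]
    {f : C(E, F)} (_ : ContDiff ℝ n f), ContDiff ℝ n (fun β : C(X, E) ↦ f.comp β) := by
  induction n with
  | zero =>
    intro F _ _ f hf
    rw [Nat.cast_zero, contDiff_zero]
    exact ContinuousMap.continuous_postcomp _
  | succ n ih =>
    intro F _ _ f hf
    have h1 : ContDiff ℝ 1 f := hf.of_le (by simp)
    have hd : ContDiff ℝ n (fderiv ℝ f) := hf.fderiv_right (by simp)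
    rw [Nat.cast_succ, contDiff_succ_iff_hasFDerivAt]
    exact ⟨_, (pointwiseApply X E F).contDiff.comp
      (ih (f := ⟨fderiv ℝ f, h1.continuous_fderiv one_ne_zero⟩) hd), hasFDerivAt_superposition h1⟩

lemma contDiff_superposition_infty {f : C(E, F)} (hf : ContDiff ℝ ∞ f) :
    ContDiff ℝ ∞ (fun β : C(X, E) ↦ f.comp β) :=
  contDiff_infty.2 fun n ↦ contDiff_superposition n (contDiff_infty.1 hf n)

end Superposition

/-! ### Simultaneous integration of two commuting vector fields -/

section Primitive

open Set

variable {E : Type} [NormedAddCommGroup E] [NormedSpace ℝ E] [CompleteSpace E]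

/-- The extension of a curve on `[0, 1]` to the whole line, constant outside the interval. -/
noncomputable def extendCurve (β : C(Icc (0 : ℝ) 1, E)) (s : ℝ) : E :=
  β (projIcc 0 1 zero_le_one s)

omit [NormedSpace ℝ E] [CompleteSpace E] in
lemma continuous_extendCurve (β : C(Icc (0 : ℝ) 1, E)) : Continuous (extendCurve β) :=
  β.continuous.comp continuous_projIcc

omit [NormedSpace ℝ E] [CompleteSpace E] in
lemma extendCurve_coe (β : C(Icc (0 : ℝ) 1, E)) (s : Icc (0 : ℝ) 1) : extendCurve β s = β s := by
  simp [extendCurve]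

/-- The primitive `s ↦ ∫₀ˢ β` of a curve, as a continuous linear operator. -/
noncomputable def primitiveCLM (E : Type) [NormedAddCommGroup E] [NormedSpace ℝ E]
    [CompleteSpace E] : C(Icc (0 : ℝ) 1, E) →L[ℝ] C(Icc (0 : ℝ) 1, E) :=
  LinearMap.mkContinuous
    { toFun := fun β ↦ ⟨fun s ↦ ∫ r in (0 : ℝ)..s, extendCurve β r,
        ((intervalIntegral.continuous_primitive
          (fun a b ↦ (continuous_extendCurve β).intervalIntegrable a b) 0).comp
          continuous_subtype_val)⟩
      map_add' := fun β γ ↦ by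
        ext s
        exact intervalIntegral.integral_add ((continuous_extendCurve β).intervalIntegrable _ _)
          ((continuous_extendCurve γ).intervalIntegrable _ _)
      map_smul' := fun c β ↦ by
        ext s
        exact intervalIntegral.integral_smul c _ } 1 (fun β ↦ by
      rw [one_mul, ContinuousMap.norm_le _ (norm_nonneg _)]
      intro s
      refine (intervalIntegral.norm_integral_le_of_norm_le_const (C := ‖β‖)
        (fun r _ ↦ β.norm_coe_le_norm _)).trans ?_
      have h1 := s.2.1
      have h2 := s.2.2
      rw [sub_zero, abs_of_nonneg h1]
      nlinarith [norm_nonneg β])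

lemma primitiveCLM_apply (β : C(Icc (0 : ℝ) 1, E)) (s : Icc (0 : ℝ) 1) :
    primitiveCLM E β s = ∫ r in (0 : ℝ)..s, extendCurve β r := rfl

lemma hasDerivAt_primitive (β : C(Icc (0 : ℝ) 1, E)) (s : ℝ) :
    HasDerivAt (fun s ↦ ∫ r in (0 : ℝ)..s, extendCurve β r) (extendCurve β s) s :=
  intervalIntegral.integral_hasDerivAt_right ((continuous_extendCurve β).intervalIntegrable _ _)
    ((continuous_extendCurve β).stronglyMeasurableAtFilter _ _) (continuous_extendCurve β).continuousAt

/-- The fundamental theorem of calculus: a curve with derivative `β` is its initial value plus the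
primitive of `β`. -/
lemma primitiveCLM_eq_of_hasDerivAt {β γ : C(Icc (0 : ℝ) 1, E)} {c : ℝ → E}
    (hc : ∀ s ∈ Icc (0 : ℝ) 1, HasDerivAt c (extendCurve β s) s)
    (hγ : ∀ s : Icc (0 : ℝ) 1, γ s = c s) (h0 : c 0 = 0) : primitiveCLM E β = γ := by
  ext s
  rw [primitiveCLM_apply, intervalIntegral.integral_eq_sub_of_hasDerivAt (f := c)
    (fun r hr ↦ hc r ?_) ((continuous_extendCurve β).intervalIntegrable _ _), h0, sub_zero, hγ]
  rw [uIcc_of_le s.2.1] at hr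
  exact ⟨hr.1, hr.2.trans s.2.2⟩

end Primitive

section LocalInverse

variable {A B : Type*} [NormedAddCommGroup A] [NormedSpace ℝ A] [CompleteSpace A]
  [NormedAddCommGroup B] [NormedSpace ℝ B]

/-- The inverse function theorem for `C^∞` maps, with smoothness of the inverse and invertibility
of the derivative on the whole domain of the local inverse, which may be taken inside a given
open set. -/
lemma exists_smooth_openPartialHomeomorph {f : A → B} {U : Set A} (hU : IsOpen U)
    (hf : ContDiffOn ℝ ∞ f U) {a : A} (ha : a ∈ U) {f' : A ≃L[ℝ] B}
    (hf' : HasFDerivAt f (f' : A →L[ℝ] B) a) :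
    ∃ e : OpenPartialHomeomorph A B, a ∈ e.source ∧ e.source ⊆ U ∧ (∀ x, e x = f x) ∧
      ContDiffOn ℝ ∞ e.symm e.target ∧
      ∀ x ∈ e.source, ∃ L : A ≃L[ℝ] B, HasFDerivAt f (L : A →L[ℝ] B) x ∧
        HasFDerivAt e.symm (L.symm : B →L[ℝ] A) (f x) := by
  have hne : (∞ : ℕ∞ω) ≠ 0 := by simp
  have hfa : ContDiffAt ℝ ∞ f a := hf.contDiffAt (hU.mem_nhds ha)
  set e₀ := hfa.toOpenPartialHomeomorph f hf' hne with he₀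
  have hcont : ContinuousOn (fderiv ℝ f) U := hf.continuousOn_fderiv_of_isOpen hU (by simp)
  have hV : IsOpen (U ∩ fderiv ℝ f ⁻¹' Set.range ((↑) : (A ≃L[ℝ] B) → A →L[ℝ] B)) :=
    hcont.isOpen_inter_preimage hU ContinuousLinearEquiv.isOpen
  set e := e₀.restrOpen _ hV
  have hex : ∀ x, e x = f x := fun x ↦ rfl
  have key : ∀ x ∈ e.source, ∃ L : A ≃L[ℝ] B, HasFDerivAt f (L : A →L[ℝ] B) x ∧
        HasFDerivAt e.symm (L.symm : B →L[ℝ] A) (f x) ∧ ContDiffAt ℝ ∞ e.symm (f x) := by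
    intro x hx
    have hx' : x ∈ e.source := hx
    obtain ⟨-, hxU, L, hL⟩ := hx
    have hd : HasFDerivAt f (L : A →L[ℝ] B) x := by
      rw [hL]
      exact ((hf.contDiffAt (hU.mem_nhds hxU)).differentiableAt hne).hasFDerivAt
    have hsx : e.symm (f x) = x := e.left_inv hx'
    have htx : f x ∈ e.target := e.map_source hx'
    refine ⟨L, hd, e.hasFDerivAt_symm htx (by rw [hsx]; exact hd),
      e.contDiffAt_symm (f₀' := L) htx (by rw [hsx]; exact hd) ?_⟩
    rw [hsx]
    exact hf.contDiffAt (hU.mem_nhds hxU)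
  refine ⟨e, ⟨hfa.mem_toOpenPartialHomeomorph_source hf' hne, ha, f', hf'.fderiv.symm⟩,
    fun x hx ↦ hx.2.1, hex, fun y hy ↦ ?_, fun x hx ↦ ?_⟩
  · obtain ⟨L, -, -, h⟩ := key _ (e.map_target hy)
    rw [← hex, e.right_inv hy] at h
    exact h.contDiffWithinAt
  · obtain ⟨L, h1, h2, -⟩ := key x hx
    exact ⟨L, h1, h2⟩

end LocalInverse

section ImplicitFamily

open Set Topology

variable {E C : Type*} [NormedAddCommGroup E] [NormedSpace ℝ E] [CompleteSpace E]
  [NormedAddCommGroup C] [NormedSpace ℝ C] [CompleteSpace C]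

/-- The equation `α = c x + l₁ 𝒦 α + l₂ ℱ α` in a Banach space has, for `(l₁, l₂)` near zero, a
solution `α` that depends smoothly on `((l₁, l₂), x)`. Any solution of the linearized equation in
the direction `(m, 0)` is the derivative of `α` in that direction. -/
lemma exists_smooth_solution_family (c : E →L[ℝ] C) {𝒦 ℱ : C → C} (hK : ContDiff ℝ ∞ 𝒦)
    (hF : ContDiff ℝ ∞ ℱ) (p : E) {U : Set C} (hU : IsOpen U) (hp : c p ∈ U) :
    ∃ (V : Set ((ℝ × ℝ) × E)) (A : (ℝ × ℝ) × E → C), IsOpen V ∧ ((0, 0), p) ∈ V ∧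
      ContDiffOn ℝ ∞ A V ∧ ∀ q ∈ V, A q ∈ U ∧
        A q = c q.2 + q.1.1 • 𝒦 (A q) + q.1.2 • ℱ (A q) ∧
        ∀ (m : ℝ × ℝ) (β : C), β = (q.1.1 • fderiv ℝ 𝒦 (A q) β + m.1 • 𝒦 (A q)) +
          (q.1.2 • fderiv ℝ ℱ (A q) β + m.2 • ℱ (A q)) → fderiv ℝ A q (m, 0) = β := by
  set H : (ℝ × ℝ) × E × C → C := fun q ↦ q.2.2 - c q.2.1 - q.1.1 • 𝒦 q.2.2 - q.1.2 • ℱ q.2.2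
    with hH
  have hHs : ContDiff ℝ ∞ H := by
    have hα : ContDiff ℝ ∞ (fun q : (ℝ × ℝ) × E × C ↦ q.2.2) := contDiff_snd.snd
    exact ((hα.sub (c.contDiff.comp contDiff_snd.fst)).sub
      (contDiff_fst.fst.smul (hK.comp hα))).sub (contDiff_fst.snd.smul (hF.comp hα))
  have hHd : ∀ (q : (ℝ × ℝ) × E × C) (m : ℝ × ℝ) (v : E) (β : C), fderiv ℝ H q (m, v, β) =
      β - c v - (q.1.1 • fderiv ℝ 𝒦 q.2.2 β + m.1 • 𝒦 q.2.2)
        - (q.1.2 • fderiv ℝ ℱ q.2.2 β + m.2 • ℱ q.2.2) := by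
    intro q m v β
    have h1 := (hasFDerivAt_snd (𝕜 := ℝ) (E := ℝ × ℝ) (F := E × C) (p := q)).snd
    have h2 : HasFDerivAt (fun q : (ℝ × ℝ) × E × C ↦ c q.2.1) _ q :=
      c.hasFDerivAt.comp q hasFDerivAt_snd.fst
    have h3 := (hasFDerivAt_fst (𝕜 := ℝ) (E := ℝ × ℝ) (F := E × C) (p := q)).fst
    have h4 := (hasFDerivAt_fst (𝕜 := ℝ) (E := ℝ × ℝ) (F := E × C) (p := q)).snd
    have h5 : HasFDerivAt (fun q : (ℝ × ℝ) × E × C ↦ 𝒦 q.2.2) _ q :=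
      ((hK.differentiable (by simp)) q.2.2).hasFDerivAt.comp q h1
    have h6 : HasFDerivAt (fun q : (ℝ × ℝ) × E × C ↦ ℱ q.2.2) _ q :=
      ((hF.differentiable (by simp)) q.2.2).hasFDerivAt.comp q h1
    have h7 : HasFDerivAt H _ q := ((h1.sub h2).sub (h3.smul h5)).sub (h4.smul h6)
    rw [h7.fderiv]
    simp
  set T : (ℝ × ℝ) × E × C → (ℝ × ℝ) × E × C := fun q ↦ (q.1, q.2.1, H q) with hT
  have hTs : ContDiff ℝ ∞ T := contDiff_fst.prodMk (contDiff_snd.fst.prodMk hHs)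
  have hTd : ∀ q, HasFDerivAt T ((ContinuousLinearMap.fst ℝ _ _).prod
      ((ContinuousLinearMap.fst ℝ _ _ ∘L ContinuousLinearMap.snd ℝ _ _).prod (fderiv ℝ H q))) q :=
    fun q ↦ hasFDerivAt_fst.prodMk (hasFDerivAt_snd.fst.prodMk
      ((hHs.differentiable (by simp)) q).hasFDerivAt)
  set q₀ : (ℝ × ℝ) × E × C := ((0, 0), p, c p) with hq₀
  set T' : ((ℝ × ℝ) × E × C) ≃L[ℝ] ((ℝ × ℝ) × E × C) := ContinuousLinearEquiv.equivOfInverse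
    ((ContinuousLinearMap.fst ℝ _ _).prod
      ((ContinuousLinearMap.fst ℝ _ _ ∘L ContinuousLinearMap.snd ℝ _ _).prod (fderiv ℝ H q₀)))
    ((ContinuousLinearMap.fst ℝ _ _).prod
      ((ContinuousLinearMap.fst ℝ _ _ ∘L ContinuousLinearMap.snd ℝ _ _).prod
        ((ContinuousLinearMap.snd ℝ _ _ ∘L ContinuousLinearMap.snd ℝ _ _) +
          c ∘L (ContinuousLinearMap.fst ℝ _ _ ∘L ContinuousLinearMap.snd ℝ _ _)
          + (ContinuousLinearMap.fst ℝ ℝ ℝ ∘L ContinuousLinearMap.fst ℝ _ _).smulRight (𝒦 (c p))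
          + (ContinuousLinearMap.snd ℝ ℝ ℝ ∘L ContinuousLinearMap.fst ℝ _ _).smulRight
            (ℱ (c p)))))
    (fun q ↦ by
      obtain ⟨m, v, β⟩ := q
      simp only [ContinuousLinearMap.prod_apply, hHd]
      simp [hq₀]
      abel)
    (fun q ↦ by
      obtain ⟨m, v, β⟩ := q
      simp only [ContinuousLinearMap.prod_apply]
      simp [hHd, hq₀]
      abel) with hT'
  obtain ⟨e, he₀, heU, heT, hes, hed⟩ := exists_smooth_openPartialHomeomorph
    (U := {q : (ℝ × ℝ) × E × C | q.2.2 ∈ U}) (hU.preimage (continuous_snd.snd)) hTs.contDiffOn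
    (a := q₀) hp (f' := T') (hTd q₀)
  set ι : (ℝ × ℝ) × E → (ℝ × ℝ) × E × C := fun q ↦ (q.1, q.2, 0) with hι
  have hιs : ContDiff ℝ ∞ ι := contDiff_fst.prodMk (contDiff_snd.prodMk contDiff_const)
  have hTq₀ : T q₀ = ((0, 0), p, 0) := by simp [hT, hH, hq₀]
  refine ⟨ι ⁻¹' e.target, fun q ↦ (e.symm (ι q)).2.2, e.open_target.preimage hιs.continuous, ?_,
    contDiff_snd.snd.comp_contDiffOn (hes.comp hιs.contDiffOn fun q hq ↦ hq), fun q hq ↦ ?_⟩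
  · have := e.map_source he₀
    rwa [heT, hTq₀] at this
  · have hsrc := e.map_target hq
    have hinv : T (e.symm (ι q)) = ι q := by rw [← heT, e.right_inv hq]
    set r := e.symm (ι q) with hr
    have hr1 : r.1 = q.1 := congrArg Prod.fst hinv
    have hr2 : r.2.1 = q.2 := congrArg (fun x ↦ x.2.1) hinv
    have hr3 : H r = 0 := congrArg (fun x ↦ x.2.2) hinv
    refine ⟨heU hsrc, ?_, fun m β hβ ↦ ?_⟩
    · rw [hH] at hr3
      simp only [hr1, hr2] at hr3
      rw [← sub_eq_zero, ← hr3]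
      abel
    · obtain ⟨L, hL, hLs⟩ := hed r hsrc
      rw [hinv] at hLs
      have hιd : HasFDerivAt ι ((ContinuousLinearMap.fst ℝ _ _).prod
          ((ContinuousLinearMap.snd ℝ _ _).prod 0)) q :=
        hasFDerivAt_fst.prodMk (hasFDerivAt_snd.prodMk (hasFDerivAt_const _ _))
      have hd := ((hLs.comp q hιd).snd).snd
      have hLe : L (m, 0, β) = (m, 0, 0) := by
        have h := (hTd r).unique hL
        rw [← ContinuousLinearEquiv.coe_coe, ← h]
        simp only [ContinuousLinearMap.prod_apply, hHd, hr1]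
        have : β - c 0 - (q.1.1 • fderiv ℝ 𝒦 r.2.2 β + m.1 • 𝒦 r.2.2)
            - (q.1.2 • fderiv ℝ ℱ r.2.2 β + m.2 • ℱ r.2.2) = 0 := by
          nth_rewrite 1 [hβ]
          rw [map_zero]
          abel
        simpa using this
      have hf : HasFDerivAt (fun q ↦ (e.symm (ι q)).2.2) _ q := hd
      rw [hf.fderiv]
      simp [L.symm_apply_eq.2 hLe.symm]

end ImplicitFamily

section CommutingFlow

open Set Topology

variable {E : Type} [NormedAddCommGroup E] [NormedSpace ℝ E] [CompleteSpace E]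

/-- The constant curves, as a continuous linear map. -/
noncomputable def constCurveCLM (E : Type) [NormedAddCommGroup E] [NormedSpace ℝ E] :
    E →L[ℝ] C(Icc (0 : ℝ) 1, E) :=
  LinearMap.mkContinuous
    { toFun := fun x ↦ ContinuousMap.const _ x
      map_add' := fun _ _ ↦ rfl
      map_smul' := fun _ _ ↦ rfl } 1 (fun x ↦ by
      rw [one_mul, ContinuousMap.norm_le _ (norm_nonneg _)]
      exact fun _ ↦ le_rfl)

omit [CompleteSpace E] in
@[simp] lemma constCurveCLM_apply (x : E) (s : Icc (0 : ℝ) 1) : constCurveCLM E x s = x := rfl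

/-- The integral `s ↦ ∫₀ˢ K(α)` of a vector field along a curve. -/
noncomputable def integralAlong (K : C(E, E)) (α : C(Icc (0 : ℝ) 1, E)) : C(Icc (0 : ℝ) 1, E) :=
  primitiveCLM E (K.comp α)

lemma contDiff_integralAlong {K : C(E, E)} (hK : ContDiff ℝ ∞ K) :
    ContDiff ℝ ∞ (integralAlong K) :=
  (primitiveCLM E).contDiff.comp (contDiff_superposition_infty hK)

/-- The derivative of `K` along a curve, as a curve of operators. -/
noncomputable def fderivAlong {K : C(E, E)} (hK : ContDiff ℝ ∞ K) (α : C(Icc (0 : ℝ) 1, E)) :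
    C(Icc (0 : ℝ) 1, E →L[ℝ] E) :=
  (⟨fderiv ℝ K, hK.continuous_fderiv (by simp)⟩ : C(E, E →L[ℝ] E)).comp α

omit [CompleteSpace E] in
@[simp] lemma fderivAlong_apply {K : C(E, E)} (hK : ContDiff ℝ ∞ K) (α : C(Icc (0 : ℝ) 1, E))
    (s : Icc (0 : ℝ) 1) : fderivAlong hK α s = fderiv ℝ K (α s) := rfl

lemma fderiv_integralAlong {K : C(E, E)} (hK : ContDiff ℝ ∞ K) (α β : C(Icc (0 : ℝ) 1, E)) :
    fderiv ℝ (integralAlong K) α β =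
      primitiveCLM E (pointwiseApply _ E E (fderivAlong hK α) β) := by
  have h : HasFDerivAt (integralAlong K) _ α := (primitiveCLM E).hasFDerivAt.comp α
    (hasFDerivAt_superposition (hK.of_le (by simp)) α)
  rw [h.fderiv]
  rfl

/-- If `K` and `F` commute along an integral curve `α` of `l₁ K + l₂ F`, then the curve
`s ↦ s • (m₁ K + m₂ F) (α s)` solves the equation that governs the variation of `α` with respect to
`(l₁, l₂)` in the direction `m`. -/
lemma variation_eq {K F : C(E, E)} (hK : ContDiff ℝ ∞ K) (hF : ContDiff ℝ ∞ F)
    {l₁ l₂ : ℝ} {x : E} {α : C(Icc (0 : ℝ) 1, E)}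
    (hα : α = constCurveCLM E x + l₁ • integralAlong K α + l₂ • integralAlong F α)
    (hcomm : ∀ s, fderiv ℝ K (α s) (F (α s)) = fderiv ℝ F (α s) (K (α s)))
    (m : ℝ × ℝ) {β : C(Icc (0 : ℝ) 1, E)}
    (hβ : β = ⟨fun s : Icc (0 : ℝ) 1 ↦ (s : ℝ) • (m.1 • K (α s) + m.2 • F (α s)), by fun_prop⟩) :
    β = (l₁ • fderiv ℝ (integralAlong K) α β + m.1 • integralAlong K α) +
          (l₂ • fderiv ℝ (integralAlong F) α β + m.2 • integralAlong F α) := by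
  rw [fderiv_integralAlong hK, fderiv_integralAlong hF]
  set δ : C(Icc (0 : ℝ) 1, E) := l₁ • K.comp α + l₂ • F.comp α with hδ
  -- the integral curve, extended to the line with the same derivative
  set c : ℝ → E := fun s ↦ x + ∫ r in (0 : ℝ)..s, extendCurve δ r with hc
  have hcd : ∀ s, HasDerivAt c (extendCurve δ s) s := fun s ↦
    (hasDerivAt_primitive δ s).const_add x
  have hcα : ∀ s : Icc (0 : ℝ) 1, α s = c s := by
    intro s
    have h2 : ∫ r in (0 : ℝ)..s, extendCurve δ r =
        l₁ • integralAlong K α s + l₂ • integralAlong F α s := by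
      rw [← primitiveCLM_apply, hδ, map_add, map_smul, map_smul]
      rfl
    rw [hc]
    simp only
    rw [h2]
    conv_lhs => rw [hα]
    rw [← add_assoc]
    rfl
  have key : primitiveCLM E (l₁ • pointwiseApply _ E E (fderivAlong hK α) β + m.1 • K.comp α
      + (l₂ • pointwiseApply _ E E (fderivAlong hF α) β + m.2 • F.comp α)) = β := by
    refine primitiveCLM_eq_of_hasDerivAt (c := fun s ↦ s • (m.1 • K (c s) + m.2 • F (c s)))
      (fun s hs ↦ ?_) (fun s ↦ ?_) (by simp)
    · have hKd := ((hK.differentiable (by simp)) (c s)).hasFDerivAt.comp_hasDerivAt s (hcd s)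
      have hFd := ((hF.differentiable (by simp)) (c s)).hasFDerivAt.comp_hasDerivAt s (hcd s)
      have := (hasDerivAt_id s).smul ((hKd.const_smul m.1).add (hFd.const_smul m.2))
      convert! this using 1
      have e1 : ∀ γ : C(Icc (0 : ℝ) 1, E), extendCurve γ s = γ ⟨s, hs⟩ := fun γ ↦
        extendCurve_coe γ ⟨s, hs⟩
      have e2 : α ⟨s, hs⟩ = c s := hcα ⟨s, hs⟩
      have e3 := hcomm ⟨s, hs⟩
      rw [e2] at e3
      rw [e1, e1]
      simp [hβ, hδ, e2, e3]
      module
    · rw [hβ]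
      simp [hcα]
  conv_lhs => rw [← key]
  simp only [map_add, map_smul]
  rfl

/-- Two commuting vector fields integrate to a smooth family of surfaces
`(l₁, l₂) ↦ Ψ ((l₁, l₂), x)`, through every point `x` near `p`, whose coordinate fields are the
given vector fields: `Ψ ((l₁, l₂), x)` is the value at time `1` of the integral curve of
`l₁ K + l₂ F` that starts at `x`. -/
theorem exists_commuting_flow {K F : E → E} (hK : ContDiff ℝ ∞ K) (hF : ContDiff ℝ ∞ F) {p : E}
    {N : Set E} (hN : N ∈ 𝓝 p) (hcomm : ∀ z ∈ N, fderiv ℝ K z (F z) = fderiv ℝ F z (K z)) :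
    ∃ (V : Set ((ℝ × ℝ) × E)) (Ψ : (ℝ × ℝ) × E → E), IsOpen V ∧ ((0, 0), p) ∈ V ∧
      ContDiffOn ℝ ∞ Ψ V ∧ (∀ x, ((0, 0), x) ∈ V → Ψ ((0, 0), x) = x) ∧
      ∀ q ∈ V, ∀ m : ℝ × ℝ, fderiv ℝ Ψ q (m, 0) = m.1 • K (Ψ q) + m.2 • F (Ψ q) := by
  set K' : C(E, E) := ⟨K, hK.continuous⟩
  set F' : C(E, E) := ⟨F, hF.continuous⟩
  obtain ⟨ε, hε, hball⟩ := Metric.mem_nhds_iff.1 hN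
  obtain ⟨V, A, hV, hpV, hA, h⟩ := exists_smooth_solution_family (constCurveCLM E)
    (contDiff_integralAlong (K := K') hK) (contDiff_integralAlong (K := F') hF) p
    (Metric.isOpen_ball (x := constCurveCLM E p) (ε := ε)) (Metric.mem_ball_self hε)
  set ev : C(Icc (0 : ℝ) 1, E) →L[ℝ] E := ContinuousMap.evalCLM ℝ ⟨1, by simp⟩ with hev
  have hevd : ∀ q ∈ V, fderiv ℝ (fun q ↦ ev (A q)) q = ev ∘L fderiv ℝ A q := fun q hq ↦
    (ev.hasFDerivAt.comp q
      ((hA.contDiffAt (hV.mem_nhds hq)).differentiableAt (by simp)).hasFDerivAt).fderiv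
  refine ⟨V, fun q ↦ ev (A q), hV, hpV, ev.contDiff.comp_contDiffOn hA, fun x hx ↦ ?_,
    fun q hq m ↦ ?_⟩
  · obtain ⟨-, h2, -⟩ := h _ hx
    simp only [zero_smul, add_zero] at h2
    simp only [h2]
    rfl
  · obtain ⟨h1, h2, h3⟩ := h q hq
    have hc : ∀ s, fderiv ℝ K' (A q s) (F' (A q s)) = fderiv ℝ F' (A q s) (K' (A q s)) := by
      refine fun s ↦ hcomm _ (hball ?_)
      exact (ContinuousMap.dist_apply_le_dist (f := A q) (g := constCurveCLM E p) s).trans_lt h1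
    rw [hevd q hq, ContinuousLinearMap.comp_apply,
      h3 m _ (variation_eq (K := K') (F := F') hK hF h2 hc m rfl)]
    simp [hev, K', F']

end CommutingFlow

/-! ### The Frobenius theorem for two commuting fields -/

section FirstIntegrals

open Set Topology

variable {E : Type} [NormedAddCommGroup E] [NormedSpace ℝ E] [FiniteDimensional ℝ E]

/-- A vector field that is smooth near a point agrees near this point with a globally smooth one. -/
lemma exists_contDiff_eventuallyEq {F : Type*} [NormedAddCommGroup F] [NormedSpace ℝ F] {X : E → F}
    {Ω : Set E} (hΩ : IsOpen Ω) (hX : ContDiffOn ℝ ∞ X Ω) {p : E} (hp : p ∈ Ω) :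
    ∃ Y : E → F, ContDiff ℝ ∞ Y ∧ Y =ᶠ[𝓝 p] X := by
  obtain ⟨χ, hχ⟩ : ∃ χ : ContDiffBump p, tsupport χ ⊆ Ω := by
    obtain ⟨ε, hε, h⟩ := Metric.isOpen_iff.1 hΩ p hp
    refine ⟨⟨ε / 3, ε / 2, by positivity, by linarith⟩, ?_⟩
    rw [ContDiffBump.tsupport_eq]
    exact (Metric.closedBall_subset_ball (by linarith)).trans h
  refine ⟨fun z ↦ χ z • X z, contDiff_iff_contDiffAt.2 fun z ↦ ?_, ?_⟩
  · by_cases hz : z ∈ Ω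
    · exact χ.contDiffAt.smul (hX.contDiffAt (hΩ.mem_nhds hz))
    · have : (fun z ↦ χ z • X z) =ᶠ[𝓝 z] fun _ ↦ 0 := by
        have hz' : z ∉ tsupport χ := fun h ↦ hz (hχ h)
        filter_upwards [(isClosed_tsupport χ).isOpen_compl.mem_nhds hz'] with y hy
        rw [image_eq_zero_of_notMem_tsupport hy, zero_smul]
      exact contDiffAt_const.congr_of_eventuallyEq this
  · filter_upwards [χ.eventuallyEq_one] with z hz
    simp [hz]

/-- Frobenius theorem for two commuting vector fields in dimension four: near a point where the
fields are independent there is a submersion to the plane whose fibres are the integral surfaces of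
the fields. -/
theorem exists_first_integrals (hdim : Module.finrank ℝ E = 4) {K F : E → E} {Ω : Set E}
    (hΩ : IsOpen Ω) (hK : ContDiffOn ℝ ∞ K Ω) (hF : ContDiffOn ℝ ∞ F Ω)
    (hcomm : ∀ z ∈ Ω, fderiv ℝ K z (F z) = fderiv ℝ F z (K z)) {p : E} (hp : p ∈ Ω)
    (hind : ∀ m : ℝ × ℝ, m.1 • K p + m.2 • F p = 0 → m = 0) :
    ∃ (W : Set E) (η : E → E2), IsOpen W ∧ p ∈ W ∧ W ⊆ Ω ∧ ContDiffOn ℝ ∞ η W ∧ ∀ z ∈ W,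
      fderiv ℝ η z (K z) = 0 ∧ fderiv ℝ η z (F z) = 0 ∧
      ∀ v, fderiv ℝ η z v = 0 → ∃ m : ℝ × ℝ, v = m.1 • K z + m.2 • F z := by
  obtain ⟨K', hK', hKK⟩ := exists_contDiff_eventuallyEq hΩ hK hp
  obtain ⟨F', hF', hFF⟩ := exists_contDiff_eventuallyEq hΩ hF hp
  obtain ⟨N, hN, hNo, hpN⟩ : ∃ N, (∀ z ∈ N, (K' =ᶠ[𝓝 z] K ∧ F' =ᶠ[𝓝 z] F) ∧ z ∈ Ω) ∧ IsOpen N ∧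
      p ∈ N := eventually_nhds_iff.1
    ((hKK.eventuallyEq_nhds.and hFF.eventuallyEq_nhds).and (hΩ.mem_nhds hp))
  obtain ⟨V, Ψ, hV, hpV, hΨ, hΨ0, hΨd⟩ := exists_commuting_flow hK' hF' (hNo.mem_nhds hpN)
    (fun z hz ↦ by
      obtain ⟨⟨h1, h2⟩, h3⟩ := hN z hz
      rw [h1.fderiv_eq, h2.fderiv_eq, h1.eq_of_nhds, h2.eq_of_nhds]
      exact hcomm z h3)
  set T : ℝ × ℝ →ₗ[ℝ] E := (LinearMap.fst ℝ ℝ ℝ).smulRight (K p) +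
    (LinearMap.snd ℝ ℝ ℝ).smulRight (F p) with hT
  have hTapp : ∀ m, T m = m.1 • K p + m.2 • F p := fun m ↦ by simp [hT]
  have hTinj : Function.Injective T := by
    rw [injective_iff_map_eq_zero]
    exact fun m hm ↦ hind m (by rw [← hTapp, hm])
  obtain ⟨C, hC⟩ := T.range.exists_isCompl
  have hCdim : Module.finrank ℝ C = 2 := by
    have h1 := Submodule.finrank_add_eq_of_isCompl hC
    have h2 := LinearMap.finrank_range_of_inj hTinj
    rw [Module.finrank_prod, Module.finrank_self] at h2
    omega
  -- flow out from the affine plane through `p` with direction `C`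
  set σ : (ℝ × ℝ) × C →L[ℝ] (ℝ × ℝ) × E := (ContinuousLinearMap.id ℝ _).prodMap C.subtypeL with hσ
  set f : (ℝ × ℝ) × C → E := fun q ↦ Ψ (((0, 0), p) + σ q) with hf
  set U : Set ((ℝ × ℝ) × C) := (fun q ↦ (((0, 0), p) : (ℝ × ℝ) × E) + σ q) ⁻¹' V with hU
  have hsh : ContDiff ℝ ∞ (fun q ↦ (((0, 0), p) : (ℝ × ℝ) × E) + σ q) :=
    contDiff_const.add σ.contDiff
  have hUo : IsOpen U := hV.preimage hsh.continuous
  have hfs : ContDiffOn ℝ ∞ f U := hΨ.comp hsh.contDiffOn fun q hq ↦ hq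
  have hdΨ : ∀ q ∈ V, HasFDerivAt Ψ (fderiv ℝ Ψ q) q := fun q hq ↦
    ((hΨ.contDiffAt (hV.mem_nhds hq)).differentiableAt (by simp)).hasFDerivAt
  have hfd : ∀ q ∈ U, HasFDerivAt f (fderiv ℝ Ψ (((0, 0), p) + σ q) ∘L σ) q := fun q hq ↦
    (hdΨ _ hq).comp q (σ.hasFDerivAt.const_add _)
  have h0U : (0 : (ℝ × ℝ) × C) ∈ U := by
    rw [hU, mem_preimage, map_zero, add_zero]
    exact hpV
  have hΨp : Ψ ((0, 0), p) = p := hΨ0 p hpV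
  have hΨv : ∀ v, fderiv ℝ Ψ ((0, 0), p) (0, v) = v := by
    intro v
    have h1 : HasFDerivAt (fun x ↦ Ψ ((0, 0), x)) _ p :=
      (hdΨ _ hpV).comp p (hasFDerivAt_prodMk_right _ _)
    have h2 : (fun x ↦ Ψ ((0, 0), x)) =ᶠ[𝓝 p] id := by
      have : {x : E | (((0, 0), x) : (ℝ × ℝ) × E) ∈ V} ∈ 𝓝 p :=
        (hV.preimage (by fun_prop : Continuous fun x : E ↦ (((0, 0), x) : (ℝ × ℝ) × E))).mem_nhds hpV
      filter_upwards [this] with x hx using hΨ0 x hx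
    have h3 := h1.unique ((hasFDerivAt_id p).congr_of_eventuallyEq h2)
    simpa using congrArg (fun A : E →L[ℝ] E ↦ A v) h3
  set f' : (ℝ × ℝ) × C →L[ℝ] E := fderiv ℝ Ψ (((0, 0), p) + σ 0) ∘L σ with hf'
  have hf'app : ∀ m c, f' (m, c) = T m + c := by
    intro m c
    have h1 : (m, (c : E)) = (m, 0) + (0, (c : E)) := by simp
    have h2 : f' (m, c) = fderiv ℝ Ψ ((0, 0), p) (m, (c : E)) := by
      rw [hf', map_zero, add_zero]
      rfl
    rw [h2, h1, map_add, hΨv, hΨd _ hpV, hΨp, hKK.eq_of_nhds, hFF.eq_of_nhds, hTapp]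
  have hbij : Function.Bijective f' := by
    have hinj : Function.Injective f' := by
      rw [injective_iff_map_eq_zero]
      rintro ⟨m, c⟩ h
      rw [hf'app] at h
      have h1 : T m ∈ T.range ⊓ C := ⟨⟨m, rfl⟩, by
        rw [eq_neg_of_add_eq_zero_left h]
        exact C.neg_mem c.2⟩
      rw [hC.inf_eq_bot, Submodule.mem_bot] at h1
      have h2 : m = 0 := hTinj (by rw [h1, map_zero])
      rw [h1, zero_add, ZeroMemClass.coe_eq_zero] at h
      simp [h2, h]
    refine ⟨hinj, ?_⟩
    exact (LinearMap.injective_iff_surjective_of_finrank_eq_finrank (f := f'.toLinearMap)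
      (by simp [hCdim, hdim])).1 hinj
  obtain ⟨e, he0, heU, hef, hes, hed⟩ := exists_smooth_openPartialHomeomorph
    (hUo.inter ((hΨ.continuousOn.comp hsh.continuous.continuousOn
      fun q hq ↦ hq).isOpen_inter_preimage hUo hNo)) (hfs.mono inter_subset_left) (a := 0)
    (⟨h0U, h0U, by
      simp only [mem_preimage, Function.comp_apply, map_zero, add_zero]
      rwa [hΨp]⟩) (f' := (LinearEquiv.ofBijective f'.toLinearMap hbij).toContinuousLinearEquiv)
    (hfd 0 h0U)
  obtain ⟨A⟩ : Nonempty (C ≃L[ℝ] E2) := ⟨ContinuousLinearEquiv.ofFinrankEq (by simp [hCdim])⟩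
  have hNt : ∀ z ∈ e.target, z ∈ N := fun z hz ↦ by
    have := (heU (e.map_target hz)).2.2
    rw [← e.right_inv hz, hef]
    exact this
  refine ⟨e.target, fun z ↦ A (e.symm z).2, e.open_target, ?_, fun z hz ↦ (hN z (hNt z hz)).2,
    A.contDiff.comp_contDiffOn (contDiff_snd.comp_contDiffOn hes), fun z hz ↦ ?_⟩
  · have := e.map_source he0
    rw [hef] at this
    simp only [hf, map_zero, add_zero] at this
    rwa [hΨp] at this
  · have hsrc := e.map_target hz
    obtain ⟨L, hL, hLs⟩ := hed _ hsrc
    have hfz : f (e.symm z) = z := by rw [← hef, e.right_inv hz]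
    rw [hfz] at hLs
    have hη : HasFDerivAt (fun z ↦ A (e.symm z).2) _ z := A.hasFDerivAt.comp z hLs.snd
    have hηv : ∀ v, fderiv ℝ (fun z ↦ A (e.symm z).2) z v = A (L.symm v).2 := fun v ↦ by
      rw [hη.fderiv]
      simp
    have hLm : ∀ m : ℝ × ℝ, L (m, 0) = m.1 • K z + m.2 • F z := by
      intro m
      have h1 := hL.unique (hfd _ (heU hsrc).1)
      have h2 := hΨd _ (heU hsrc).1 m
      have h3 := hN z (hNt z hz)
      rw [show Ψ (((0, 0), p) + σ (e.symm z)) = z from hfz, h3.1.1.eq_of_nhds,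
        h3.1.2.eq_of_nhds] at h2
      rw [← h2, ← ContinuousLinearEquiv.coe_coe, h1]
      simp [hσ]
    refine ⟨?_, ?_, fun v hv ↦ ?_⟩
    · have h := hLm (1, 0)
      rw [one_smul, zero_smul, add_zero] at h
      rw [hηv, ← h, L.symm_apply_apply, map_zero]
    · have h := hLm (0, 1)
      rw [one_smul, zero_smul, zero_add] at h
      rw [hηv, ← h, L.symm_apply_apply, map_zero]
    · rw [hηv, map_eq_zero_iff A A.injective] at hv
      refine ⟨(L.symm v).1, ?_⟩
      rw [← hLm, ← hv, Prod.mk.eta, L.apply_symm_apply]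

end FirstIntegrals

/-! ### Calculus in the plane and conformally flat surfaces -/

section PlaneCalculus

lemma ContDiffOn.differentiableAt_of_isOpen {F G : Type*} [NormedAddCommGroup F] [NormedSpace ℝ F]
    [NormedAddCommGroup G] [NormedSpace ℝ G] {S : Set F} {f : F → G} {a : F}
    (hf : ContDiffOn ℝ ∞ f S) (hS : IsOpen S) (ha : a ∈ S) : DifferentiableAt ℝ f a :=
  (hf.contDiffAt (hS.mem_nhds ha)).differentiableAt (by simp)

lemma fderiv_fderiv_apply_comm {E F : Type*} [NormedAddCommGroup E] [NormedSpace ℝ E]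
    [NormedAddCommGroup F] [NormedSpace ℝ F] {S : Set E} (hS : IsOpen S) {f : E → F}
    (hf : ContDiffOn ℝ ∞ f S) {q : E} (hq : q ∈ S) (u v : E) :
    fderiv ℝ (fun r ↦ fderiv ℝ f r u) q v = fderiv ℝ (fun r ↦ fderiv ℝ f r v) q u := by
  have hsymm : IsSymmSndFDerivAt ℝ f q :=
    (hf.contDiffAt (hS.mem_nhds hq)).isSymmSndFDerivAt (by
      rw [minSmoothness_of_isRCLikeNormedField]
      exact WithTop.coe_le_coe.2 (le_top : (2 : ℕ∞) ≤ ⊤))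
  have hd : DifferentiableAt ℝ (fderiv ℝ f) q :=
    (hf.fderiv_of_isOpen hS (m := ∞) (by simp)).differentiableAt_of_isOpen hS hq
  have key : ∀ u v, fderiv ℝ (fun r ↦ fderiv ℝ f r u) q v = fderiv ℝ (fderiv ℝ f) q v u := by
    intro u v
    have : HasFDerivAt (fun r ↦ fderiv ℝ f r u) _ q :=
      hd.hasFDerivAt.clm_apply (hasFDerivAt_const _ _)
    rw [this.fderiv]
    simp
  rw [key, key]
  exact hsymm _ _

lemma fderiv_congr_of_isOpen {E F : Type*} [NormedAddCommGroup E] [NormedSpace ℝ E]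
    [NormedAddCommGroup F] [NormedSpace ℝ F] {S : Set E} (hS : IsOpen S) {f g : E → F}
    (hfg : ∀ q ∈ S, f q = g q) {q : E} (hq : q ∈ S) : fderiv ℝ f q = fderiv ℝ g q :=
  ((show Set.EqOn f g S from hfg).eventuallyEq_of_mem (hS.mem_nhds hq)).fderiv_eq

variable {S : Set E2} {f h : E2 → ℝ} {a : E2}

lemma partialD_congr (hS : IsOpen S) (ha : a ∈ S) (hfh : Set.EqOn f h S) (i : Fin 2) :
    partialD i f a = partialD i h a := by
  rw [partialD, partialD, (hfh.eventuallyEq_of_mem (hS.mem_nhds ha)).fderiv_eq]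

lemma ContDiffOn.partialD (hf : ContDiffOn ℝ ∞ f S) (hS : IsOpen S) (i : Fin 2) :
    ContDiffOn ℝ ∞ (partialD i f) S :=
  (hf.fderiv_of_isOpen hS (by simp)).clm_apply contDiffOn_const

lemma partialD_mul (hf : DifferentiableAt ℝ f a) (hh : DifferentiableAt ℝ h a) (i : Fin 2) :
    partialD i (fun b ↦ f b * h b) a = f a * partialD i h a + h a * partialD i f a := by
  simp only [partialD, fderiv_fun_mul hf hh]
  simp

lemma partialD_sub (hf : DifferentiableAt ℝ f a) (hh : DifferentiableAt ℝ h a) (i : Fin 2) :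
    partialD i (fun b ↦ f b - h b) a = partialD i f a - partialD i h a := by
  simp only [partialD, fderiv_fun_sub hf hh]
  simp

lemma partialD_const_mul (hf : DifferentiableAt ℝ f a) (c : ℝ) (i : Fin 2) :
    partialD i (fun b ↦ c * f b) a = c * partialD i f a := by
  simp only [partialD, fderiv_const_mul hf]
  simp

lemma partialD_const (c : ℝ) (i : Fin 2) : partialD i (fun _ ↦ c) a = 0 := by
  simp [partialD]

lemma partialD_inv (hh : DifferentiableAt ℝ h a) (h0 : h a ≠ 0) (i : Fin 2) :
    partialD i (fun b ↦ (h b)⁻¹) a = -(partialD i h a / h a ^ 2) := by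
  have : HasFDerivAt (fun b ↦ (h b)⁻¹) _ a := (hasDerivAt_inv h0).comp_hasFDerivAt a hh.hasFDerivAt
  rw [partialD, this.fderiv, partialD]
  simp
  ring

lemma partialD_comm (hS : IsOpen S) (hf : ContDiffOn ℝ ∞ f S) (ha : a ∈ S) (i j : Fin 2) :
    partialD i (partialD j f) a = partialD j (partialD i f) a :=
  fderiv_fderiv_apply_comm hS hf ha (coordVec j) (coordVec i)

lemma eq_smul_coordVec_add (m : E2) : m = m 0 • coordVec 0 + m 1 • coordVec 1 := by
  ext i
  fin_cases i <;> simp [coordVec]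

/-- A function on a convex open set of the plane is constant if its derivative vanishes. -/
lemma eq_of_partialD_eq_zero {S : Set E2} (hS : IsOpen S) (hSc : Convex ℝ S) {f : E2 → ℝ}
    (hf : ContDiffOn ℝ ∞ f S) (h0 : ∀ a ∈ S, ∀ i, partialD i f a = 0) {a b : E2} (ha : a ∈ S)
    (hb : b ∈ S) : f a = f b := by
  refine hS.is_const_of_fderiv_eq_zero hSc.isPreconnected (hf.differentiableOn (by simp))
    (fun c hc ↦ ?_) ha hb
  ext v
  have h1 := h0 c hc 0
  have h2 := h0 c hc 1
  rw [partialD] at h1 h2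
  rw [eq_smul_coordVec_add v, map_add, map_smul, map_smul, h1, h2]
  simp

/-- Let `β ∂ₜ + α ∂ₓ` be a Killing field of the metric `e^u (-dt² + dx²)`, with `ℓ = ∂ₓ u`
independent of `t`. The compatibility of the Killing equations, which express `∂ₜ² ∂ₓ α` in two
ways, forces `∂ₓ² ℓ = ℓ ∂ₓ ℓ` where `α ≠ 0`. -/
lemma killing_compatibility {α β ℓ : E2 → ℝ} (hS : IsOpen S) (hα : ContDiffOn ℝ ∞ α S)
    (hβ : ContDiffOn ℝ ∞ β S) (hℓ : ContDiffOn ℝ ∞ ℓ S)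
    (h1 : ∀ b ∈ S, partialD 1 α b = -1 / 2 * (α b * ℓ b))
    (h2 : ∀ b ∈ S, partialD 0 β b = -1 / 2 * (α b * ℓ b))
    (h3 : ∀ b ∈ S, partialD 0 α b = partialD 1 β b)
    (h4 : ∀ b ∈ S, partialD 0 ℓ b = 0) (ha : a ∈ S) :
    α a * (partialD 1 (partialD 1 ℓ) a - ℓ a * partialD 1 ℓ a) = 0 := by
  have hd : ∀ {k : E2 → ℝ}, ContDiffOn ℝ ∞ k S → ∀ b ∈ S, DifferentiableAt ℝ k b :=
    fun hk b hb ↦ hk.differentiableAt_of_isOpen hS hb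
  have hα0 := hα.partialD hS 0
  have hα1 := hα.partialD hS 1
  have hℓ1 := hℓ.partialD hS 1
  set q : E2 → ℝ := fun b ↦ 1 / 4 * (ℓ b * ℓ b) - 1 / 2 * partialD 1 ℓ b with hq
  have hqs : ContDiffOn ℝ ∞ q S :=
    (contDiffOn_const.mul (hℓ.mul hℓ)).sub (contDiffOn_const.mul hℓ1)
  have hαℓ : ContDiffOn ℝ ∞ (fun b ↦ α b * ℓ b) S := hα.mul hℓ
  have e1 : ∀ b ∈ S, partialD 0 (partialD 0 α) b = α b * q b := by
    intro b hb
    rw [partialD_congr hS hb (h := partialD 1 β) h3, partialD_comm hS hβ hb,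
      partialD_congr hS hb (h := fun b ↦ -1 / 2 * (α b * ℓ b)) h2,
      partialD_const_mul (hd hαℓ b hb), partialD_mul (hd hα b hb) (hd hℓ b hb), h1 b hb, hq]
    ring
  have e2 : ∀ b ∈ S, partialD 0 (partialD 0 (partialD 1 α)) b = -1 / 2 * (ℓ b * (α b * q b)) := by
    intro b hb
    have : Set.EqOn (partialD 0 (partialD 1 α)) (fun b ↦ -1 / 2 * (ℓ b * partialD 0 α b)) S := by
      intro b hb
      rw [partialD_congr hS hb (h := fun b ↦ -1 / 2 * (α b * ℓ b)) h1,
        partialD_const_mul (hd hαℓ b hb), partialD_mul (hd hα b hb) (hd hℓ b hb), h4 b hb]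
      ring
    rw [partialD_congr hS hb this, partialD_const_mul (hd (hℓ.mul hα0) b hb),
      partialD_mul (hd hℓ b hb) (hd hα0 b hb), h4 b hb, e1 b hb]
    ring
  have e3 : partialD 0 (partialD 0 (partialD 1 α)) a = partialD 1 (fun b ↦ α b * q b) a := by
    rw [partialD_congr hS ha (h := partialD 1 (partialD 0 α))
      (fun b hb ↦ partialD_comm hS hα hb 0 1), partialD_comm hS hα0 ha,
      partialD_congr hS ha (h := fun b ↦ α b * q b) e1]
  have e4 : partialD 1 q a = 1 / 2 * (ℓ a * partialD 1 ℓ a) - 1 / 2 * partialD 1 (partialD 1 ℓ) a := by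
    have hℓℓ : ContDiffOn ℝ ∞ (fun b ↦ ℓ b * ℓ b) S := hℓ.mul hℓ
    rw [hq, partialD_sub ((hd hℓℓ a ha).const_mul _) ((hd hℓ1 a ha).const_mul _),
      partialD_const_mul (hd hℓℓ a ha), partialD_const_mul (hd hℓ1 a ha),
      partialD_mul (hd hℓ a ha) (hd hℓ a ha)]
    ring
  rw [e2 a ha, partialD_mul (hd hα a ha) (hd hqs a ha), h1 a ha, e4] at e3
  linarith

end PlaneCalculus

section ConformallyFlatSurface

/-- The flat Lorentzian form `-dt² + dx²` of the plane. -/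
noncomputable def minkowskiForm : E2 →L[ℝ] E2 →L[ℝ] ℝ :=
  -(EuclideanSpace.proj (𝕜 := ℝ) (0 : Fin 2)).smulRight (EuclideanSpace.proj (𝕜 := ℝ) (0 : Fin 2))
    + (EuclideanSpace.proj (𝕜 := ℝ) (1 : Fin 2)).smulRight
      (EuclideanSpace.proj (𝕜 := ℝ) (1 : Fin 2))

lemma minkowskiForm_apply (u v : E2) : minkowskiForm u v = -(u 0 * v 0) + u 1 * v 1 := by
  simp [minkowskiForm]

lemma isLorentzForm_smul_minkowskiForm {c : ℝ} (hc : 0 < c) :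
    IsLorentzForm (c • minkowskiForm) := by
  refine ⟨fun u v ↦ ?_, coordVec 0, ?_, fun u hu hu0 ↦ ?_⟩
  · simp only [_root_.smul_apply, minkowskiForm_apply]
    ring_nf
  · simp [minkowskiForm_apply, coordVec, hc]
  · simp only [_root_.smul_apply, minkowskiForm_apply, coordVec, smul_eq_mul] at hu ⊢
    simp [hc.ne'] at hu
    have h1 : u 1 ≠ 0 := fun h ↦ hu0 (by ext i; fin_cases i <;> simp [hu, h])
    rw [hu]
    have := mul_self_pos.2 h1
    simp only [mul_zero, neg_zero, zero_add]
    positivity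

variable {S : Set E2} {U : E2 → ℝ} {a : E2}

/-- A metric `U (-dt² + dx²)`, conformal to the flat Lorentzian metric. -/
noncomputable def conformalForm (U : E2 → ℝ) : PlaneForm := fun a ↦ U a • minkowskiForm

lemma gram_conformalForm (U : E2 → ℝ) (a : E2) :
    (conformalForm U).gram a = !![-U a, 0; 0, U a] := by
  ext i j
  fin_cases i <;> fin_cases j <;>
    simp [PlaneForm.gram, conformalForm, minkowskiForm_apply, coordVec]

lemma gram_conformalForm_inv (hU : U a ≠ 0) :
    ((conformalForm U).gram a)⁻¹ = !![-(U a)⁻¹, 0; 0, (U a)⁻¹] := by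
  rw [gram_conformalForm]
  refine Matrix.inv_eq_right_inv ?_
  ext i j
  fin_cases i <;> fin_cases j <;> simp [Matrix.mul_apply, hU]

lemma partialD_gram_conformalForm (i j k : Fin 2) :
    partialD k (fun b ↦ (conformalForm U).gram b i j) a =
      !![-partialD k U a, 0; 0, partialD k U a] i j := by
  simp only [gram_conformalForm]
  have hneg : partialD k (fun b ↦ -U b) a = -partialD k U a := by
    simp [partialD, fderiv_fun_neg]
  fin_cases i <;> fin_cases j <;> simp [partialD_const, hneg]

/-- The Christoffel symbols of `U (-dt² + dx²)`, with `U` a function of `x`. -/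
lemma christoffel_conformalForm (h0 : U a ≠ 0)
    (hU0 : partialD 0 U a = 0) :
    (conformalForm U).christoffel 0 0 1 a = 1 / 2 * (partialD 1 U a / U a) ∧
    (conformalForm U).christoffel 0 1 0 a = 1 / 2 * (partialD 1 U a / U a) ∧
    (conformalForm U).christoffel 1 0 0 a = 1 / 2 * (partialD 1 U a / U a) ∧
    (conformalForm U).christoffel 1 1 1 a = 1 / 2 * (partialD 1 U a / U a) ∧
    (conformalForm U).christoffel 0 1 1 a = 0 ∧
    (conformalForm U).christoffel 0 0 0 a = 0 ∧
    (conformalForm U).christoffel 1 0 1 a = 0 ∧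
    (conformalForm U).christoffel 1 1 0 a = 0 := by
  simp only [PlaneForm.christoffel, gram_conformalForm_inv h0, partialD_gram_conformalForm]
  simp [hU0]
  field_simp

/-- The curvature of `e^u (-dt² + dx²)`, with `u` a function of `x`, is `-e^{-u} ∂ₓ² u / 2`. -/
lemma gaussCurvature_conformalForm (hS : IsOpen S) (hU : ContDiffOn ℝ ∞ U S)
    (hpos : ∀ b ∈ S, 0 < U b) (hU0 : ∀ b ∈ S, partialD 0 U b = 0) (ha : a ∈ S) :
    (conformalForm U).gaussCurvature a =
      -1 / 2 * (partialD 1 (fun b ↦ partialD 1 U b / U b) a * (U a)⁻¹) := by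
  have hℓ : ContDiffOn ℝ ∞ (fun b ↦ partialD 1 U b / U b) S :=
    (hU.partialD hS 1).div hU fun b hb ↦ (hpos b hb).ne'
  have hΓ := fun b hb ↦ christoffel_conformalForm (hpos b hb).ne' (hU0 b hb)
  obtain ⟨c1, c2, c3, c4, c5, c6, c7, c8⟩ := hΓ a ha
  have hd1 : partialD 1 ((conformalForm U).christoffel 0 0 1) a =
      1 / 2 * partialD 1 (fun b ↦ partialD 1 U b / U b) a := by
    rw [partialD_congr hS ha (h := fun b ↦ 1 / 2 * (partialD 1 U b / U b))
      (fun b hb ↦ (hΓ b hb).1), partialD_const_mul (hℓ.differentiableAt_of_isOpen hS ha)]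
  have hd0 : partialD 0 ((conformalForm U).christoffel 0 1 1) a = 0 := by
    rw [partialD_congr hS ha (h := fun _ ↦ 0) (fun b hb ↦ (hΓ b hb).2.2.2.2.1), partialD_const]
  have hpa := (hpos a ha).ne'
  simp only [PlaneForm.gaussCurvature, PlaneForm.riemann, Fin.sum_univ_two, gram_conformalForm,
    Matrix.det_fin_two, hd0, hd1, c1, c2, c3, c4, c5, c6, c7, c8]
  simp
  field_simp

/-- `∂ₜ (∂ₓ log U) = 0` for a function `U` of `x`. -/
lemma partialD_logDeriv_eq_zero (hS : IsOpen S) (hU : ContDiffOn ℝ ∞ U S)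
    (hpos : ∀ b ∈ S, 0 < U b) (hU0 : ∀ b ∈ S, partialD 0 U b = 0) :
    ∀ b ∈ S, partialD 0 (fun b ↦ partialD 1 U b / U b) b = 0 := by
  intro b hb
  have hUi : ContDiffOn ℝ ∞ (fun b ↦ (U b)⁻¹) S := hU.inv fun b hb ↦ (hpos b hb).ne'
  have hd : ∀ {k : E2 → ℝ}, ContDiffOn ℝ ∞ k S → ∀ b ∈ S, DifferentiableAt ℝ k b :=
    fun hk b hb ↦ hk.differentiableAt_of_isOpen hS hb
  have h1 : partialD 0 (fun b ↦ partialD 1 U b) b = 0 := by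
    rw [show (fun b ↦ partialD 1 U b) = partialD 1 U from rfl, partialD_comm hS hU hb,
      partialD_congr hS hb (h := fun _ ↦ 0) hU0, partialD_const]
  simp only [div_eq_mul_inv]
  rw [partialD_mul (hd (hU.partialD hS 1) b hb) (hd hUi b hb), h1,
    partialD_inv (hd hU b hb) (hpos b hb).ne', hU0 b hb]
  simp

/-- The metric `U (-dt² + dx²)`, with `U` a function of `x`, has constant curvature if
`ℓ = ∂ₓ log U` satisfies `ℓ'' = ℓ ℓ'`. -/
lemma hasConstantCurvatureOn_conformalForm (hS : IsOpen S) (hSc : Convex ℝ S)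
    (hU : ContDiffOn ℝ ∞ U S) (hpos : ∀ b ∈ S, 0 < U b) (hU0 : ∀ b ∈ S, partialD 0 U b = 0)
    (hℓ : ∀ b ∈ S, partialD 1 (partialD 1 (fun b ↦ partialD 1 U b / U b)) b =
      partialD 1 U b / U b * partialD 1 (fun b ↦ partialD 1 U b / U b) b) :
    (conformalForm U).HasConstantCurvatureOn S := by
  have hUi : ContDiffOn ℝ ∞ (fun b ↦ (U b)⁻¹) S := hU.inv fun b hb ↦ (hpos b hb).ne'
  have hd : ∀ {k : E2 → ℝ}, ContDiffOn ℝ ∞ k S → ∀ b ∈ S, DifferentiableAt ℝ k b :=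
    fun hk b hb ↦ hk.differentiableAt_of_isOpen hS hb
  have hU1 := hU.partialD hS 1
  have hℓs : ContDiffOn ℝ ∞ (fun b ↦ partialD 1 U b / U b) S :=
    hU1.div hU fun b hb ↦ (hpos b hb).ne'
  have hℓ1 := hℓs.partialD hS 1
  have hℓ0 := partialD_logDeriv_eq_zero hS hU hpos hU0
  set κ : E2 → ℝ := fun b ↦ partialD 1 (fun b ↦ partialD 1 U b / U b) b * (U b)⁻¹ with hκ
  have hκs : ContDiffOn ℝ ∞ κ S := hℓ1.mul hUi
  have hinv : ∀ b ∈ S, ∀ i, partialD i (fun b ↦ (U b)⁻¹) b = -(partialD i U b / U b ^ 2) :=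
    fun b hb ↦ partialD_inv (hd hU b hb) (hpos b hb).ne'
  have hκ0 : ∀ b ∈ S, partialD 0 κ b = 0 := by
    intro b hb
    rw [hκ, partialD_mul (hd hℓ1 b hb) (hd hUi b hb), hinv b hb, hU0 b hb,
      partialD_comm hS hℓs hb, partialD_congr hS hb (h := fun _ ↦ 0) hℓ0, partialD_const]
    simp
  have hκ1 : ∀ b ∈ S, partialD 1 κ b = 0 := by
    intro b hb
    rw [hκ, partialD_mul (hd hℓ1 b hb) (hd hUi b hb), hinv b hb]
    have h := hℓ b hb
    rw [show partialD 1 (fun b ↦ partialD 1 (fun b ↦ partialD 1 U b / U b) b) b =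
      partialD 1 (partialD 1 (fun b ↦ partialD 1 U b / U b)) b from rfl, h]
    have := (hpos b hb).ne'
    field_simp
    ring
  rcases S.eq_empty_or_nonempty with rfl | ⟨b₀, hb₀⟩
  · exact ⟨0, fun b hb ↦ hb.elim⟩
  · refine ⟨-1 / 2 * κ b₀, fun b hb ↦ ?_⟩
    rw [gaussCurvature_conformalForm hS hU hpos hU0 hb]
    congr 1
    refine eq_of_partialD_eq_zero hS hSc hκs (fun b hb i ↦ ?_) hb hb₀
    fin_cases i
    exacts [hκ0 b hb, hκ1 b hb]

end ConformallyFlatSurface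

/-! ### Killing fields in coordinates -/

section CoordinateFields

variable {E : Type*} [NormedAddCommGroup E] [NormedSpace ℝ E]

/-- The Killing equation `L_X G = 0` on `Ω`, in coordinates. -/
def IsKillingOn (G : E → E →L[ℝ] E →L[ℝ] ℝ) (X : E → E) (Ω : Set E) : Prop :=
  ∀ z ∈ Ω, ∀ u v, fderiv ℝ G z (X z) u v + G z (fderiv ℝ X z u) v + G z u (fderiv ℝ X z v) = 0

/-- The exterior derivative of the one-form `G(X, ·)`, in coordinates. -/
noncomputable def coordDFlat (G : E → E →L[ℝ] E →L[ℝ] ℝ) (X : E → E) (z u v : E) : ℝ :=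
  fderiv ℝ G z u (X z) v + G z (fderiv ℝ X z u) v
    - (fderiv ℝ G z v (X z) u + G z (fderiv ℝ X z v) u)

/-- Hypersurface-orthogonality `X♭ ∧ dX♭ = 0` on `Ω`, in coordinates. -/
def IsHypersurfaceOrthogonalOn (G : E → E →L[ℝ] E →L[ℝ] ℝ) (X : E → E) (Ω : Set E) : Prop :=
  ∀ z ∈ Ω, ∀ u v w, G z (X z) u * coordDFlat G X z v w + G z (X z) v * coordDFlat G X z w u
    + G z (X z) w * coordDFlat G X z u v = 0

variable {G : E → E →L[ℝ] E →L[ℝ] ℝ} {X Y : E → E} {f : E → ℝ} {z : E}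

lemma fderiv_flat (hG : DifferentiableAt ℝ G z) (hX : DifferentiableAt ℝ X z) (u v : E) :
    fderiv ℝ (fun y ↦ G y (X y)) z u v = fderiv ℝ G z u (X z) v + G z (fderiv ℝ X z u) v := by
  have : HasFDerivAt (fun y ↦ G y (X y)) _ z := hG.hasFDerivAt.clm_apply hX.hasFDerivAt
  rw [this.fderiv]
  simp [add_comm]

lemma fderiv_pairing_along {D : Type*} [NormedAddCommGroup D] [NormedSpace ℝ D]
    {B : D → E →L[ℝ] E →L[ℝ] ℝ} {X Y : D → E} {q : D} (hB : DifferentiableAt ℝ B q)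
    (hX : DifferentiableAt ℝ X q) (hY : DifferentiableAt ℝ Y q) (u : D) :
    fderiv ℝ (fun r ↦ B r (X r) (Y r)) q u =
      fderiv ℝ B q u (X q) (Y q) + B q (fderiv ℝ X q u) (Y q) + B q (X q) (fderiv ℝ Y q u) := by
  have h1 : HasFDerivAt (fun y ↦ B y (X y)) _ q := hB.hasFDerivAt.clm_apply hX.hasFDerivAt
  have : HasFDerivAt (fun y ↦ B y (X y) (Y y)) _ q := h1.clm_apply hY.hasFDerivAt
  rw [this.fderiv]
  simp
  ring

lemma fderiv_pairing (hG : DifferentiableAt ℝ G z) (hX : DifferentiableAt ℝ X z)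
    (hY : DifferentiableAt ℝ Y z) (u : E) :
    fderiv ℝ (fun y ↦ G y (X y) (Y y)) z u =
      fderiv ℝ G z u (X z) (Y z) + G z (fderiv ℝ X z u) (Y z) + G z (X z) (fderiv ℝ Y z u) :=
  fderiv_pairing_along hG hX hY u

lemma fderiv_smul_apply {F : Type*} [NormedAddCommGroup F] [NormedSpace ℝ F] {A : E → F}
    (hf : DifferentiableAt ℝ f z) (hA : DifferentiableAt ℝ A z) (u : E) :
    fderiv ℝ (fun y ↦ f y • A y) z u = fderiv ℝ f z u • A z + f z • fderiv ℝ A z u := by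
  rw [fderiv_fun_smul hf hA]
  simp [add_comm]

lemma fderiv_inv_apply (hf : DifferentiableAt ℝ f z) (h0 : f z ≠ 0) (u : E) :
    fderiv ℝ (fun y ↦ (f y)⁻¹) z u = -(fderiv ℝ f z u / f z ^ 2) := by
  have : HasFDerivAt (fun b ↦ (f b)⁻¹) _ z := (hasDerivAt_inv h0).comp_hasFDerivAt z hf.hasFDerivAt
  rw [this.fderiv]
  simp
  ring

/-- For a hypersurface-orthogonal Killing field `X` without zeros of `N = g(X, X)`, the one-form
`X♭ / N` is closed: the Killing equation gives `i_X dX♭ = -dN`, so contracting `X♭ ∧ dX♭ = 0` with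
`X` gives `N dX♭ = dN ∧ X♭`. -/
lemma fderiv_normalized_flat_symm {Ω : Set E} (hz : z ∈ Ω) (hG : DifferentiableAt ℝ G z)
    (hX : DifferentiableAt ℝ X z) (hsymm : ∀ u v, G z u v = G z v u) (hkill : IsKillingOn G X Ω)
    (hhso : IsHypersurfaceOrthogonalOn G X Ω) (h0 : G z (X z) (X z) ≠ 0) (u v : E) :
    fderiv ℝ (fun y ↦ (G y (X y) (X y))⁻¹ • G y (X y)) z u v =
      fderiv ℝ (fun y ↦ (G y (X y) (X y))⁻¹ • G y (X y)) z v u := by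
  have hκ : DifferentiableAt ℝ (fun y ↦ G y (X y)) z := hG.clm_apply hX
  have hN : DifferentiableAt ℝ (fun y ↦ G y (X y) (X y)) z := hκ.clm_apply hX
  have hd : ∀ u v, fderiv ℝ (fun y ↦ (G y (X y) (X y))⁻¹ • G y (X y)) z u v =
      -(fderiv ℝ (fun y ↦ G y (X y) (X y)) z u / G z (X z) (X z) ^ 2) * G z (X z) v +
        (G z (X z) (X z))⁻¹ * (fderiv ℝ G z u (X z) v + G z (fderiv ℝ X z u) v) := by
    intro u v
    rw [fderiv_smul_apply (hN.fun_inv h0) hκ, fderiv_inv_apply hN h0, add_apply, smul_apply,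
      smul_apply, fderiv_flat hG hX]
    simp
  have hXd : ∀ w, coordDFlat G X z (X z) w = -fderiv ℝ (fun y ↦ G y (X y) (X y)) z w := by
    intro w
    rw [fderiv_pairing hG hX hX, coordDFlat]
    have := hkill z hz (X z) w
    rw [hsymm (X z) (fderiv ℝ X z w)] at this ⊢
    linarith
  have hXd' : ∀ w, coordDFlat G X z w (X z) = fderiv ℝ (fun y ↦ G y (X y) (X y)) z w := by
    intro w
    rw [← neg_eq_iff_eq_neg.2 (hXd w), coordDFlat, coordDFlat]
    ring
  have h := hhso z hz (X z) u v
  rw [hXd', hXd] at h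
  rw [hd, hd]
  rw [coordDFlat] at h
  field_simp
  linarith

end CoordinateFields

/-! ### Adapted frames -/

section AdaptedFrame

variable {E : Type*} [NormedAddCommGroup E] [NormedSpace ℝ E]

/-- A frame `K, F` of the distribution spanned by two static Killing fields `K` and `ξ = a F + b K`,
on an open set of coordinates: `K` and `F` are orthogonal, of opposite squares `-P` and `P`, and
their span is involutive. The fields `K` and `ξ` are independent on a dense set. -/
structure AdaptedFrame (Ω : Set E) (G : E → E →L[ℝ] E →L[ℝ] ℝ) (K F ξ : E → E)
    (P a b : E → ℝ) : Prop where
  isOpen : IsOpen Ω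
  smooth_G : ContDiffOn ℝ ∞ G Ω
  smooth_K : ContDiffOn ℝ ∞ K Ω
  smooth_F : ContDiffOn ℝ ∞ F Ω
  smooth_ξ : ContDiffOn ℝ ∞ ξ Ω
  smooth_P : ContDiffOn ℝ ∞ P Ω
  smooth_a : ContDiffOn ℝ ∞ a Ω
  smooth_b : ContDiffOn ℝ ∞ b Ω
  symm : ∀ z ∈ Ω, ∀ u v, G z u v = G z v u
  P_pos : ∀ z ∈ Ω, 0 < P z
  K_K : ∀ z ∈ Ω, G z (K z) (K z) = -P z
  F_F : ∀ z ∈ Ω, G z (F z) (F z) = P z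
  K_F : ∀ z ∈ Ω, G z (K z) (F z) = 0
  ξ_eq : ∀ z ∈ Ω, ξ z = a z • F z + b z • K z
  timelike : ∀ z ∈ Ω, G z (ξ z) (ξ z) < 0
  killing_K : IsKillingOn G K Ω
  killing_ξ : IsKillingOn G ξ Ω
  hso_K : IsHypersurfaceOrthogonalOn G K Ω
  hso_ξ : IsHypersurfaceOrthogonalOn G ξ Ω
  involutive : ∀ z ∈ Ω, ∃ c d : ℝ, fderiv ℝ F z (K z) - fderiv ℝ K z (F z) = c • K z + d • F z
  dense : ∀ U ⊆ Ω, IsOpen U → U.Nonempty → ∃ z ∈ U, a z ≠ 0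

/-- The one-form dual to `K` in an adapted frame. -/
noncomputable def tauForm (G : E → E →L[ℝ] E →L[ℝ] ℝ) (K : E → E) (P : E → ℝ) (z : E) :
    E →L[ℝ] ℝ := -((P z)⁻¹ • G z (K z))

/-- The one-form dual to `F` in an adapted frame. -/
noncomputable def thetaForm (G : E → E →L[ℝ] E →L[ℝ] ℝ) (F : E → E) (P : E → ℝ) (z : E) :
    E →L[ℝ] ℝ := (P z)⁻¹ • G z (F z)

namespace AdaptedFrame

variable {Ω : Set E} {G : E → E →L[ℝ] E →L[ℝ] ℝ} {K F ξ : E → E} {P a b : E → ℝ}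
  (h : AdaptedFrame Ω G K F ξ P a b) {z : E}
include h

lemma dG (hz : z ∈ Ω) : DifferentiableAt ℝ G z := h.smooth_G.differentiableAt_of_isOpen h.isOpen hz
lemma dK (hz : z ∈ Ω) : DifferentiableAt ℝ K z := h.smooth_K.differentiableAt_of_isOpen h.isOpen hz
lemma dF (hz : z ∈ Ω) : DifferentiableAt ℝ F z := h.smooth_F.differentiableAt_of_isOpen h.isOpen hz
lemma dξ (hz : z ∈ Ω) : DifferentiableAt ℝ ξ z := h.smooth_ξ.differentiableAt_of_isOpen h.isOpen hz
lemma dP (hz : z ∈ Ω) : DifferentiableAt ℝ P z := h.smooth_P.differentiableAt_of_isOpen h.isOpen hz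
lemma da (hz : z ∈ Ω) : DifferentiableAt ℝ a z := h.smooth_a.differentiableAt_of_isOpen h.isOpen hz
lemma db (hz : z ∈ Ω) : DifferentiableAt ℝ b z := h.smooth_b.differentiableAt_of_isOpen h.isOpen hz

lemma eq_zero_of_dense {f : E → ℝ} (hf : ContinuousOn f Ω) (h0 : ∀ z ∈ Ω, a z ≠ 0 → f z = 0)
    (hz : z ∈ Ω) : f z = 0 := by
  by_contra hne
  obtain ⟨y, hy, hay⟩ := h.dense _ Set.inter_subset_left
    (hf.isOpen_inter_preimage h.isOpen (isOpen_compl_singleton (x := (0 : ℝ)))) ⟨z, hz, hne⟩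
  exact hy.2 (h0 y hy.1 hay)

lemma fderiv_congr {X : Type*} [NormedAddCommGroup X] [NormedSpace ℝ X] {f₁ f₂ : E → X}
    (hf : ∀ y ∈ Ω, f₁ y = f₂ y) (hz : z ∈ Ω) : fderiv ℝ f₁ z = fderiv ℝ f₂ z :=
  ((show Set.EqOn f₁ f₂ Ω from hf).eventuallyEq_of_mem (h.isOpen.mem_nhds hz)).fderiv_eq

lemma deriv_K_K (hz : z ∈ Ω) (u : E) :
    fderiv ℝ G z u (K z) (K z) + 2 * G z (fderiv ℝ K z u) (K z) = -fderiv ℝ P z u := by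
  have h1 := fderiv_pairing (h.dG hz) (h.dK hz) (h.dK hz) u
  rw [h.fderiv_congr h.K_K hz, fderiv_fun_neg, h.symm z hz (K z)] at h1
  simp only [neg_apply] at h1
  linarith

lemma deriv_F_F (hz : z ∈ Ω) (u : E) :
    fderiv ℝ G z u (F z) (F z) + 2 * G z (fderiv ℝ F z u) (F z) = fderiv ℝ P z u := by
  have h1 := fderiv_pairing (h.dG hz) (h.dF hz) (h.dF hz) u
  rw [h.fderiv_congr h.F_F hz, h.symm z hz (F z)] at h1
  linarith

lemma deriv_K_F (hz : z ∈ Ω) (u : E) :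
    fderiv ℝ G z u (K z) (F z) + G z (fderiv ℝ K z u) (F z) + G z (K z) (fderiv ℝ F z u) = 0 := by
  have h1 := fderiv_pairing (h.dG hz) (h.dK hz) (h.dF hz) u
  rw [h.fderiv_congr h.K_F hz] at h1
  simp at h1
  linarith

lemma deriv_ξ (hz : z ∈ Ω) (u : E) : fderiv ℝ ξ z u =
    (fderiv ℝ a z u • F z + a z • fderiv ℝ F z u) +
      (fderiv ℝ b z u • K z + b z • fderiv ℝ K z u) := by
  rw [h.fderiv_congr h.ξ_eq hz, fderiv_fun_add ((h.da hz).fun_smul (h.dF hz))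
    ((h.db hz).fun_smul (h.dK hz)), add_apply, fderiv_smul_apply (h.da hz) (h.dF hz),
    fderiv_smul_apply (h.db hz) (h.dK hz)]

lemma K_P (hz : z ∈ Ω) : fderiv ℝ P z (K z) = 0 := by
  have h1 := h.deriv_K_K hz (K z)
  have h2 := h.killing_K z hz (K z) (K z)
  rw [h.symm z hz (K z)] at h2
  linarith

/-- The fields of an adapted frame commute. -/
lemma commute (hz : z ∈ Ω) : fderiv ℝ F z (K z) = fderiv ℝ K z (F z) := by
  obtain ⟨c, d, hcd⟩ := h.involutive z hz
  have h1 : G z (K z) (fderiv ℝ F z (K z) - fderiv ℝ K z (F z)) = 0 := by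
    have h1 := h.deriv_K_F hz (K z)
    have h2 := h.killing_K z hz (K z) (F z)
    rw [map_sub]
    linarith
  have h2 : G z (F z) (fderiv ℝ F z (K z) - fderiv ℝ K z (F z)) = 0 := by
    have h1 := h.deriv_F_F hz (K z)
    have h2 := h.killing_K z hz (F z) (F z)
    rw [h.K_P hz] at h1
    rw [h.symm z hz (fderiv ℝ K z (F z))] at h2
    rw [map_sub, h.symm z hz (F z) (fderiv ℝ F z (K z))]
    linarith
  have hP := (h.P_pos z hz).ne'
  rw [hcd, map_add, map_smul, map_smul, h.K_K z hz, h.K_F z hz] at h1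
  rw [hcd, map_add, map_smul, map_smul, h.symm z hz (F z), h.K_F z hz, h.F_F z hz] at h2
  simp [hP] at h1 h2
  rwa [h1, h2, zero_smul, zero_smul, add_zero, sub_eq_zero] at hcd

lemma smooth_tau : ContDiffOn ℝ ∞ (tauForm G K P) Ω :=
  ((h.smooth_P.inv fun z hz ↦ (h.P_pos z hz).ne').smul (h.smooth_G.clm_apply h.smooth_K)).neg

lemma smooth_theta : ContDiffOn ℝ ∞ (thetaForm G F P) Ω :=
  (h.smooth_P.inv fun z hz ↦ (h.P_pos z hz).ne').smul (h.smooth_G.clm_apply h.smooth_F)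

omit h in
lemma tau_apply (u : E) : tauForm G K P z u = -((P z)⁻¹ * G z (K z) u) := by
  simp [tauForm]

omit h in
lemma theta_apply (u : E) : thetaForm G F P z u = (P z)⁻¹ * G z (F z) u := by
  simp [thetaForm]

lemma G_K (hz : z ∈ Ω) (u : E) : G z (K z) u = -(P z * tauForm G K P z u) := by
  have := (h.P_pos z hz).ne'
  rw [tau_apply]
  field_simp

lemma G_F (hz : z ∈ Ω) (u : E) : G z (F z) u = P z * thetaForm G F P z u := by
  have := (h.P_pos z hz).ne'
  rw [theta_apply]
  field_simp

lemma tau_K (hz : z ∈ Ω) : tauForm G K P z (K z) = 1 := by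
  have := (h.P_pos z hz).ne'
  simp [tau_apply, h.K_K z hz, this]

lemma tau_F (hz : z ∈ Ω) : tauForm G K P z (F z) = 0 := by
  simp [tau_apply, h.K_F z hz]

lemma theta_K (hz : z ∈ Ω) : thetaForm G F P z (K z) = 0 := by
  simp [theta_apply, h.symm z hz (F z), h.K_F z hz]

lemma theta_F (hz : z ∈ Ω) : thetaForm G F P z (F z) = 1 := by
  have := (h.P_pos z hz).ne'
  simp [theta_apply, h.F_F z hz, this]

lemma tau_closed (hz : z ∈ Ω) (u v : E) :
    fderiv ℝ (tauForm G K P) z u v = fderiv ℝ (tauForm G K P) z v u := by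
  have h1 : ∀ y ∈ Ω, tauForm G K P y = (G y (K y) (K y))⁻¹ • G y (K y) := by
    intro y hy
    rw [h.K_K y hy, tauForm, inv_neg]
    exact (neg_smul _ _).symm
  rw [h.fderiv_congr h1 hz]
  exact fderiv_normalized_flat_symm hz (h.dG hz) (h.dK hz) (h.symm z hz) h.killing_K h.hso_K
    (by rw [h.K_K z hz]; exact neg_ne_zero.2 (h.P_pos z hz).ne') u v

/-- The projection to the orthogonal complement of the span of `K` and `F`. -/
noncomputable def _root_.normalPart (G : E → E →L[ℝ] E →L[ℝ] ℝ) (K F : E → E) (P : E → ℝ)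
    (z u : E) : E := u - tauForm G K P z u • K z - thetaForm G F P z u • F z

lemma tau_normalPart (hz : z ∈ Ω) (u : E) : tauForm G K P z (normalPart G K F P z u) = 0 := by
  simp [normalPart, h.tau_K hz, h.tau_F hz]

lemma theta_normalPart (hz : z ∈ Ω) (u : E) : thetaForm G F P z (normalPart G K F P z u) = 0 := by
  simp [normalPart, h.theta_K hz, h.theta_F hz]

omit h in
lemma normalPart_of_normal {u : E} (h1 : tauForm G K P z u = 0) (h2 : thetaForm G F P z u = 0) :
    normalPart G K F P z u = u := by
  simp [normalPart, h1, h2]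

lemma continuousOn_normalPart (u : E) : ContinuousOn (fun z ↦ normalPart G K F P z u) Ω :=
  (continuousOn_const.sub ((h.smooth_tau.continuousOn.clm_apply continuousOn_const).smul
    h.smooth_K.continuousOn)).sub ((h.smooth_theta.continuousOn.clm_apply continuousOn_const).smul
    h.smooth_F.continuousOn)

/-- The component `b = τ(ξ)` is constant in normal directions: since `τ` is closed, `db` is the Lie
derivative of `τ` along `ξ`, and `ξ` is a Killing field. -/
lemma normal_b (hz : z ∈ Ω) {Z : E} (h1 : tauForm G K P z Z = 0) (h2 : thetaForm G F P z Z = 0) :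
    fderiv ℝ b z Z = 0 := by
  have hP := (h.P_pos z hz).ne'
  have hτ : DifferentiableAt ℝ (tauForm G K P) z :=
    h.smooth_tau.differentiableAt_of_isOpen h.isOpen hz
  have hb : ∀ y ∈ Ω, b y = tauForm G K P y (ξ y) := by
    intro y hy
    rw [h.ξ_eq y hy, map_add, map_smul, map_smul, h.tau_F hy, h.tau_K hy]
    simp
  have e1 : fderiv ℝ b z Z = fderiv ℝ (tauForm G K P) z (ξ z) Z
      + tauForm G K P z (fderiv ℝ ξ z Z) := by
    have : HasFDerivAt (fun y ↦ tauForm G K P y (ξ y)) _ z :=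
      hτ.hasFDerivAt.clm_apply (h.dξ hz).hasFDerivAt
    rw [h.fderiv_congr hb hz, this.fderiv, ← h.tau_closed hz Z]
    simp [add_comm]
  have e2 : fderiv ℝ (tauForm G K P) z (ξ z) Z =
      -((P z)⁻¹ * (fderiv ℝ G z (ξ z) (K z) Z + G z (fderiv ℝ K z (ξ z)) Z)) := by
    have hPi : DifferentiableAt ℝ (fun y ↦ (P y)⁻¹) z := (h.dP hz).fun_inv hP
    have h3 : G z (K z) Z = 0 := by rw [h.G_K hz, h1]; simp
    unfold tauForm
    rw [fderiv_fun_neg, neg_apply, neg_apply,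
      fderiv_smul_apply hPi ((h.dG hz).clm_apply (h.dK hz)), add_apply, smul_apply, smul_apply,
      fderiv_flat (h.dG hz) (h.dK hz), h3]
    simp
  have e3 := h.killing_ξ z hz (K z) Z
  have e4 : G z (fderiv ℝ ξ z (K z)) Z = G z (fderiv ℝ K z (ξ z)) Z := by
    rw [h.deriv_ξ hz, h.ξ_eq z hz]
    simp only [map_add, map_smul, add_apply, smul_apply, h.G_K hz, h.G_F hz, h1, h2, h.commute hz]
    simp
  rw [e1, e2, tau_apply]
  rw [e4] at e3
  linear_combination -(P z)⁻¹ * e3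

/-- The components of `ξ♭ / g(ξ, ξ)` in terms of the dual frame. -/
lemma ξ_flat (hz : z ∈ Ω) : a z • thetaForm G F P z - b z • tauForm G K P z =
    (a z * a z - b z * b z) • ((G z (ξ z) (ξ z))⁻¹ • G z (ξ z)) := by
  have hP := (h.P_pos z hz).ne'
  have e1 : G z (ξ z) = P z • (a z • thetaForm G F P z - b z • tauForm G K P z) := by
    ext u
    rw [h.ξ_eq z hz]
    simp only [map_add, map_smul, add_apply, smul_apply, sub_apply, h.G_K hz, h.G_F hz, smul_eq_mul]
    ring
  have e2 : G z (ξ z) (ξ z) = P z * (a z * a z - b z * b z) := by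
    rw [e1, h.ξ_eq z hz]
    simp only [map_add, map_smul, smul_apply, sub_apply, smul_eq_mul, h.tau_K hz,
      h.tau_F hz, h.theta_K hz, h.theta_F hz]
    ring
  have h0 := (h.timelike z hz).ne
  rw [e2] at h0 ⊢
  rw [e1, smul_smul, smul_smul]
  have : (a z * a z - b z * b z) * ((P z * (a z * a z - b z * b z))⁻¹ * P z) = 1 := by
    rw [← mul_inv_cancel₀ h0]
    ring
  rw [mul_assoc, this, one_smul]

lemma norm_ξ (hz : z ∈ Ω) : a z * a z - b z * b z < 0 := by
  have hP := h.P_pos z hz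
  have e2 : G z (ξ z) (ξ z) = P z * (a z * a z - b z * b z) := by
    rw [h.ξ_eq z hz]
    simp only [map_add, map_smul, add_apply, smul_apply, smul_eq_mul, h.G_K hz, h.G_F hz, h.tau_K hz,
      h.tau_F hz, h.theta_K hz, h.theta_F hz]
    ring
  have := h.timelike z hz
  rw [e2] at this
  by_contra hcon
  push Not at hcon
  have := mul_nonneg hP.le hcon
  linarith

/-- The exterior derivative of `a θ - b τ = (a² - b²) ξ♭ / g(ξ, ξ)`, computed with `dτ = 0` and with
`d (ξ♭ / g(ξ, ξ)) = 0`. -/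
lemma structure_eq (hz : z ∈ Ω) (u v : E) :
    fderiv ℝ a z u * thetaForm G F P z v - fderiv ℝ a z v * thetaForm G F P z u
      + a z * (fderiv ℝ (thetaForm G F P) z u v - fderiv ℝ (thetaForm G F P) z v u)
      - (fderiv ℝ b z u * tauForm G K P z v - fderiv ℝ b z v * tauForm G K P z u) =
    (2 * (a z * fderiv ℝ a z u - b z * fderiv ℝ b z u)) *
        ((a z * thetaForm G F P z v - b z * tauForm G K P z v) / (a z * a z - b z * b z))
      - (2 * (a z * fderiv ℝ a z v - b z * fderiv ℝ b z v)) *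
        ((a z * thetaForm G F P z u - b z * tauForm G K P z u) / (a z * a z - b z * b z)) := by
  set σ : E → E →L[ℝ] ℝ := fun y ↦ (G y (ξ y) (ξ y))⁻¹ • G y (ξ y) with hσ
  have hGξ : DifferentiableAt ℝ (fun y ↦ G y (ξ y)) z := (h.dG hz).clm_apply (h.dξ hz)
  have hσd : DifferentiableAt ℝ σ z :=
    ((hGξ.clm_apply (h.dξ hz)).fun_inv (h.timelike z hz).ne).smul hGξ
  have hclosed := fderiv_normalized_flat_symm hz (h.dG hz) (h.dξ hz) (h.symm z hz) h.killing_ξ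
    h.hso_ξ (h.timelike z hz).ne
  have hτ : DifferentiableAt ℝ (tauForm G K P) z :=
    h.smooth_tau.differentiableAt_of_isOpen h.isOpen hz
  have hθ : DifferentiableAt ℝ (thetaForm G F P) z :=
    h.smooth_theta.differentiableAt_of_isOpen h.isOpen hz
  have hD : DifferentiableAt ℝ (fun y ↦ a y * a y - b y * b y) z :=
    ((h.da hz).fun_mul (h.da hz)).fun_sub ((h.db hz).fun_mul (h.db hz))
  have hDd : ∀ u, fderiv ℝ (fun y ↦ a y * a y - b y * b y) z u =
      2 * (a z * fderiv ℝ a z u - b z * fderiv ℝ b z u) := by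
    intro u
    rw [fderiv_fun_sub ((h.da hz).fun_mul (h.da hz)) ((h.db hz).fun_mul (h.db hz)),
      fderiv_fun_mul (h.da hz) (h.da hz), fderiv_fun_mul (h.db hz) (h.db hz)]
    simp
    ring
  have hσz : ∀ u, σ z u =
      (a z * thetaForm G F P z u - b z * tauForm G K P z u) / (a z * a z - b z * b z) := by
    intro u
    have e := congrArg (fun φ : E →L[ℝ] ℝ ↦ φ u) (h.ξ_flat hz)
    simp only [sub_apply, smul_apply, smul_eq_mul] at e
    rw [e, mul_div_cancel_left₀ _ (h.norm_ξ hz).ne]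
    simp [hσ]
  have key : ∀ u v, (fderiv ℝ a z u * thetaForm G F P z v
      + a z * fderiv ℝ (thetaForm G F P) z u v) - (fderiv ℝ b z u * tauForm G K P z v
      + b z * fderiv ℝ (tauForm G K P) z u v) =
      2 * (a z * fderiv ℝ a z u - b z * fderiv ℝ b z u) * σ z v
        + (a z * a z - b z * b z) * fderiv ℝ σ z u v := by
    intro u v
    have e := congrArg (fun φ : E →L[ℝ] E →L[ℝ] ℝ ↦ φ u v)
      (h.fderiv_congr (fun y hy ↦ h.ξ_flat hy) hz)
    rw [fderiv_fun_sub ((h.da hz).fun_smul hθ) ((h.db hz).fun_smul hτ), sub_apply,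
      fderiv_smul_apply (h.da hz) hθ, fderiv_smul_apply (h.db hz) hτ,
      fderiv_smul_apply (A := σ) hD hσd, hDd] at e
    simpa using e
  have k1 := key u v
  have k2 := key v u
  have k3 := h.tau_closed hz u v
  have k4 : fderiv ℝ σ z u v = fderiv ℝ σ z v u := hclosed u v
  rw [hσz] at k1 k2
  rw [k3, k4] at k1
  linear_combination k1 - k2

/-- `i_K dθ = 0`, as `K` is a Killing field that commutes with `F`. -/
lemma theta_closed_K (hz : z ∈ Ω) (u : E) :
    fderiv ℝ (thetaForm G F P) z (K z) u = fderiv ℝ (thetaForm G F P) z u (K z) := by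
  have hP := (h.P_pos z hz).ne'
  have hθ : DifferentiableAt ℝ (thetaForm G F P) z :=
    h.smooth_theta.differentiableAt_of_isOpen h.isOpen hz
  have e1 : fderiv ℝ (thetaForm G F P) z u (K z) + thetaForm G F P z (fderiv ℝ K z u) = 0 := by
    have : HasFDerivAt (fun y ↦ thetaForm G F P y (K y)) _ z :=
      hθ.hasFDerivAt.clm_apply (h.dK hz).hasFDerivAt
    have e := this.fderiv
    rw [h.fderiv_congr (fun y hy ↦ h.theta_K hy) hz] at e
    have e' := congrArg (fun φ : E →L[ℝ] ℝ ↦ φ u) e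
    simp at e'
    linarith
  have e2 : fderiv ℝ (thetaForm G F P) z (K z) u =
      (P z)⁻¹ * (fderiv ℝ G z (K z) (F z) u + G z (fderiv ℝ F z (K z)) u) := by
    have hPi : DifferentiableAt ℝ (fun y ↦ (P y)⁻¹) z := (h.dP hz).fun_inv hP
    unfold thetaForm
    rw [fderiv_smul_apply hPi ((h.dG hz).clm_apply (h.dF hz)), add_apply, smul_apply, smul_apply,
      fderiv_flat (h.dG hz) (h.dF hz), fderiv_inv_apply (h.dP hz) hP, h.K_P hz]
    simp
  have e3 := h.killing_K z hz (F z) u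
  rw [theta_apply] at e1
  rw [h.commute hz] at e2
  rw [e2]
  linear_combination (P z)⁻¹ * e3 - e1

/-- The structure equation on `(K, Z)` with `Z` normal reads `b · Z a = 0` up to a nonzero factor, and
`b ≠ 0` because `ξ` is timelike. -/
lemma normal_a_of_ne (hz : z ∈ Ω) (ha : a z ≠ 0) {Z : E} (h1 : tauForm G K P z Z = 0)
    (h2 : thetaForm G F P z Z = 0) : fderiv ℝ a z Z = 0 := by
  have e := h.structure_eq hz (K z) Z
  rw [h1, h2, h.theta_closed_K hz, h.normal_b hz h1 h2, h.tau_K hz, h.theta_K hz] at e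
  have hD := h.norm_ξ hz
  have hb : b z ≠ 0 := by
    intro hb
    rw [hb] at hD
    nlinarith [mul_self_nonneg (a z)]
  have hD' := hD.ne
  simp at e
  tauto

/-- `dθ` vanishes where `a ≠ 0`: on `K` by `theta_closed_K`, and on the other pairs of vectors by the
structure equation, since `a` and `b` are constant in normal directions. -/
lemma theta_closed_of_ne (hz : z ∈ Ω) (ha : a z ≠ 0) (u v : E) :
    fderiv ℝ (thetaForm G F P) z u v = fderiv ℝ (thetaForm G F P) z v u := by
  set dθ : E → E → ℝ := fun u v ↦
    fderiv ℝ (thetaForm G F P) z u v - fderiv ℝ (thetaForm G F P) z v u with hdθ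
  have hFZ : ∀ Z, tauForm G K P z Z = 0 → thetaForm G F P z Z = 0 → dθ (F z) Z = 0 := by
    intro Z h1 h2
    have e := h.structure_eq hz (F z) Z
    rw [h1, h2, h.normal_b hz h1 h2, h.normal_a_of_ne hz ha h1 h2, h.tau_F hz] at e
    simp [ha] at e
    exact e
  have hZW : ∀ Z W, tauForm G K P z Z = 0 → thetaForm G F P z Z = 0 → tauForm G K P z W = 0 →
      thetaForm G F P z W = 0 → dθ Z W = 0 := by
    intro Z W h1 h2 h3 h4
    have e := h.structure_eq hz Z W
    rw [h1, h2, h3, h4] at e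
    simp [ha] at e
    exact e
  have hK : ∀ v, dθ (K z) v = 0 := fun v ↦ sub_eq_zero.2 (h.theta_closed_K hz v)
  have hanti : ∀ u v, dθ u v = -dθ v u := fun u v ↦ by simp [hdθ]
  have hdec : ∀ u, u = tauForm G K P z u • K z + thetaForm G F P z u • F z
      + normalPart G K F P z u := fun u ↦ by rw [normalPart]; abel
  have hadd : ∀ u v w, dθ (u + v) w = dθ u w + dθ v w := fun u v w ↦ by simp [hdθ]; ring
  have hsmul : ∀ (c : ℝ) u w, dθ (c • u) w = c * dθ u w := fun c u w ↦ by simp [hdθ]; ring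
  have hF : ∀ v, dθ (F z) v = 0 := by
    intro v
    rw [hanti, hdec v, hadd, hadd, hsmul, hsmul, hK, hanti (normalPart G K F P z v),
      hFZ _ (h.tau_normalPart hz v) (h.theta_normalPart hz v)]
    simp [hdθ]
  have hN : ∀ u v, dθ (normalPart G K F P z u) v = 0 := by
    intro u v
    rw [hanti, hdec v, hadd, hadd, hsmul, hsmul, hK, hF, hZW _ _ (h.tau_normalPart hz v)
      (h.theta_normalPart hz v) (h.tau_normalPart hz u) (h.theta_normalPart hz u)]
    simp
  have : dθ u v = 0 := by
    rw [hdec u, hadd, hadd, hsmul, hsmul, hK, hF, hN]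
    simp
  exact sub_eq_zero.1 this

lemma theta_closed (hz : z ∈ Ω) (u v : E) :
    fderiv ℝ (thetaForm G F P) z u v = fderiv ℝ (thetaForm G F P) z v u := by
  have hc : ContinuousOn (fderiv ℝ (thetaForm G F P)) Ω :=
    h.smooth_theta.continuousOn_fderiv_of_isOpen h.isOpen (by simp)
  refine sub_eq_zero.1 (h.eq_zero_of_dense (f := fun z ↦ fderiv ℝ (thetaForm G F P) z u v
    - fderiv ℝ (thetaForm G F P) z v u) ?_ (fun y hy hay ↦ ?_) hz)
  · exact ((hc.clm_apply continuousOn_const).clm_apply continuousOn_const).sub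
      ((hc.clm_apply continuousOn_const).clm_apply continuousOn_const)
  · exact sub_eq_zero.2 (h.theta_closed_of_ne hy hay u v)

lemma normal_a (hz : z ∈ Ω) {Z : E} (h1 : tauForm G K P z Z = 0)
    (h2 : thetaForm G F P z Z = 0) : fderiv ℝ a z Z = 0 := by
  have hc : ContinuousOn (fderiv ℝ a) Ω :=
    h.smooth_a.continuousOn_fderiv_of_isOpen h.isOpen (by simp)
  have := h.eq_zero_of_dense (f := fun z ↦ fderiv ℝ a z (normalPart G K F P z Z))
    (hc.clm_apply (h.continuousOn_normalPart Z)) (fun y hy hay ↦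
      h.normal_a_of_ne hy hay (h.tau_normalPart hy Z) (h.theta_normalPart hy Z)) hz
  simpa only [normalPart_of_normal h1 h2] using this

lemma bracket_K_ξ (hz : z ∈ Ω) : fderiv ℝ ξ z (K z) - fderiv ℝ K z (ξ z) =
    fderiv ℝ a z (K z) • F z + fderiv ℝ b z (K z) • K z := by
  rw [h.deriv_ξ hz, h.ξ_eq z hz, map_add, map_smul, map_smul, h.commute hz]
  abel

lemma bracket_F_ξ (hz : z ∈ Ω) : fderiv ℝ ξ z (F z) - fderiv ℝ F z (ξ z) =
    fderiv ℝ a z (F z) • F z + fderiv ℝ b z (F z) • K z := by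
  rw [h.deriv_ξ hz, h.ξ_eq z hz, map_add, map_smul, map_smul, h.commute hz]
  abel

lemma ξ_P (hz : z ∈ Ω) : fderiv ℝ P z (ξ z) = a z * fderiv ℝ P z (F z) := by
  rw [h.ξ_eq z hz, map_add, map_smul, map_smul, h.K_P hz]
  simp

/-- The component of the Killing equation of `ξ` on `(K, K)`. -/
lemma killing_ξ_K_K (hz : z ∈ Ω) :
    a z * fderiv ℝ P z (F z) = -(2 * P z * fderiv ℝ b z (K z)) := by
  have e1 := h.killing_ξ z hz (K z) (K z)
  have e2 := h.deriv_K_K hz (ξ z)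
  have e3 := congrArg (G z (K z)) (h.bracket_K_ξ hz)
  rw [map_sub, map_add, map_smul, map_smul, h.K_F z hz, h.K_K z hz] at e3
  rw [h.symm z hz (fderiv ℝ ξ z (K z))] at e1
  rw [h.symm z hz (fderiv ℝ K z (ξ z)), h.ξ_P hz] at e2
  simp at e3
  linear_combination e2 - e1 + 2 * e3

/-- The component of the Killing equation of `ξ` on `(F, F)`. -/
lemma killing_ξ_F_F (hz : z ∈ Ω) :
    a z * fderiv ℝ P z (F z) = -(2 * P z * fderiv ℝ a z (F z)) := by
  have e1 := h.killing_ξ z hz (F z) (F z)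
  have e2 := h.deriv_F_F hz (ξ z)
  have e3 := congrArg (G z (F z)) (h.bracket_F_ξ hz)
  rw [map_sub, map_add, map_smul, map_smul, h.symm z hz (F z) (K z), h.K_F z hz, h.F_F z hz] at e3
  rw [h.symm z hz (fderiv ℝ ξ z (F z))] at e1
  rw [h.symm z hz (fderiv ℝ F z (ξ z)), h.ξ_P hz] at e2
  simp at e3
  linear_combination e1 - e2 - 2 * e3

/-- The component of the Killing equation of `ξ` on `(K, F)`. -/
lemma killing_ξ_K_F (hz : z ∈ Ω) : fderiv ℝ a z (K z) = fderiv ℝ b z (F z) := by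
  have e1 := h.killing_ξ z hz (K z) (F z)
  have e2 := h.deriv_K_F hz (ξ z)
  have e3 := congrArg (G z (F z)) (h.bracket_K_ξ hz)
  have e4 := congrArg (G z (K z)) (h.bracket_F_ξ hz)
  rw [map_sub, map_add, map_smul, map_smul, h.symm z hz (F z) (K z), h.K_F z hz, h.F_F z hz] at e3
  rw [map_sub, map_add, map_smul, map_smul, h.K_F z hz, h.K_K z hz] at e4
  rw [h.symm z hz (fderiv ℝ ξ z (K z))] at e1
  rw [h.symm z hz (fderiv ℝ K z (ξ z))] at e2
  simp at e3 e4
  have hP := (h.P_pos z hz).ne'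
  have : P z * (fderiv ℝ a z (K z) - fderiv ℝ b z (F z)) = 0 := by
    linear_combination e1 - e2 - e3 - e4
  rcases mul_eq_zero.1 this with h0 | h0
  · exact absurd h0 hP
  · linarith

/-- `F` preserves the metric in the normal directions, because `K` and `ξ` do. -/
lemma killing_F_normal (hz : z ∈ Ω) {Z W : E} (h1 : tauForm G K P z Z = 0)
    (h2 : thetaForm G F P z Z = 0) (h3 : tauForm G K P z W = 0) (h4 : thetaForm G F P z W = 0) :
    fderiv ℝ G z (F z) Z W + G z (fderiv ℝ F z Z) W + G z Z (fderiv ℝ F z W) = 0 := by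
  have key : ∀ z ∈ Ω, a z ≠ 0 → ∀ Z W, tauForm G K P z Z = 0 → thetaForm G F P z Z = 0 →
      tauForm G K P z W = 0 → thetaForm G F P z W = 0 →
      fderiv ℝ G z (F z) Z W + G z (fderiv ℝ F z Z) W + G z Z (fderiv ℝ F z W) = 0 := by
    intro z hz ha Z W h1 h2 h3 h4
    have e1 := h.killing_ξ z hz Z W
    have e2 := h.killing_K z hz Z W
    have gK : ∀ u, G z u (K z) = -(P z * tauForm G K P z u) := fun u ↦ by
      rw [h.symm z hz u, h.G_K hz]
    have gF : ∀ u, G z u (F z) = P z * thetaForm G F P z u := fun u ↦ by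
      rw [h.symm z hz u, h.G_F hz]
    rw [h.deriv_ξ hz, h.deriv_ξ hz, h.ξ_eq z hz] at e1
    simp only [map_add, map_smul, add_apply, smul_apply, smul_eq_mul, h.G_K hz, h.G_F hz, gK, gF,
      h1, h2, h3, h4] at e1
    have : a z * (fderiv ℝ G z (F z) Z W + G z (fderiv ℝ F z Z) W + G z Z (fderiv ℝ F z W)) = 0 := by
      linear_combination e1 - b z * e2
    exact (mul_eq_zero.1 this).resolve_left ha
  have hcG :=
    h.smooth_G.continuousOn_fderiv_of_isOpen h.isOpen (by simp)
  have hcF : ContinuousOn (fderiv ℝ F) Ω :=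
    h.smooth_F.continuousOn_fderiv_of_isOpen h.isOpen (by simp)
  have cZ := h.continuousOn_normalPart Z
  have cW := h.continuousOn_normalPart W
  have := h.eq_zero_of_dense (f := fun z ↦
    fderiv ℝ G z (F z) (normalPart G K F P z Z) (normalPart G K F P z W)
    + G z (fderiv ℝ F z (normalPart G K F P z Z)) (normalPart G K F P z W)
    + G z (normalPart G K F P z Z) (fderiv ℝ F z (normalPart G K F P z W)))
    (((((hcG.clm_apply h.smooth_F.continuousOn).clm_apply cZ).clm_apply cW).add
      ((h.smooth_G.continuousOn.clm_apply (hcF.clm_apply cZ)).clm_apply cW)).add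
      ((h.smooth_G.continuousOn.clm_apply cZ).clm_apply (hcF.clm_apply cW)))
    (fun y hy hay ↦ key y hy hay _ _ (h.tau_normalPart hy Z) (h.theta_normalPart hy Z)
      (h.tau_normalPart hy W) (h.theta_normalPart hy W)) hz
  simpa only [normalPart_of_normal h1 h2, normalPart_of_normal h3 h4] using this

end AdaptedFrame

end AdaptedFrame

/-! ### Adapted charts -/

section AdaptedChart

open Set Topology

variable {E : Type} [NormedAddCommGroup E] [NormedSpace ℝ E]

/-- A chart `e` of `E`, with a product as target, whose first two coordinate fields are `K` and `F`,
and whose last two coordinate fields are normal to these: they are annihilated by the dual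
one-forms. -/
structure IsAdaptedChart (e : OpenPartialHomeomorph E (E2 × E2)) (Ω : Set E)
    (G : E → E →L[ℝ] E →L[ℝ] ℝ) (K F : E → E) (P : E → ℝ) (S₀ S₁ : Set E2) : Prop where
  source_subset : e.source ⊆ Ω
  target_eq : e.target = S₀ ×ˢ S₁
  smooth : ContDiffOn ℝ ∞ e e.source
  smooth_symm : ContDiffOn ℝ ∞ e.symm e.target
  deriv_zero : ∀ q ∈ e.target, fderiv ℝ e.symm q (coordVec 0, 0) = K (e.symm q)
  deriv_one : ∀ q ∈ e.target, fderiv ℝ e.symm q (coordVec 1, 0) = F (e.symm q)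
  tau_deriv : ∀ q ∈ e.target, ∀ v, tauForm G K P (e.symm q) (fderiv ℝ e.symm q (0, v)) = 0
  theta_deriv : ∀ q ∈ e.target, ∀ v, thetaForm G F P (e.symm q) (fderiv ℝ e.symm q (0, v)) = 0

/-- A primitive of a smooth closed one-form is smooth. -/
lemma exists_primitive {Ω : Set E} (hΩ : IsOpen Ω) (hc : Convex ℝ Ω) {φ : E → E →L[ℝ] ℝ}
    (hφ : ContDiffOn ℝ ∞ φ Ω) (hcl : ∀ z ∈ Ω, ∀ u v, fderiv ℝ φ z u v = fderiv ℝ φ z v u) :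
    ∃ f : E → ℝ, ContDiffOn ℝ ∞ f Ω ∧ ∀ z ∈ Ω, HasFDerivAt f (φ z) z := by
  obtain ⟨f, hf⟩ := hc.exists_forall_hasFDerivAt_of_fderiv_symmetric hΩ
    (hφ.differentiableOn (by simp)) hcl
  refine ⟨f, ?_, hf⟩
  rw [contDiffOn_infty_iff_fderiv_of_isOpen hΩ]
  exact ⟨fun z hz ↦ (hf z hz).differentiableAt.differentiableWithinAt,
    hφ.congr fun z hz ↦ (hf z hz).fderiv⟩

variable [FiniteDimensional ℝ E]

/-- An adapted frame extends to adapted coordinates `(t, x, y)`: the closed forms `τ` and `θ` have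
primitives `t` and `x`, and `y` is a submersion whose fibres are the integral surfaces of the
commuting fields `K` and `F`. -/
theorem AdaptedFrame.exists_chart (hdim : Module.finrank ℝ E = 4) {Ω : Set E}
    {G : E → E →L[ℝ] E →L[ℝ] ℝ} {K F ξ : E → E} {P a b : E → ℝ}
    (h : AdaptedFrame Ω G K F ξ P a b) {p : E} (hp : p ∈ Ω) :
    ∃ (e : OpenPartialHomeomorph E (E2 × E2)) (c₀ c₁ : E2) (r : ℝ), 0 < r ∧ p ∈ e.source ∧
      IsAdaptedChart e Ω G K F P (Metric.ball c₀ r) (Metric.ball c₁ r) := by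
  obtain ⟨W, η, hW, hpW, hWΩ, hη, hηd⟩ := exists_first_integrals hdim h.isOpen h.smooth_K h.smooth_F
    (fun z hz ↦ (h.commute hz).symm) hp (fun m hm ↦ by
      have h1 := congrArg (tauForm G K P p) hm
      have h2 := congrArg (thetaForm G F P p) hm
      simp only [map_add, map_smul, h.tau_K hp, h.tau_F hp, h.theta_K hp, h.theta_F hp] at h1 h2
      simp at h1 h2
      exact Prod.ext h1 h2)
  obtain ⟨ε, hε, hball⟩ := Metric.isOpen_iff.1 hW p hpW
  have hBΩ : Metric.ball p ε ⊆ Ω := hball.trans hWΩ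
  obtain ⟨t, ht, htd⟩ := exists_primitive Metric.isOpen_ball (convex_ball p ε)
    (h.smooth_tau.mono hBΩ) fun z hz ↦ h.tau_closed (hBΩ hz)
  obtain ⟨x, hx, hxd⟩ := exists_primitive Metric.isOpen_ball (convex_ball p ε)
    (h.smooth_theta.mono hBΩ) fun z hz ↦ h.theta_closed (hBΩ hz)
  set f : E → E2 × E2 := fun z ↦ (t z • coordVec 0 + x z • coordVec 1, η z) with hf
  have hfs : ContDiffOn ℝ ∞ f (Metric.ball p ε) :=
    ((ht.smul contDiffOn_const).add (hx.smul contDiffOn_const)).prodMk (hη.mono hball)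
  set f' : E → E →L[ℝ] E2 × E2 := fun z ↦
    ((tauForm G K P z).smulRight (coordVec 0) + (thetaForm G F P z).smulRight (coordVec 1)).prod
      (fderiv ℝ η z) with hf'
  have hfd : ∀ z ∈ Metric.ball p ε, HasFDerivAt f (f' z) z := fun z hz ↦
    (((htd z hz).smul_const _).add ((hxd z hz).smul_const _)).prodMk
      (hη.differentiableAt_of_isOpen hW (hball hz)).hasFDerivAt
  have hf'app : ∀ z v, f' z v = (tauForm G K P z v • coordVec 0 + thetaForm G F P z v • coordVec 1,
      fderiv ℝ η z v) := fun z v ↦ rfl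
  have hcoord : ∀ {s r : ℝ} {m : E2}, s • coordVec 0 + r • coordVec 1 = m → s = m 0 ∧ r = m 1 := by
    rintro s r m rfl
    simp [coordVec]
  have hbij : Function.Bijective (f' p) := by
    have hinj : Function.Injective (f' p) := by
      rw [injective_iff_map_eq_zero]
      intro v hv
      rw [hf'app, Prod.mk_eq_zero] at hv
      obtain ⟨h1, h2⟩ := hcoord hv.1
      obtain ⟨m, hm⟩ := (hηd p hpW).2.2 v hv.2
      rw [hm, map_add, map_smul, map_smul] at h1 h2
      rw [h.tau_K hp, h.tau_F hp] at h1
      rw [h.theta_K hp, h.theta_F hp] at h2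
      simp at h1 h2
      rw [hm, h1, h2]
      simp
    exact ⟨hinj, (LinearMap.injective_iff_surjective_of_finrank_eq_finrank
      (f := (f' p).toLinearMap) (by simp [hdim])).1 hinj⟩
  obtain ⟨e₀, he0, heU, hef, hes, hed⟩ := exists_smooth_openPartialHomeomorph Metric.isOpen_ball hfs
    (Metric.mem_ball_self hε)
    (f' := (LinearEquiv.ofBijective (f' p).toLinearMap hbij).toContinuousLinearEquiv)
    (hfd p (Metric.mem_ball_self hε))
  obtain ⟨r, hr, hrt⟩ := Metric.isOpen_iff.1 e₀.open_target _ (e₀.map_source he0)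
  set c := e₀ p with hc
  rw [← Prod.mk.eta (p := c), ← ball_prod_same] at hrt
  have hop : IsOpen (Metric.ball c.1 r ×ˢ Metric.ball c.2 r) :=
    Metric.isOpen_ball.prod Metric.isOpen_ball
  set e := (e₀.symm.restrOpen _ hop).symm with he
  have htgt : e.target = Metric.ball c.1 r ×ˢ Metric.ball c.2 r := by
    change e₀.target ∩ _ = _
    exact inter_eq_right.2 hrt
  have hee : ∀ z, e z = f z := fun z ↦ hef z
  have hsymm : ∀ q, e.symm q = e₀.symm q := fun q ↦ rfl
  have hts : ∀ q ∈ e.target, e.symm q ∈ e₀.source := fun q hq ↦ by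
    rw [hsymm]
    exact e₀.map_target (by rw [htgt] at hq; exact hrt hq)
  have hfe : ∀ q ∈ e.target, f (e.symm q) = q := fun q hq ↦ by rw [← hee, e.right_inv hq]
  -- the derivative of the inverse chart inverts the derivative of `f`
  have hder : ∀ q ∈ e.target, Function.LeftInverse (fderiv ℝ e.symm q) (f' (e.symm q)) ∧
      Function.RightInverse (fderiv ℝ e.symm q) (f' (e.symm q)) := by
    intro q hq
    obtain ⟨L, hL, hLs⟩ := hed _ (hts q hq)
    rw [hfe q hq] at hLs
    have h1 : fderiv ℝ e.symm q = L.symm := HasFDerivAt.fderiv hLs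
    have h2 : f' (e.symm q) = L := (hfd _ (heU (hts q hq))).unique hL
    rw [h1, h2]
    exact ⟨L.left_inv, L.right_inv⟩
  have hin : ∀ q ∈ e.target, e.symm q ∈ Metric.ball p ε := fun q hq ↦ heU (hts q hq)
  have hsrc : e.source ⊆ Metric.ball p ε := fun z hz ↦ by
    have := hin _ (e.map_source hz)
    rwa [e.left_inv hz] at this
  have hder' : ∀ q ∈ e.target, ∀ v,
      tauForm G K P (e.symm q) (fderiv ℝ e.symm q (0, v)) = 0 ∧
      thetaForm G F P (e.symm q) (fderiv ℝ e.symm q (0, v)) = 0 := by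
    intro q hq v
    have h1 := (hder q hq).2 (0, v)
    rw [hf'app, Prod.mk.injEq] at h1
    simpa using hcoord h1.1
  refine ⟨e, c.1, c.2, r, hr, ?_, hsrc.trans hBΩ, htgt, ?_, ?_, ?_, ?_,
    fun q hq v ↦ (hder' q hq v).1, fun q hq v ↦ (hder' q hq v).2⟩
  · rw [he]
    change p ∈ (e₀.symm.restrOpen _ hop).target
    have : c ∈ (e₀.symm.restrOpen _ hop).source := ⟨e₀.map_source he0, by simpa using hr⟩
    have h2 := (e₀.symm.restrOpen _ hop).map_source this
    convert! h2 using 1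
    exact (e₀.left_inv he0).symm
  · exact (hfs.mono hsrc).congr fun z _ ↦ hee z
  · refine hes.mono ?_
    rw [htgt]
    exact hrt
  · intro q hq
    have hz := hin q hq
    have h1 := (hder q hq).1 (K (e.symm q))
    rwa [hf'app, (hηd _ (hball hz)).1, h.tau_K (hBΩ hz), h.theta_K (hBΩ hz), one_smul, zero_smul,
      add_zero] at h1
  · intro q hq
    have hz := hin q hq
    have h1 := (hder q hq).1 (F (e.symm q))
    rwa [hf'app, (hηd _ (hball hz)).2.1, h.tau_F (hBΩ hz), h.theta_F (hBΩ hz), one_smul, zero_smul,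
      zero_add] at h1

end AdaptedChart

/-! ### Components of the metric in an adapted chart -/

section LorentzAlgebra

variable {V : Type*} [AddCommGroup V] [Module ℝ V] [TopologicalSpace V]

/-- A vector orthogonal to a timelike vector is spacelike: otherwise the form would be negative
semidefinite on a plane, which meets the positive definite complement of a timelike vector. -/
lemma IsLorentzForm.pos_of_orthogonal {B : V →L[ℝ] V →L[ℝ] ℝ} (hB : IsLorentzForm B) {k z : V}
    (hk : B k k < 0) (hkz : B k z = 0) (hz : z ≠ 0) : 0 < B z z := by
  obtain ⟨hsymm, v, hv, hpos⟩ := hB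
  by_contra hcon
  push Not at hcon
  have hvk : B v k ≠ 0 := fun h0 ↦ by
    have := hpos k h0 (by rintro rfl; simp at hk)
    linarith
  have hu : B v (B v z • k - B v k • z) = 0 := by
    simp only [map_sub, map_smul, smul_eq_mul]
    ring
  have huu : B (B v z • k - B v k • z) (B v z • k - B v k • z) =
      B v z * B v z * B k k + B v k * B v k * B z z := by
    simp only [map_sub, map_smul, smul_eq_mul, sub_apply, smul_apply, hsymm z k, hkz]
    ring
  by_cases h0 : B v z • k - B v k • z = 0
  · have h1 := congrArg (B k) h0
    simp only [map_sub, map_smul, hkz, map_zero, smul_eq_mul, mul_zero, sub_zero] at h1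
    have h2 : B v z = 0 := (mul_eq_zero.1 h1).resolve_right hk.ne
    rw [h2, zero_smul, zero_sub, neg_eq_zero, smul_eq_zero] at h0
    exact h0.elim hvk hz
  · have h1 := hpos _ hu h0
    rw [huu] at h1
    nlinarith [mul_self_nonneg (B v z), mul_self_nonneg (B v k)]

end LorentzAlgebra

section WarpedProduct

open Set Topology

lemma partialD_slice {f : E2 × E2 → ℝ} {a y : E2} (hf : DifferentiableAt ℝ f (a, y)) (i : Fin 2) :
    partialD i (fun b ↦ f (b, y)) a = fderiv ℝ f (a, y) (coordVec i, 0) := by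
  have : HasFDerivAt (fun b ↦ f (b, y)) _ a :=
    hf.hasFDerivAt.comp a (hasFDerivAt_prodMk_left a y)
  rw [partialD, this.fderiv]
  simp

variable {E : Type} [NormedAddCommGroup E] [NormedSpace ℝ E]
  {Ω : Set E} {G : E → E →L[ℝ] E →L[ℝ] ℝ} {K F ξ : E → E} {P a b : E → ℝ}
  {e : OpenPartialHomeomorph E (E2 × E2)} {S₀ S₁ : Set E2}

namespace IsAdaptedChart

variable (h : AdaptedFrame Ω G K F ξ P a b) (he : IsAdaptedChart e Ω G K F P S₀ S₁)
  {q : E2 × E2}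
include he

lemma symm_mem (hq : q ∈ e.target) : e.symm q ∈ Ω := he.source_subset (e.map_target hq)

lemma differentiableAt_symm (hq : q ∈ e.target) : DifferentiableAt ℝ e.symm q :=
  he.smooth_symm.differentiableAt_of_isOpen e.open_target hq

lemma comp_smooth {X : Type*} [NormedAddCommGroup X] [NormedSpace ℝ X] {f : E → X}
    (hf : ContDiffOn ℝ ∞ f Ω) : ContDiffOn ℝ ∞ (fun q ↦ f (e.symm q)) e.target :=
  hf.comp he.smooth_symm fun _ hq ↦ he.symm_mem hq

lemma fderiv_comp {X : Type*} [NormedAddCommGroup X] [NormedSpace ℝ X] {f : E → X} (hΩ : IsOpen Ω)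
    (hf : ContDiffOn ℝ ∞ f Ω) (hq : q ∈ e.target) (v : E2 × E2) :
    fderiv ℝ (fun q ↦ f (e.symm q)) q v = fderiv ℝ f (e.symm q) (fderiv ℝ e.symm q v) := by
  have : HasFDerivAt (fun q ↦ f (e.symm q)) _ q :=
    (hf.differentiableAt_of_isOpen hΩ (he.symm_mem hq)).hasFDerivAt.comp q
      (he.differentiableAt_symm hq).hasFDerivAt
  rw [this.fderiv]
  rfl

include h

lemma eq_zero_of_dense {f : E2 × E2 → ℝ} (hf : ContinuousOn f e.target)
    (h0 : ∀ q ∈ e.target, a (e.symm q) * f q = 0) (hq : q ∈ e.target) : f q = 0 := by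
  by_contra hne
  have hV : IsOpen (e.target ∩ f ⁻¹' {0}ᶜ) :=
    hf.isOpen_inter_preimage e.open_target isOpen_compl_singleton
  obtain ⟨z, ⟨r, hr, rfl⟩, haz⟩ := h.dense (e.symm '' (e.target ∩ f ⁻¹' {0}ᶜ))
    (by rintro _ ⟨r, hr, rfl⟩; exact he.symm_mem hr.1)
    (e.symm.isOpen_image_of_subset_source hV inter_subset_left) ⟨_, q, ⟨hq, hne⟩, rfl⟩
  exact (mul_eq_zero.1 (h0 r hr.1)).elim haz hr.2

lemma deriv_a_normal (hq : q ∈ e.target) (v : E2) :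
    fderiv ℝ (fun q ↦ a (e.symm q)) q (0, v) = 0 := by
  rw [he.fderiv_comp h.isOpen h.smooth_a hq]
  exact h.normal_a (he.symm_mem hq) (he.tau_deriv q hq v) (he.theta_deriv q hq v)

omit he in
lemma smooth_logDeriv : ContDiffOn ℝ ∞ (fun z ↦ fderiv ℝ P z (F z) / P z) Ω :=
  ((h.smooth_P.fderiv_of_isOpen h.isOpen (m := ∞) (by simp)).clm_apply h.smooth_F).div h.smooth_P
    fun z hz ↦ (h.P_pos z hz).ne'

omit he in
lemma a_mul_logDeriv {z : E} (hz : z ∈ Ω) :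
    a z * (fderiv ℝ P z (F z) / P z) = -2 * fderiv ℝ a z (F z) := by
  have h1 := h.killing_ξ_F_F hz
  have h2 := (h.P_pos z hz).ne'
  field_simp
  linarith

/-- `F log P` does not depend on the normal coordinates: it is determined by `a F log P = -2 F a`,
and `a` is constant in normal directions. -/
lemma deriv_logDeriv_normal (hq : q ∈ e.target) (v : E2) :
    fderiv ℝ (fun q ↦ fderiv ℝ P (e.symm q) (F (e.symm q)) / P (e.symm q)) q (0, v) = 0 := by
  set ℓ : E2 × E2 → ℝ := fun q ↦ fderiv ℝ P (e.symm q) (F (e.symm q)) / P (e.symm q) with hℓ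
  have hℓs : ContDiffOn ℝ ∞ ℓ e.target := he.comp_smooth (smooth_logDeriv h)
  set α : E2 × E2 → ℝ := fun q ↦ a (e.symm q) with hα
  have hαs : ContDiffOn ℝ ∞ α e.target := he.comp_smooth h.smooth_a
  have hc : ContinuousOn (fun q ↦ fderiv ℝ ℓ q (0, v)) e.target :=
    (hℓs.continuousOn_fderiv_of_isOpen e.open_target (by simp)).clm_apply continuousOn_const
  refine eq_zero_of_dense h he (f := fun q ↦ fderiv ℝ ℓ q (0, v)) hc (fun q hq ↦ ?_) hq
  have hdα := hαs.differentiableAt_of_isOpen e.open_target hq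
  have hdℓ := hℓs.differentiableAt_of_isOpen e.open_target hq
  have hd1 : ContDiffOn ℝ ∞ (fun r ↦ fderiv ℝ α r (coordVec 1, 0)) e.target :=
    (hαs.fderiv_of_isOpen e.open_target (m := ∞) (by simp)).clm_apply contDiffOn_const
  have e1 : ∀ r ∈ e.target, α r * ℓ r = -2 * fderiv ℝ α r (coordVec 1, 0) := by
    intro r hr
    rw [hα, he.fderiv_comp h.isOpen h.smooth_a hr, he.deriv_one r hr]
    exact a_mul_logDeriv h (he.symm_mem hr)
  have e2 := congrArg (fun φ : E2 × E2 →L[ℝ] ℝ ↦ φ (0, v))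
    (fderiv_congr_of_isOpen e.open_target e1 hq)
  have e3 : fderiv ℝ (fun r ↦ fderiv ℝ α r (coordVec 1, 0)) q (0, v) = 0 := by
    rw [fderiv_fderiv_apply_comm e.open_target hαs hq,
      fderiv_congr_of_isOpen e.open_target (g := fun _ ↦ (0 : ℝ))
        (fun r hr ↦ deriv_a_normal h he hr v) hq]
    simp
  rw [fderiv_fun_mul hdα hdℓ, fderiv_const_mul (hd1.differentiableAt_of_isOpen e.open_target hq)] at e2
  simp only [add_apply, smul_apply, smul_eq_mul, e3] at e2
  rw [show fderiv ℝ α q (0, v) = 0 from deriv_a_normal h he hq v] at e2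
  simpa using e2

/-- The metric in the normal directions does not depend on the first two coordinates. -/
lemma deriv_normal_metric (hq : q ∈ e.target) (i : Fin 2) (u v : E2) :
    fderiv ℝ (fun q ↦ G (e.symm q) (fderiv ℝ e.symm q (0, u)) (fderiv ℝ e.symm q (0, v))) q
      (coordVec i, 0) = 0 := by
  have hGs : ContDiffOn ℝ ∞ (fun q ↦ G (e.symm q)) e.target := he.comp_smooth h.smooth_G
  have hds : ContDiffOn ℝ ∞ (fderiv ℝ e.symm) e.target :=
    he.smooth_symm.fderiv_of_isOpen e.open_target (by simp)
  have hdv : ∀ v, DifferentiableAt ℝ (fun q ↦ fderiv ℝ e.symm q v) q := fun v ↦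
    (hds.clm_apply contDiffOn_const).differentiableAt_of_isOpen e.open_target hq
  rw [fderiv_pairing_along (hGs.differentiableAt_of_isOpen e.open_target hq) (hdv _) (hdv _),
    he.fderiv_comp h.isOpen h.smooth_G hq,
    fderiv_fderiv_apply_comm e.open_target he.smooth_symm hq,
    fderiv_fderiv_apply_comm e.open_target he.smooth_symm hq (0, v)]
  have hz := he.symm_mem hq
  fin_cases i
  · simp only [Fin.zero_eta, Fin.isValue]
    rw [fderiv_congr_of_isOpen e.open_target he.deriv_zero hq, he.deriv_zero q hq,
      he.fderiv_comp h.isOpen h.smooth_K hq, he.fderiv_comp h.isOpen h.smooth_K hq]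
    exact h.killing_K _ hz _ _
  · simp only [Fin.mk_one, Fin.isValue]
    rw [fderiv_congr_of_isOpen e.open_target he.deriv_one hq, he.deriv_one q hq,
      he.fderiv_comp h.isOpen h.smooth_F hq, he.fderiv_comp h.isOpen h.smooth_F hq]
    exact h.killing_F_normal hz (he.tau_deriv q hq u) (he.theta_deriv q hq u)
      (he.tau_deriv q hq v) (he.theta_deriv q hq v)

lemma logDeriv_eq (hS₁ : IsOpen S₁) (hc₁ : Convex ℝ S₁) {a₀ y₁ y₀ : E2} (ha₀ : a₀ ∈ S₀)
    (hy₁ : y₁ ∈ S₁) (hy₀ : y₀ ∈ S₁) :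
    fderiv ℝ P (e.symm (a₀, y₁)) (F (e.symm (a₀, y₁))) / P (e.symm (a₀, y₁)) =
      fderiv ℝ P (e.symm (a₀, y₀)) (F (e.symm (a₀, y₀))) / P (e.symm (a₀, y₀)) := by
  have hmem : ∀ {y}, y ∈ S₁ → (a₀, y) ∈ e.target := fun hy ↦ by
    rw [he.target_eq]
    exact ⟨ha₀, hy⟩
  set ℓ : E2 × E2 → ℝ := fun q ↦ fderiv ℝ P (e.symm q) (F (e.symm q)) / P (e.symm q) with hℓ
  have hℓs : ContDiffOn ℝ ∞ ℓ e.target := he.comp_smooth (smooth_logDeriv h)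
  refine eq_of_partialD_eq_zero hS₁ hc₁ (f := fun y ↦ ℓ (a₀, y)) (hℓs.comp
    (contDiff_prodMk_right a₀).contDiffOn fun y hy ↦ hmem hy) (fun y hy i ↦ ?_) hy₁ hy₀
  have : HasFDerivAt (fun y ↦ ℓ (a₀, y)) _ y :=
    (hℓs.differentiableAt_of_isOpen e.open_target (hmem hy)).hasFDerivAt.comp y
      (hasFDerivAt_prodMk_right a₀ y)
  rw [partialD, this.fderiv]
  exact deriv_logDeriv_normal h he (hmem hy) _

/-- `log P` is the sum of a function of the first two and a function of the last two coordinates. -/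
lemma log_P_eq (hS₀ : IsOpen S₀) (hS₁ : IsOpen S₁) (hc₀ : Convex ℝ S₀) (hc₁ : Convex ℝ S₁)
    {a₁ a₀ y₁ y₀ : E2} (ha₁ : a₁ ∈ S₀) (ha₀ : a₀ ∈ S₀) (hy₁ : y₁ ∈ S₁) (hy₀ : y₀ ∈ S₁) :
    Real.log (P (e.symm (a₁, y₁))) - Real.log (P (e.symm (a₁, y₀))) =
      Real.log (P (e.symm (a₀, y₁))) - Real.log (P (e.symm (a₀, y₀))) := by
  have hmem : ∀ {a y}, a ∈ S₀ → y ∈ S₁ → (a, y) ∈ e.target := fun ha hy ↦ by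
    rw [he.target_eq]
    exact ⟨ha, hy⟩
  have hLs : ContDiffOn ℝ ∞ (fun z ↦ Real.log (P z)) Ω :=
    h.smooth_P.log fun z hz ↦ (h.P_pos z hz).ne'
  have hLd : ∀ z ∈ Ω, ∀ u, fderiv ℝ (fun z ↦ Real.log (P z)) z u = fderiv ℝ P z u / P z := by
    intro z hz u
    rw [((h.dP hz).hasFDerivAt.log (h.P_pos z hz).ne').fderiv]
    simp [div_eq_inv_mul]
  have hLe := he.comp_smooth hLs
  have hsl : ∀ y ∈ S₁, ContDiffOn ℝ ∞ (fun a ↦ Real.log (P (e.symm (a, y)))) S₀ := fun y hy ↦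
    hLe.comp (contDiff_prodMk_left y).contDiffOn fun a ha ↦ hmem ha hy
  have hpd : ∀ a ∈ S₀, ∀ y ∈ S₁, ∀ i, partialD i (fun a ↦ Real.log (P (e.symm (a, y)))) a =
      fderiv ℝ P (e.symm (a, y)) (fderiv ℝ e.symm (a, y) (coordVec i, 0)) / P (e.symm (a, y)) := by
    intro a ha y hy i
    rw [partialD_slice (f := fun q ↦ Real.log (P (e.symm q)))
      (hLe.differentiableAt_of_isOpen e.open_target (hmem ha hy)),
      he.fderiv_comp h.isOpen hLs (hmem ha hy), hLd _ (he.symm_mem (hmem ha hy))]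
  have hconst : ∀ a ∈ S₀, fderiv ℝ P (e.symm (a, y₁)) (F (e.symm (a, y₁))) / P (e.symm (a, y₁)) =
      fderiv ℝ P (e.symm (a, y₀)) (F (e.symm (a, y₀))) / P (e.symm (a, y₀)) :=
    fun a ha ↦ logDeriv_eq h he hS₁ hc₁ ha hy₁ hy₀
  refine eq_of_partialD_eq_zero hS₀ hc₀ (f := fun a ↦ Real.log (P (e.symm (a, y₁)))
    - Real.log (P (e.symm (a, y₀)))) ((hsl y₁ hy₁).sub (hsl y₀ hy₀)) (fun a ha i ↦ ?_) ha₁ ha₀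
  rw [partialD_sub ((hsl y₁ hy₁).differentiableAt_of_isOpen hS₀ ha)
    ((hsl y₀ hy₀).differentiableAt_of_isOpen hS₀ ha), hpd a ha y₁ hy₁, hpd a ha y₀ hy₀]
  fin_cases i
  · simp only [Fin.zero_eta, Fin.isValue]
    rw [he.deriv_zero _ (hmem ha hy₁), he.deriv_zero _ (hmem ha hy₀),
      h.K_P (he.symm_mem (hmem ha hy₁)), h.K_P (he.symm_mem (hmem ha hy₀))]
    simp
  · simp only [Fin.mk_one, Fin.isValue]
    rw [he.deriv_one _ (hmem ha hy₁), he.deriv_one _ (hmem ha hy₀), hconst a ha, sub_self]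

lemma normal_metric_eq (hS₀ : IsOpen S₀) (hc₀ : Convex ℝ S₀) {a₁ a₀ y : E2} (ha₁ : a₁ ∈ S₀)
    (ha₀ : a₀ ∈ S₀) (hy : y ∈ S₁) (u v : E2) :
    G (e.symm (a₁, y)) (fderiv ℝ e.symm (a₁, y) (0, u)) (fderiv ℝ e.symm (a₁, y) (0, v)) =
      G (e.symm (a₀, y)) (fderiv ℝ e.symm (a₀, y) (0, u)) (fderiv ℝ e.symm (a₀, y) (0, v)) := by
  have hmem : ∀ {a}, a ∈ S₀ → (a, y) ∈ e.target := fun ha ↦ by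
    rw [he.target_eq]
    exact ⟨ha, hy⟩
  have hds : ContDiffOn ℝ ∞ (fderiv ℝ e.symm) e.target :=
    he.smooth_symm.fderiv_of_isOpen e.open_target (by simp)
  have hs : ContDiffOn ℝ ∞ (fun q ↦
      G (e.symm q) (fderiv ℝ e.symm q (0, u)) (fderiv ℝ e.symm q (0, v))) e.target :=
    ((he.comp_smooth h.smooth_G).clm_apply (hds.clm_apply contDiffOn_const)).clm_apply
      (hds.clm_apply contDiffOn_const)
  refine eq_of_partialD_eq_zero hS₀ hc₀ (f := fun a ↦ G (e.symm (a, y))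
    (fderiv ℝ e.symm (a, y) (0, u)) (fderiv ℝ e.symm (a, y) (0, v)))
    (hs.comp (contDiff_prodMk_left y).contDiffOn fun a ha ↦ hmem ha) (fun a ha i ↦ ?_) ha₁ ha₀
  rw [partialD_slice (f := fun q ↦ G (e.symm q) (fderiv ℝ e.symm q (0, u))
    (fderiv ℝ e.symm q (0, v))) (hs.differentiableAt_of_isOpen e.open_target (hmem ha))]
  exact deriv_normal_metric h he (hmem ha) i u v

omit h in
lemma slice_smooth {f : E → ℝ} (hf : ContDiffOn ℝ ∞ f Ω) {y : E2} (hy : y ∈ S₁) :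
    ContDiffOn ℝ ∞ (fun a ↦ f (e.symm (a, y))) S₀ :=
  (he.comp_smooth hf).comp (contDiff_prodMk_left y).contDiffOn fun a ha ↦ by
    rw [he.target_eq]
    exact ⟨ha, hy⟩

lemma partialD_zero_comp {f : E → ℝ} (hf : ContDiffOn ℝ ∞ f Ω) {a₀ y : E2} (ha₀ : a₀ ∈ S₀)
    (hy : y ∈ S₁) : partialD 0 (fun a ↦ f (e.symm (a, y))) a₀ =
      fderiv ℝ f (e.symm (a₀, y)) (K (e.symm (a₀, y))) := by
  have hq : (a₀, y) ∈ e.target := by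
    rw [he.target_eq]
    exact ⟨ha₀, hy⟩
  rw [partialD_slice (f := fun q ↦ f (e.symm q))
    ((he.comp_smooth hf).differentiableAt_of_isOpen e.open_target hq),
    he.fderiv_comp h.isOpen hf hq, he.deriv_zero _ hq]

lemma partialD_one_comp {f : E → ℝ} (hf : ContDiffOn ℝ ∞ f Ω) {a₀ y : E2} (ha₀ : a₀ ∈ S₀)
    (hy : y ∈ S₁) : partialD 1 (fun a ↦ f (e.symm (a, y))) a₀ =
      fderiv ℝ f (e.symm (a₀, y)) (F (e.symm (a₀, y))) := by
  have hq : (a₀, y) ∈ e.target := by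
    rw [he.target_eq]
    exact ⟨ha₀, hy⟩
  rw [partialD_slice (f := fun q ↦ f (e.symm q))
    ((he.comp_smooth hf).differentiableAt_of_isOpen e.open_target hq),
    he.fderiv_comp h.isOpen hf hq, he.deriv_one _ hq]

/-- The Lorentzian factor `P (-dt² + dx²)` of the metric has constant curvature on every slice:
where `a ≠ 0`, this is the compatibility condition of the Killing equations for `ξ = a F + b K`,
and it does not depend on the normal coordinates. -/
lemma constantCurvature (hS₀ : IsOpen S₀) (hS₁ : IsOpen S₁) (hc₀ : Convex ℝ S₀)
    (hc₁ : Convex ℝ S₁) {y : E2} (hy : y ∈ S₁) :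
    (conformalForm fun a ↦ P (e.symm (a, y))).HasConstantCurvatureOn S₀ := by
  have hmem : ∀ {a y'}, a ∈ S₀ → y' ∈ S₁ → (a, y') ∈ e.target := fun ha hy' ↦ by
    rw [he.target_eq]
    exact ⟨ha, hy'⟩
  have hmΩ : ∀ {a y'}, a ∈ S₀ → y' ∈ S₁ → e.symm (a, y') ∈ Ω := fun ha hy' ↦
    he.symm_mem (hmem ha hy')
  have hpos : ∀ a ∈ S₀, 0 < P (e.symm (a, y)) := fun a ha ↦ h.P_pos _ (hmΩ ha hy)
  have hU := he.slice_smooth h.smooth_P hy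
  have hU0 : ∀ a ∈ S₀, partialD 0 (fun a ↦ P (e.symm (a, y))) a = 0 := fun a ha ↦ by
    rw [partialD_zero_comp h he h.smooth_P ha hy, h.K_P (hmΩ ha hy)]
  have hℓ0 := partialD_logDeriv_eq_zero hS₀ hU hpos hU0
  refine hasConstantCurvatureOn_conformalForm hS₀ hc₀ hU hpos hU0 ?_
  set ℓ : E2 → ℝ := fun b ↦ partialD 1 (fun a ↦ P (e.symm (a, y))) b / P (e.symm (b, y)) with hℓ
  have hℓs : ContDiffOn ℝ ∞ ℓ S₀ := (hU.partialD hS₀ 1).div hU fun b hb ↦ (hpos b hb).ne'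
  have hℓe : ∀ b ∈ S₀, ∀ y' ∈ S₁, ℓ b =
      fderiv ℝ P (e.symm (b, y')) (F (e.symm (b, y'))) / P (e.symm (b, y')) := by
    intro b hb y' hy'
    rw [hℓ]
    simp only
    rw [partialD_one_comp h he h.smooth_P hb hy]
    exact logDeriv_eq h he hS₁ hc₁ hb hy hy'
  have key : ∀ q ∈ e.target, a (e.symm q) *
      (partialD 1 (partialD 1 ℓ) q.1 - ℓ q.1 * partialD 1 ℓ q.1) = 0 := by
    rintro ⟨b₀, y'⟩ hq
    rw [he.target_eq] at hq
    obtain ⟨hb₀, hy'⟩ : b₀ ∈ S₀ ∧ y' ∈ S₁ := hq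
    refine killing_compatibility (α := fun b ↦ a (e.symm (b, y'))) (β := fun c ↦ b (e.symm (c, y')))
      hS₀ (he.slice_smooth h.smooth_a hy') (he.slice_smooth h.smooth_b hy') hℓs (fun c hc ↦ ?_)
      (fun c hc ↦ ?_) (fun c hc ↦ ?_) hℓ0 hb₀
    · rw [partialD_one_comp h he h.smooth_a hc hy', hℓe c hc y' hy']
      linarith [a_mul_logDeriv h (hmΩ hc hy')]
    · rw [partialD_zero_comp h he h.smooth_b hc hy', hℓe c hc y' hy']
      have h1 := h.killing_ξ_K_K (hmΩ hc hy')
      have h2 := (h.P_pos _ (hmΩ hc hy')).ne'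
      field_simp
      linarith
    · rw [partialD_zero_comp h he h.smooth_a hc hy', partialD_one_comp h he h.smooth_b hc hy',
        h.killing_ξ_K_F (hmΩ hc hy')]
  have hs : ContDiffOn ℝ ∞ (fun b ↦ partialD 1 (partialD 1 ℓ) b - ℓ b * partialD 1 ℓ b) S₀ :=
    ((hℓs.partialD hS₀ 1).partialD hS₀ 1).sub (hℓs.mul (hℓs.partialD hS₀ 1))
  intro b hb
  refine sub_eq_zero.1 (eq_zero_of_dense h he
    (f := fun q ↦ partialD 1 (partialD 1 ℓ) q.1 - ℓ q.1 * partialD 1 ℓ q.1) ?_ key (hmem hb hy))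
  refine hs.continuousOn.comp continuousOn_fst fun q hq ↦ ?_
  rw [he.target_eq] at hq
  exact hq.1

end IsAdaptedChart

end WarpedProduct

/-! ### The warped product form -/

section WarpedChart

open Set Topology

variable {E : Type} [NormedAddCommGroup E] [NormedSpace ℝ E]
  {Ω : Set E} {G : E → E →L[ℝ] E →L[ℝ] ℝ} {K F ξ : E → E} {P a b : E → ℝ}
  {e : OpenPartialHomeomorph E (E2 × E2)} {S₀ S₁ : Set E2}

namespace IsAdaptedChart

variable (h : AdaptedFrame Ω G K F ξ P a b) (he : IsAdaptedChart e Ω G K F P S₀ S₁)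
  {q : E2 × E2}
include he

lemma fderiv_symm_fderiv {z : E} (hz : z ∈ e.source) (u : E) :
    fderiv ℝ e.symm (e z) (fderiv ℝ e z u) = u := by
  have h1 : HasFDerivAt (fun y ↦ e.symm (e y)) _ z :=
    (he.differentiableAt_symm (e.map_source hz)).hasFDerivAt.comp z
      (he.smooth.differentiableAt_of_isOpen e.open_source hz).hasFDerivAt
  have h2 : fderiv ℝ (fun y ↦ e.symm (e y)) z = fderiv ℝ (fun y ↦ y) z :=
    fderiv_congr_of_isOpen e.open_source (fun y hy ↦ e.left_inv hy) hz
  rw [h1.fderiv] at h2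
  simpa using congrArg (fun φ : E →L[ℝ] E ↦ φ u) h2

lemma fderiv_fderiv_symm (hq : q ∈ e.target) (u : E2 × E2) :
    fderiv ℝ e (e.symm q) (fderiv ℝ e.symm q u) = u := by
  have h1 : HasFDerivAt (fun y ↦ e (e.symm y)) _ q :=
    (he.smooth.differentiableAt_of_isOpen e.open_source (e.map_target hq)).hasFDerivAt.comp q
      (he.differentiableAt_symm hq).hasFDerivAt
  have h2 : fderiv ℝ (fun y ↦ e (e.symm y)) q = fderiv ℝ (fun y ↦ y) q :=
    fderiv_congr_of_isOpen e.open_target (fun y hy ↦ e.right_inv hy) hq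
  rw [h1.fderiv] at h2
  simpa using congrArg (fun φ : E2 × E2 →L[ℝ] E2 × E2 ↦ φ u) h2

lemma fderiv_symm_eq (hq : q ∈ e.target) (u : E2 × E2) : fderiv ℝ e.symm q u =
    u.1 0 • K (e.symm q) + u.1 1 • F (e.symm q) + fderiv ℝ e.symm q (0, u.2) := by
  have hu : u = u.1 0 • (coordVec 0, 0) + u.1 1 • (coordVec 1, 0) + (0, u.2) := by
    refine Prod.ext ?_ ?_
    · simpa using eq_smul_coordVec_add u.1
    · simp
  conv_lhs => rw [hu]
  rw [map_add, map_add, map_smul, map_smul, he.deriv_zero q hq, he.deriv_one q hq]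

include h

/-- The metric in adapted coordinates. -/
lemma metric_eq (hq : q ∈ e.target) (u v : E2 × E2) :
    G (e.symm q) (fderiv ℝ e.symm q u) (fderiv ℝ e.symm q v) =
      P (e.symm q) * minkowskiForm u.1 v.1 +
        G (e.symm q) (fderiv ℝ e.symm q (0, u.2)) (fderiv ℝ e.symm q (0, v.2)) := by
  have hz := he.symm_mem hq
  have gK : ∀ u, G (e.symm q) u (K (e.symm q)) = -(P (e.symm q) * tauForm G K P (e.symm q) u) :=
    fun u ↦ by rw [h.symm _ hz u, h.G_K hz]
  have gF : ∀ u, G (e.symm q) u (F (e.symm q)) = P (e.symm q) * thetaForm G F P (e.symm q) u :=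
    fun u ↦ by rw [h.symm _ hz u, h.G_F hz]
  rw [he.fderiv_symm_eq hq u, he.fderiv_symm_eq hq v, minkowskiForm_apply]
  simp only [map_add, map_smul, add_apply, smul_apply, smul_eq_mul, h.G_K hz, h.G_F hz, gK, gF,
    h.tau_K hz, h.tau_F hz, h.theta_K hz, h.theta_F hz, he.tau_deriv q hq, he.theta_deriv q hq]
  ring

/-- The metric induced on the surface `{a₀} × S₁`. -/
noncomputable def _root_.normalForm (G : E → E →L[ℝ] E →L[ℝ] ℝ)
    (e : OpenPartialHomeomorph E (E2 × E2)) (a₀ : E2) : PlaneForm := fun y ↦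
  (G (e.symm (a₀, y))).bilinearComp
    ((fderiv ℝ e.symm (a₀, y)).comp (ContinuousLinearMap.inr ℝ E2 E2))
    ((fderiv ℝ e.symm (a₀, y)).comp (ContinuousLinearMap.inr ℝ E2 E2))

omit h he in
lemma normalForm_apply (a₀ y u v : E2) : normalForm G e a₀ y u v =
    G (e.symm (a₀, y)) (fderiv ℝ e.symm (a₀, y) (0, u)) (fderiv ℝ e.symm (a₀, y) (0, v)) := by
  simp [normalForm]

lemma isRiemannianOn_normalForm (hL : ∀ z ∈ Ω, IsLorentzForm (G z)) {a₀ : E2} (ha₀ : a₀ ∈ S₀) :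
    (normalForm G e a₀).IsRiemannianOn S₁ := by
  have hmem : ∀ {y}, y ∈ S₁ → (a₀, y) ∈ e.target := fun hy ↦ by
    rw [he.target_eq]
    exact ⟨ha₀, hy⟩
  refine ⟨?_, fun y hy ↦ ⟨fun u v ↦ ?_, fun u hu ↦ ?_⟩⟩
  · have hsl := (contDiff_prodMk_right a₀ (𝕜 := ℝ) (n := ∞)).contDiffOn (s := S₁)
    have h1 : ContDiffOn ℝ ∞ (fun y ↦ G (e.symm (a₀, y))) S₁ :=
      (he.comp_smooth h.smooth_G).comp hsl fun y hy ↦ hmem hy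
    have h2 : ContDiffOn ℝ ∞ (fun y ↦ fderiv ℝ e.symm (a₀, y)) S₁ :=
      (he.smooth_symm.fderiv_of_isOpen e.open_target (m := ∞) (by simp)).comp hsl
        fun y hy ↦ hmem hy
    rw [contDiffOn_clm_apply]
    intro u
    rw [contDiffOn_clm_apply]
    intro v
    simp only [normalForm_apply]
    exact (h1.clm_apply (h2.clm_apply contDiffOn_const)).clm_apply (h2.clm_apply contDiffOn_const)
  · rw [normalForm_apply, normalForm_apply, h.symm _ (he.symm_mem (hmem hy))]
  · have hz := he.symm_mem (hmem hy)
    rw [normalForm_apply]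
    refine (hL _ hz).pos_of_orthogonal (k := K (e.symm (a₀, y))) ?_ ?_ fun h0 ↦ hu ?_
    · rw [h.K_K _ hz]
      exact neg_neg_of_pos (h.P_pos _ hz)
    · rw [h.G_K hz, he.tau_deriv _ (hmem hy)]
      simp
    · have := he.fderiv_fderiv_symm (hmem hy) (0, u)
      rw [h0, map_zero] at this
      exact (congrArg Prod.snd this).symm

end IsAdaptedChart

/-- In adapted coordinates `(t, x, y)` the metric is `P (-dt² + dx²) + γ₁` with `γ₁` depending only on
`y`, and `P` is the product of a function of `y` and of a function of `(t, x)` that makes the first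
summand a metric of constant curvature. -/
theorem AdaptedFrame.exists_warped [FiniteDimensional ℝ E] (hdim : Module.finrank ℝ E = 4)
    (h : AdaptedFrame Ω G K F ξ P a b) (hL : ∀ z ∈ Ω, IsLorentzForm (G z)) {p : E} (hp : p ∈ Ω) :
    ∃ (S₀ S₁ : Set E2) (γ₀ γ₁ : PlaneForm) (w : E2 → ℝ)
      (e : OpenPartialHomeomorph E (E2 × E2)), IsOpen S₀ ∧ IsOpen S₁ ∧ p ∈ e.source ∧
      e.source ⊆ Ω ∧ e.target = S₀ ×ˢ S₁ ∧ ContDiffOn ℝ ∞ e e.source ∧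
      ContDiffOn ℝ ∞ e.symm e.target ∧ γ₀.IsLorentzianOn S₀ ∧ γ₀.HasConstantCurvatureOn S₀ ∧
      γ₁.IsRiemannianOn S₁ ∧ ContDiffOn ℝ ∞ w S₁ ∧ ∀ z ∈ e.source, ∀ u v,
        G z u v = warpedProduct w γ₀ γ₁ (e z) (fderiv ℝ e z u) (fderiv ℝ e z v) := by
  obtain ⟨e, c₀, c₁, r, hr, hpe, he⟩ := h.exists_chart hdim hp
  have hc₀ : c₀ ∈ Metric.ball c₀ r := Metric.mem_ball_self hr
  have hc₁ : c₁ ∈ Metric.ball c₁ r := Metric.mem_ball_self hr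
  have hmem : ∀ {a y}, a ∈ Metric.ball c₀ r → y ∈ Metric.ball c₁ r → (a, y) ∈ e.target :=
    fun ha hy ↦ by
      rw [he.target_eq]
      exact ⟨ha, hy⟩
  refine ⟨_, _, conformalForm fun a ↦ P (e.symm (a, c₁)), normalForm G e c₀,
    fun y ↦ Real.log (P (e.symm (c₀, y))) - Real.log (P (e.symm (c₀, c₁))), e,
    Metric.isOpen_ball, Metric.isOpen_ball, hpe, he.source_subset, he.target_eq, he.smooth,
    he.smooth_symm, ⟨?_, fun a ha ↦ ?_⟩, IsAdaptedChart.constantCurvature h he Metric.isOpen_ball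
      Metric.isOpen_ball (convex_ball _ _) (convex_ball _ _) hc₁,
    he.isRiemannianOn_normalForm h hL hc₀, ?_, fun z hz u v ↦ ?_⟩
  · rw [contDiffOn_clm_apply]
    intro u
    rw [contDiffOn_clm_apply]
    intro v
    exact (he.slice_smooth h.smooth_P hc₁).mul contDiffOn_const
  · exact isLorentzForm_smul_minkowskiForm (h.P_pos _ (he.symm_mem (hmem ha hc₁)))
  · refine ContDiffOn.sub (ContDiffOn.log ?_ fun y hy ↦
      (h.P_pos _ (he.symm_mem (hmem hc₀ hy))).ne') contDiffOn_const
    exact (he.comp_smooth h.smooth_P).comp (contDiff_prodMk_right c₀).contDiffOn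
      fun y hy ↦ hmem hc₀ hy
  · have hq := e.map_source hz
    obtain ⟨h0, h1⟩ : (e z).1 ∈ Metric.ball c₀ r ∧ (e z).2 ∈ Metric.ball c₁ r := by
      have := hq
      rwa [he.target_eq] at this
    have hm := he.metric_eq h hq (fderiv ℝ e z u) (fderiv ℝ e z v)
    rw [he.fderiv_symm_fderiv hz, he.fderiv_symm_fderiv hz, e.left_inv hz] at hm
    have hlog := IsAdaptedChart.log_P_eq h he Metric.isOpen_ball Metric.isOpen_ball
      (convex_ball _ _) (convex_ball _ _) h0 hc₀ h1 hc₁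
    have hn := IsAdaptedChart.normal_metric_eq h he Metric.isOpen_ball (convex_ball _ _) h0 hc₀ h1
      (fderiv ℝ e z u).2 (fderiv ℝ e z v).2
    simp only [Prod.mk.eta, e.left_inv hz] at hlog hn
    rw [hm, hn, warpedProduct, IsAdaptedChart.normalForm_apply, conformalForm, ← hlog, Real.exp_sub,
      Real.exp_log (h.P_pos z (he.source_subset hz)),
      Real.exp_log (h.P_pos _ (he.symm_mem (hmem h0 hc₁)))]
    have := (h.P_pos _ (he.symm_mem (hmem h0 hc₁))).ne'
    simp only [smul_apply, smul_eq_mul]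
    field_simp

end WarpedChart

/-! ### Construction of an adapted frame -/

section FrameConstruction

open Set Topology

variable {E : Type} [NormedAddCommGroup E] [NormedSpace ℝ E]
  {Ω : Set E} {G : E → E →L[ℝ] E →L[ℝ] ℝ} {K ξ : E → E}

/-- If `K` and `b K` are both Killing fields, and `K` is timelike, then `b` is constant. -/
lemma fderiv_eq_zero_of_isKillingOn_smul {U : Set E} (hU : IsOpen U) {b : E → ℝ}
    (hK : DifferentiableOn ℝ K U) (hb : DifferentiableOn ℝ b U)
    (hsymm : ∀ z ∈ U, ∀ u v, G z u v = G z v u) (hKK : ∀ z ∈ U, G z (K z) (K z) ≠ 0)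
    (hkK : IsKillingOn G K U) (hkξ : IsKillingOn G ξ U) (hξ : ∀ z ∈ U, ξ z = b z • K z) :
    ∀ z ∈ U, fderiv ℝ b z = 0 := by
  intro z hz
  have hdb := (hb z hz).differentiableAt (hU.mem_nhds hz)
  have hdK := (hK z hz).differentiableAt (hU.mem_nhds hz)
  have key : ∀ u v, fderiv ℝ b z u * G z (K z) v + fderiv ℝ b z v * G z (K z) u = 0 := by
    intro u v
    have h1 := hkK z hz u v
    have h2 := hkξ z hz u v
    rw [fderiv_congr_of_isOpen hU hξ hz, fderiv_smul_apply hdb hdK, fderiv_smul_apply hdb hdK,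
      hξ z hz] at h2
    simp only [map_add, map_smul, add_apply, smul_apply, smul_eq_mul, hsymm z hz u (K z)] at h2
    linear_combination h2 - b z * h1
  have h0 : fderiv ℝ b z (K z) = 0 := by
    have := key (K z) (K z)
    have h2 : 2 * G z (K z) (K z) * fderiv ℝ b z (K z) = 0 := by linear_combination this
    exact (mul_eq_zero.1 h2).resolve_left (mul_ne_zero two_ne_zero (hKK z hz))
  ext u
  have := key u (K z)
  rw [h0, zero_mul, add_zero] at this
  exact (mul_eq_zero.1 this).resolve_right (hKK z hz)

/-- A vector in the span of two orthogonal vectors, in components. -/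
lemma eq_of_mem_span_pair {B : E →L[ℝ] E →L[ℝ] ℝ} (hsymm : ∀ u v, B u v = B v u) {k f x : E}
    {P : ℝ} (hP : P ≠ 0) (hk : B k k = -P) (hf : B f f = P) (hkf : B k f = 0)
    (hx : x ∈ Submodule.span ℝ {k, f}) : x = (B x f / P) • f + (-(B x k) / P) • k := by
  obtain ⟨c, d, rfl⟩ := Submodule.mem_span_pair.1 hx
  have hfk : B f k = 0 := by rw [hsymm, hkf]
  simp [hk, hf, hkf, hfk, hP, add_comm]

/-- An adapted frame exists near every point, if the values of the Lie algebra `A` generated by `K`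
and `ξ` are planes: a third field of `A` completes `K` to a frame of these planes, which is then
made orthogonal. -/
theorem exists_adaptedFrame [FiniteDimensional ℝ E] (hΩ : IsOpen Ω) {A : Set (E → E)}
    (hG : ContDiffOn ℝ ∞ G Ω) (hL : ∀ z ∈ Ω, IsLorentzForm (G z))
    (hA : ∀ X ∈ A, ContDiffOn ℝ ∞ X Ω) (hKA : K ∈ A) (hξA : ξ ∈ A)
    (hbr : ∀ X ∈ A, ∃ Z ∈ A, ∀ z ∈ Ω, Z z = fderiv ℝ X z (K z) - fderiv ℝ K z (X z))
    (hrank : ∀ z ∈ Ω, Module.finrank ℝ (Submodule.span ℝ ((fun X : E → E ↦ X z) '' A)) = 2)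
    (hne : ∀ U ⊆ Ω, IsOpen U → U.Nonempty → ∀ c : ℝ, ∃ z ∈ U, ξ z ≠ c • K z)
    (htK : ∀ z ∈ Ω, G z (K z) (K z) < 0) (htξ : ∀ z ∈ Ω, G z (ξ z) (ξ z) < 0)
    (hkK : IsKillingOn G K Ω) (hkξ : IsKillingOn G ξ Ω) (hoK : IsHypersurfaceOrthogonalOn G K Ω)
    (hoξ : IsHypersurfaceOrthogonalOn G ξ Ω) {p : E} (hp : p ∈ Ω) :
    ∃ (Ω' : Set E) (F : E → E) (P a b : E → ℝ), Ω' ⊆ Ω ∧ p ∈ Ω' ∧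
      AdaptedFrame Ω' G K F ξ P a b := by
  have hK := hA K hKA
  have hξ := hA ξ hξA
  obtain ⟨Y, hYA, hYp⟩ : ∃ Y ∈ A, Y p ∉ Submodule.span ℝ {K p} := by
    by_contra! hcon
    have h1 : Submodule.span ℝ ((fun X : E → E ↦ X p) '' A) ≤ Submodule.span ℝ {K p} :=
      Submodule.span_le.2 (by rintro _ ⟨X, hX, rfl⟩; exact hcon X hX)
    have h2 := Submodule.finrank_mono h1
    rw [hrank p hp] at h2
    have h3 : Module.finrank ℝ (Submodule.span ℝ {K p}) = 1 :=
      finrank_span_singleton fun h0 ↦ by simpa [h0] using htK p hp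
    omega
  have hY := hA Y hYA
  set P : E → ℝ := fun z ↦ -G z (K z) (K z) with hP
  have hPs : ContDiffOn ℝ ∞ P Ω := ((hG.clm_apply hK).clm_apply hK).neg
  have hPpos : ∀ z ∈ Ω, 0 < P z := fun z hz ↦ neg_pos.2 (htK z hz)
  have hsymm : ∀ z ∈ Ω, ∀ u v, G z u v = G z v u := fun z hz ↦ (hL z hz).1
  set t : E → ℝ := fun z ↦ G z (Y z) (K z) / P z with ht
  have hts : ContDiffOn ℝ ∞ t Ω :=
    ((hG.clm_apply hY).clm_apply hK).div hPs fun z hz ↦ (hPpos z hz).ne'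
  set N : E → E := fun z ↦ Y z + t z • K z with hN
  have hNs : ContDiffOn ℝ ∞ N Ω := hY.add (hts.smul hK)
  have hKN : ∀ z ∈ Ω, G z (K z) (N z) = 0 := by
    intro z hz
    have h1 : G z (K z) (K z) = -P z := by simp [hP]
    have h2 := (hPpos z hz).ne'
    simp only [hN, ht, map_add, map_smul, h1, smul_eq_mul, hsymm z hz (K z) (Y z)]
    field_simp
    ring
  set Ω' := Ω ∩ N ⁻¹' {0}ᶜ with hΩ'
  have hΩ'o : IsOpen Ω' := hNs.continuousOn.isOpen_inter_preimage hΩ isOpen_compl_singleton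
  have hsub : Ω' ⊆ Ω := inter_subset_left
  have hpΩ' : p ∈ Ω' := by
    refine ⟨hp, fun h0 ↦ hYp ?_⟩
    rw [mem_singleton_iff, hN] at h0
    rw [eq_neg_of_add_eq_zero_left h0]
    exact Submodule.neg_mem _ (Submodule.smul_mem _ _ (Submodule.mem_span_singleton_self _))
  have hNN : ∀ z ∈ Ω', 0 < G z (N z) (N z) := fun z hz ↦
    (hL z hz.1).pos_of_orthogonal (htK z hz.1) (hKN z hz.1) hz.2
  set s : E → ℝ := fun z ↦ √(P z / G z (N z) (N z)) with hs
  have hss : ContDiffOn ℝ ∞ s Ω' := by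
    refine ContDiffOn.sqrt ?_ fun z hz ↦ (div_pos (hPpos z hz.1) (hNN z hz)).ne'
    exact (hPs.mono hsub).div (((hG.clm_apply hNs).clm_apply hNs).mono hsub)
      fun z hz ↦ (hNN z hz).ne'
  have hspos : ∀ z ∈ Ω', 0 < s z := fun z hz ↦
    Real.sqrt_pos.2 (div_pos (hPpos z hz.1) (hNN z hz))
  set F : E → E := fun z ↦ s z • N z with hF
  have hFs : ContDiffOn ℝ ∞ F Ω' := hss.smul (hNs.mono hsub)
  have hKK : ∀ z ∈ Ω', G z (K z) (K z) = -P z := fun z _ ↦ by simp [hP]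
  have hKF : ∀ z ∈ Ω', G z (K z) (F z) = 0 := fun z hz ↦ by simp [hF, hKN z hz.1]
  have hFF : ∀ z ∈ Ω', G z (F z) (F z) = P z := by
    intro z hz
    have h1 := (hNN z hz).ne'
    have h2 : s z * s z = P z / G z (N z) (N z) :=
      Real.mul_self_sqrt (div_pos (hPpos z hz.1) (hNN z hz)).le
    simp only [hF, map_smul, smul_apply, smul_eq_mul]
    rw [← mul_assoc, h2]
    field_simp
  have hYspan : ∀ z ∈ Ω', F z ∈ Submodule.span ℝ ((fun X : E → E ↦ X z) '' A) := by
    intro z hz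
    refine Submodule.smul_mem _ _ (Submodule.add_mem _ ?_ (Submodule.smul_mem _ _ ?_))
    · exact Submodule.subset_span ⟨Y, hYA, rfl⟩
    · exact Submodule.subset_span ⟨K, hKA, rfl⟩
  have hspan : ∀ z ∈ Ω', ∀ X ∈ A, X z ∈ Submodule.span ℝ {K z, F z} := by
    intro z hz X hX
    have hli : LinearIndependent ℝ ![K z, F z] := by
      rw [LinearIndependent.pair_iff]
      intro c d hcd
      have h1 := congrArg (G z (K z)) hcd
      have h2 := congrArg (G z (F z)) hcd
      simp only [map_add, map_smul, hKK z hz, hKF z hz, hFF z hz, hsymm z hz.1 (F z) (K z),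
        smul_eq_mul, map_zero] at h1 h2
      have h3 := (hPpos z hz.1).ne'
      simp [h3] at h1 h2
      exact ⟨h1, h2⟩
    have h2 : Module.finrank ℝ (Submodule.span ℝ {K z, F z}) = 2 := by
      have := finrank_span_eq_card hli
      rwa [Matrix.range_cons_cons_empty, Fintype.card_fin] at this
    have hle : Submodule.span ℝ {K z, F z} ≤ Submodule.span ℝ ((fun X : E → E ↦ X z) '' A) := by
      refine Submodule.span_le.2 ?_
      rintro _ (rfl | rfl)
      · exact Submodule.subset_span ⟨K, hKA, rfl⟩
      · exact hYspan z hz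
    rw [Submodule.eq_of_le_of_finrank_eq hle (by rw [h2, hrank z hz.1])]
    exact Submodule.subset_span ⟨X, hX, rfl⟩
  set a : E → ℝ := fun z ↦ G z (ξ z) (F z) / P z with ha
  set b : E → ℝ := fun z ↦ -(G z (ξ z) (K z)) / P z with hb
  have hPs' := hPs.mono hsub
  have hP0 : ∀ z ∈ Ω', P z ≠ 0 := fun z hz ↦ (hPpos z hz.1).ne'
  have hGξ := (hG.clm_apply hξ).mono hsub
  have hbs : ContDiffOn ℝ ∞ b Ω' := (hGξ.clm_apply (hK.mono hsub)).neg.div hPs' hP0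
  have hξeq : ∀ z ∈ Ω', ξ z = a z • F z + b z • K z := fun z hz ↦
    eq_of_mem_span_pair (hsymm z hz.1) (hP0 z hz) (hKK z hz) (hFF z hz) (hKF z hz)
      (hspan z hz ξ hξA)
  refine ⟨Ω', F, P, a, b, hsub, hpΩ', ⟨hΩ'o, hG.mono hsub, hK.mono hsub, hFs, hξ.mono hsub, hPs',
    (hGξ.clm_apply hFs).div hPs' hP0, hbs, fun z hz ↦ hsymm z hz.1, fun z hz ↦ hPpos z hz.1,
    hKK, hFF, hKF, hξeq, fun z hz ↦ htξ z hz.1, fun z hz ↦ hkK z hz.1, fun z hz ↦ hkξ z hz.1,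
    fun z hz ↦ hoK z hz.1, fun z hz ↦ hoξ z hz.1, fun z hz ↦ ?_, fun U hU hUo hUne ↦ ?_⟩⟩
  · have dK := hK.differentiableAt_of_isOpen hΩ hz.1
    have dY := hY.differentiableAt_of_isOpen hΩ hz.1
    have dt := hts.differentiableAt_of_isOpen hΩ hz.1
    have dN := hNs.differentiableAt_of_isOpen hΩ hz.1
    have ds := hss.differentiableAt_of_isOpen hΩ'o hz
    obtain ⟨Z, hZA, hZ⟩ := hbr Y hYA
    have hNspan : N z ∈ Submodule.span ℝ {K z, F z} := by
      have : N z = (s z)⁻¹ • F z := by simp [hF, (hspos z hz).ne']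
      rw [this]
      exact Submodule.smul_mem _ _ (Submodule.subset_span (by simp))
    have hmem : fderiv ℝ F z (K z) - fderiv ℝ K z (F z) ∈ Submodule.span ℝ {K z, F z} := by
      have e1 : fderiv ℝ F z (K z) - fderiv ℝ K z (F z) = fderiv ℝ s z (K z) • N z
          + s z • (Z z + fderiv ℝ t z (K z) • K z) := by
        have e2 : fderiv ℝ N z (K z) = fderiv ℝ Y z (K z)
            + (fderiv ℝ t z (K z) • K z + t z • fderiv ℝ K z (K z)) := by
          rw [hN, fderiv_fun_add dY (dt.fun_smul dK), add_apply, fderiv_smul_apply dt dK]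
        rw [hF, fderiv_smul_apply ds dN, e2, hZ z hz.1, map_smul]
        simp only [hN, map_add, map_smul, smul_add, smul_sub]
        abel
      rw [e1]
      have hKm : K z ∈ Submodule.span ℝ {K z, F z} := Submodule.subset_span (by simp)
      exact add_mem (Submodule.smul_mem _ _ hNspan) (Submodule.smul_mem _ _
        (add_mem (hspan z hz Z hZA) (Submodule.smul_mem _ _ hKm)))
    obtain ⟨c, d, hcd⟩ := Submodule.mem_span_pair.1 hmem
    exact ⟨c, d, hcd.symm⟩
  · by_contra! hcon
    have hξb : ∀ z ∈ U, ξ z = b z • K z := fun z hz ↦ by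
      rw [hξeq z (hU hz), hcon z hz, zero_smul, zero_add]
    have hd := fderiv_eq_zero_of_isKillingOn_smul hUo
      ((hK.mono (hU.trans hsub)).differentiableOn (by simp))
      ((hbs.mono hU).differentiableOn (by simp)) (fun z hz ↦ hsymm z (hU hz).1)
      (fun z hz ↦ (htK z (hU hz).1).ne) (fun z hz ↦ hkK z (hU hz).1)
      (fun z hz ↦ hkξ z (hU hz).1) hξb
    obtain ⟨z₀, hz₀⟩ := hUne
    obtain ⟨ε, hε, hball⟩ := Metric.isOpen_iff.1 hUo z₀ hz₀
    obtain ⟨z, hz, hne'⟩ := hne (Metric.ball z₀ ε) (hball.trans (hU.trans hsub)) Metric.isOpen_ball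
      ⟨z₀, Metric.mem_ball_self hε⟩ (b z₀)
    refine hne' ?_
    rw [hξb z (hball hz)]
    congr 1
    exact Metric.isOpen_ball.is_const_of_fderiv_eq_zero (convex_ball _ _).isPreconnected
      (((hbs.mono hU).mono hball).differentiableOn (by simp)) (fun y hy ↦ hd y (hball hy)) hz
      (Metric.mem_ball_self hε)

end FrameConstruction

/-! ### Vector fields and metrics in a chart of a manifold -/

section ChartTransfer

open Set Topology

variable {M : Type*} [TopologicalSpace M] [ChartedSpace E4 M] [IsManifold 𝓘(ℝ, E4) ∞ M]

/-- The open partial homeomorphism `φ` is a smooth chart. -/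
structure IsSmoothChart (φ : OpenPartialHomeomorph M E4) : Prop where
  smooth : ContMDiffOn 𝓘(ℝ, E4) 𝓘(ℝ, E4) ∞ φ φ.source
  smooth_symm : ContMDiffOn 𝓘(ℝ, E4) 𝓘(ℝ, E4) ∞ φ.symm φ.target

/-- The coordinate expression of a vector field in the chart `φ`. -/
noncomputable def coordField (φ : OpenPartialHomeomorph M E4) (X : VField M) : E4 → E4 :=
  VectorField.mpullback 𝓘(ℝ, E4) 𝓘(ℝ, E4) φ.symm X

/-- The vector field with constant coordinates `u` in the chart `φ`. -/
noncomputable def constField (φ : OpenPartialHomeomorph M E4) (u : E4) : VField M :=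
  VectorField.mpullback 𝓘(ℝ, E4) 𝓘(ℝ, E4) φ (fun _ ↦ u)

/-- The coordinate expression of a metric in the chart `φ`. -/
noncomputable def coordMetric (φ : OpenPartialHomeomorph M E4) (g : LorentzMetric M) (z : E4) :
    E4 →L[ℝ] E4 →L[ℝ] ℝ :=
  let B : E4 →L[ℝ] E4 →L[ℝ] ℝ := g.inner (φ.symm z)
  let A : E4 →L[ℝ] E4 := mfderiv 𝓘(ℝ, E4) 𝓘(ℝ, E4) φ.symm z
  B.bilinearComp A A

variable {φ : OpenPartialHomeomorph M E4} {g : LorentzMetric M} {X Y : VField M} {x : M} {z u v : E4}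

lemma coordMetric_apply : coordMetric φ g z u v = g.inner (φ.symm z)
    (mfderiv 𝓘(ℝ, E4) 𝓘(ℝ, E4) φ.symm z u) (mfderiv 𝓘(ℝ, E4) 𝓘(ℝ, E4) φ.symm z v) :=
  rfl

namespace IsSmoothChart

variable (h : IsSmoothChart φ)
include h

omit [IsManifold 𝓘(ℝ, E4) ∞ M] in
lemma mdifferentiable : φ.MDifferentiable 𝓘(ℝ, E4) 𝓘(ℝ, E4) :=
  ⟨h.smooth.mdifferentiableOn (by simp), h.smooth_symm.mdifferentiableOn (by simp)⟩

omit [IsManifold 𝓘(ℝ, E4) ∞ M] in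
lemma isInvertible_mfderiv (hx : x ∈ φ.source) :
    (mfderiv 𝓘(ℝ, E4) 𝓘(ℝ, E4) φ x).IsInvertible :=
  ⟨h.mdifferentiable.mfderiv hx, rfl⟩

omit [IsManifold 𝓘(ℝ, E4) ∞ M] in
lemma isInvertible_mfderiv_symm (hz : z ∈ φ.target) :
    (mfderiv 𝓘(ℝ, E4) 𝓘(ℝ, E4) φ.symm z).IsInvertible :=
  ⟨h.mdifferentiable.symm.mfderiv hz, rfl⟩

omit [IsManifold 𝓘(ℝ, E4) ∞ M] in
lemma mfderiv_symm_coordField (X : VField M) (hz : z ∈ φ.target) :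
    mfderiv 𝓘(ℝ, E4) 𝓘(ℝ, E4) φ.symm z (coordField φ X z) = X (φ.symm z) :=
  ((h.isInvertible_mfderiv_symm hz).inverse_apply_eq.1 rfl).symm

omit [IsManifold 𝓘(ℝ, E4) ∞ M] in
lemma coordField_eq_iff (hz : z ∈ φ.target) :
    coordField φ X z = u ↔ X (φ.symm z) = mfderiv 𝓘(ℝ, E4) 𝓘(ℝ, E4) φ.symm z u :=
  (h.isInvertible_mfderiv_symm hz).inverse_apply_eq

omit [IsManifold 𝓘(ℝ, E4) ∞ M] in
lemma constField_symm (u : E4) (hz : z ∈ φ.target) :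
    constField φ u (φ.symm z) = mfderiv 𝓘(ℝ, E4) 𝓘(ℝ, E4) φ.symm z u := by
  refine (h.isInvertible_mfderiv (φ.map_target hz)).inverse_apply_eq.2 ?_
  exact (congrArg (fun A : E4 →L[ℝ] E4 ↦ A u) (h.mdifferentiable.comp_symm_deriv hz)).symm

omit [IsManifold 𝓘(ℝ, E4) ∞ M] in
lemma coordField_constField (u : E4) (hz : z ∈ φ.target) : coordField φ (constField φ u) z = u :=
  (h.coordField_eq_iff hz).2 (h.constField_symm u hz)

lemma coordMetric_coordField (X Y : VField M) (hz : z ∈ φ.target) :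
    coordMetric φ g z (coordField φ X z) (coordField φ Y z) =
      g.inner (φ.symm z) (X (φ.symm z)) (Y (φ.symm z)) := by
  rw [coordMetric_apply, h.mfderiv_symm_coordField X hz, h.mfderiv_symm_coordField Y hz]

omit [IsManifold 𝓘(ℝ, E4) ∞ M] in
lemma contMDiffAt_symm (hz : z ∈ φ.target) : ContMDiffAt 𝓘(ℝ, E4) 𝓘(ℝ, E4) ∞ φ.symm z :=
  h.smooth_symm.contMDiffAt (φ.open_target.mem_nhds hz)

lemma smooth_coordField (hX : ∀ x ∈ φ.source, X.SmoothAt x) :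
    ContDiffOn ℝ ∞ (coordField φ X) φ.target := by
  have : IsManifold 𝓘(ℝ, E4) 1 M := IsManifold.of_le (n := ∞) (by simp)
  intro z hz
  refine (contMDiffAt_vectorSpace_iff_contDiffAt.1 ?_).contDiffWithinAt
  exact ContMDiffAt.mpullback_vectorField_preimage (hX _ (φ.map_target hz)) (h.contMDiffAt_symm hz)
    (h.isInvertible_mfderiv_symm hz) (by simp)

lemma smoothAt_constField (u : E4) (hx : x ∈ φ.source) : (constField φ u).SmoothAt x := by
  have : IsManifold 𝓘(ℝ, E4) 1 M := IsManifold.of_le (n := ∞) (by simp)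
  refine ContMDiffAt.mpullback_vectorField_preimage ?_
    (h.smooth.contMDiffAt (φ.open_source.mem_nhds hx)) (h.isInvertible_mfderiv hx) (by simp)
  exact contMDiffAt_vectorSpace_iff_contDiffAt.2 contDiffAt_const

omit h in
lemma _root_.LorentzMetric.smoothAt_inner (hX : X.SmoothAt x) (hY : Y.SmoothAt x) :
    ContMDiffAt 𝓘(ℝ, E4) 𝓘(ℝ, ℝ) ∞ (fun y ↦ g.inner y (X y) (Y y)) x := by
  have := ContMDiffAt.clm_bundle_apply₂ (F₁ := E4) (F₂ := E4) (F₃ := ℝ)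
    (E₁ := fun x : M ↦ TangentSpace 𝓘(ℝ, E4) x) (E₂ := fun x : M ↦ TangentSpace 𝓘(ℝ, E4) x)
    (E₃ := Bundle.Trivial M ℝ) (b := fun y : M ↦ y) (ψ := fun y ↦ g.inner y) (g.contMDiff x) hX hY
  rw [Bundle.contMDiffAt_totalSpace] at this
  exact this.2

lemma smooth_coordMetric : ContDiffOn ℝ ∞ (coordMetric φ g) φ.target := by
  rw [contDiffOn_clm_apply]
  intro u
  rw [contDiffOn_clm_apply]
  intro v z hz
  have h1 : ContMDiffAt 𝓘(ℝ, E4) 𝓘(ℝ, ℝ) ∞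
      (fun y ↦ g.inner (φ.symm y) (constField φ u (φ.symm y)) (constField φ v (φ.symm y))) z :=
    (LorentzMetric.smoothAt_inner (g := g) (h.smoothAt_constField u (φ.map_target hz))
      (h.smoothAt_constField v (φ.map_target hz))).comp z (h.contMDiffAt_symm hz)
  refine (contMDiffAt_iff_contDiffAt.1 h1).contDiffWithinAt.congr_of_mem (fun y hy ↦ ?_) hz
  rw [coordMetric_apply, h.constField_symm u hy, h.constField_symm v hy]

omit [IsManifold 𝓘(ℝ, E4) ∞ M] in
lemma deriv_eq {f : M → ℝ} (hz : z ∈ φ.target) (hf : ContMDiffAt 𝓘(ℝ, E4) 𝓘(ℝ, ℝ) ∞ f (φ.symm z)) :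
    X.deriv f (φ.symm z) = fderiv ℝ (fun y ↦ f (φ.symm y)) z (coordField φ X z) := by
  have h1 := mfderiv_comp z (hf.mdifferentiableAt (by simp))
    ((h.contMDiffAt_symm hz).mdifferentiableAt (by simp))
  rw [mfderiv_eq_fderiv] at h1
  have h2 := congrArg (fun A : E4 →L[ℝ] ℝ ↦ A (coordField φ X z)) h1
  refine Eq.trans ?_ h2.symm
  exact congrArg (mvfderiv 𝓘(ℝ, E4) f (φ.symm z)) (h.mfderiv_symm_coordField X hz).symm

lemma coordField_bracket (hX : X.SmoothAt (φ.symm z)) (hY : Y.SmoothAt (φ.symm z))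
    (hz : z ∈ φ.target) : coordField φ (X.bracket Y) z =
      fderiv ℝ (coordField φ Y) z (coordField φ X z)
        - fderiv ℝ (coordField φ X) z (coordField φ Y z) := by
  have : IsManifold 𝓘(ℝ, E4) 2 M := IsManifold.of_le (n := ∞) (WithTop.coe_le_coe.2 le_top)
  have : IsManifold 𝓘(ℝ, E4) (minSmoothness ℝ 2) M := by simpa
  have h1 := VectorField.mpullback_mlieBracket (n := ∞) (V := X) (W := Y)
    (hX.mdifferentiableAt (by simp)) (hY.mdifferentiableAt (by simp)) (h.contMDiffAt_symm hz)
    (by simpa using WithTop.coe_le_coe.2 (le_top : (2 : ℕ∞) ≤ ⊤))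
  have h2 : ∀ V W : E4 → E4, VectorField.mlieBracket 𝓘(ℝ, E4) V W z =
      VectorField.lieBracket ℝ V W z := fun V W ↦
    (congrFun (VectorField.mlieBracketWithin_eq_lieBracketWithin (s := univ)) z).trans
      (congrFun VectorField.lieBracketWithin_univ z)
  exact h1.trans (h2 _ _)

lemma isKillingOn {K : VField M} (hK : ∀ x ∈ φ.source, K.SmoothAt x) (hk : g.IsKilling K) :
    IsKillingOn (coordMetric φ g) (coordField φ K) φ.target := by
  intro z hz u v
  have hx := φ.map_target hz
  have h1 := hk (φ.symm z) (constField φ u) (constField φ v) (h.smoothAt_constField u hx)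
    (h.smoothAt_constField v hx)
  have hdG := h.smooth_coordMetric (g := g).differentiableAt_of_isOpen φ.open_target hz
  have hdf : fderiv ℝ (fun y ↦ g.inner (φ.symm y) (constField φ u (φ.symm y))
      (constField φ v (φ.symm y))) z = fderiv ℝ (fun y ↦ coordMetric φ g y u v) z :=
    fderiv_congr_of_isOpen φ.open_target (fun y hy ↦ by
      rw [coordMetric_apply, h.constField_symm u hy, h.constField_symm v hy]) hz
  have hbr : ∀ u, coordField φ (K.bracket (constField φ u)) z =
      -fderiv ℝ (coordField φ K) z u := by
    intro u
    rw [h.coordField_bracket (hK _ hx) (h.smoothAt_constField u hx) hz,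
      h.coordField_constField u hz, fderiv_congr_of_isOpen φ.open_target (g := fun _ ↦ u)
        (fun y hy ↦ h.coordField_constField u hy) hz]
    simp
  rw [h.deriv_eq hz (LorentzMetric.smoothAt_inner (h.smoothAt_constField u hx)
    (h.smoothAt_constField v hx)), hdf, ← h.coordMetric_coordField _ _ hz,
    ← h.coordMetric_coordField _ _ hz, hbr, hbr, h.coordField_constField u hz,
    h.coordField_constField v hz, fderiv_pairing hdG (differentiableAt_const _)
    (differentiableAt_const _)] at h1
  simp only [fderiv_fun_const, Pi.zero_apply, zero_apply, map_zero, add_zero, map_neg,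
    neg_apply, sub_neg_eq_add] at h1
  exact h1

lemma dFlat_constField {K : VField M} (hK : ∀ x ∈ φ.source, K.SmoothAt x) (hz : z ∈ φ.target) :
    g.dFlat K (constField φ u) (constField φ v) (φ.symm z) =
      coordDFlat (coordMetric φ g) (coordField φ K) z u v := by
  have hx := φ.map_target hz
  have hdG := h.smooth_coordMetric (g := g).differentiableAt_of_isOpen φ.open_target hz
  have hdK := (h.smooth_coordField hK).differentiableAt_of_isOpen φ.open_target hz
  have hder : ∀ u v, VField.deriv (constField φ u)
      (fun y ↦ g.inner y (K y) (constField φ v y)) (φ.symm z) =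
      fderiv ℝ (coordMetric φ g) z u (coordField φ K z) v
        + coordMetric φ g z (fderiv ℝ (coordField φ K) z u) v := by
    intro u v
    rw [h.deriv_eq hz (LorentzMetric.smoothAt_inner (hK _ hx) (h.smoothAt_constField v hx)),
      fderiv_congr_of_isOpen φ.open_target
        (g := fun y ↦ coordMetric φ g y (coordField φ K y) v) (fun y hy ↦ by
          rw [← h.coordMetric_coordField _ _ hy, h.coordField_constField v hy]) hz,
      h.coordField_constField u hz, fderiv_pairing hdG hdK (differentiableAt_const _)]
    simp
  have hbr : coordField φ (VField.bracket (constField φ u) (constField φ v)) z = 0 := by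
    rw [h.coordField_bracket (h.smoothAt_constField u hx) (h.smoothAt_constField v hx) hz,
      fderiv_congr_of_isOpen φ.open_target (g := fun _ ↦ u)
        (fun y hy ↦ h.coordField_constField u hy) hz,
      fderiv_congr_of_isOpen φ.open_target (g := fun _ ↦ v)
        (fun y hy ↦ h.coordField_constField v hy) hz]
    simp
  rw [LorentzMetric.dFlat, hder, hder, ← h.coordMetric_coordField _ _ hz, hbr, map_zero, sub_zero,
    coordDFlat]

lemma isHypersurfaceOrthogonalOn {K : VField M} (hK : ∀ x ∈ φ.source, K.SmoothAt x)
    (ho : g.IsHypersurfaceOrthogonal K) :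
    IsHypersurfaceOrthogonalOn (coordMetric φ g) (coordField φ K) φ.target := by
  intro z hz u v w
  have hx := φ.map_target hz
  have h1 := ho (φ.symm z) (constField φ u) (constField φ v) (constField φ w)
    (h.smoothAt_constField u hx) (h.smoothAt_constField v hx) (h.smoothAt_constField w hx)
  rw [h.dFlat_constField hK hz, h.dFlat_constField hK hz, h.dFlat_constField hK hz,
    ← h.coordMetric_coordField _ _ hz, ← h.coordMetric_coordField _ _ hz,
    ← h.coordMetric_coordField _ _ hz, h.coordField_constField u hz,
    h.coordField_constField v hz, h.coordField_constField w hz] at h1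
  exact h1

lemma isLorentzForm_coordMetric (hz : z ∈ φ.target) : IsLorentzForm (coordMetric φ g z) := by
  obtain ⟨hsymm, v, hv, hpos⟩ := g.lorentz (φ.symm z)
  refine ⟨fun u v ↦ hsymm _ _, ?_⟩
  obtain ⟨v', rfl⟩ := h.mdifferentiable.symm.mfderiv_surjective hz v
  refine ⟨v', hv, fun u hu hu0 ↦ hpos _ hu fun h0 ↦ hu0 ?_⟩
  exact h.mdifferentiable.symm.mfderiv_injective hz (h0.trans (map_zero _).symm)

lemma inner_eq_coordMetric (hx : x ∈ φ.source) (u v : TangentSpace 𝓘(ℝ, E4) x) :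
    g.inner x u v = coordMetric φ g (φ x) (mfderiv 𝓘(ℝ, E4) 𝓘(ℝ, E4) φ x u)
      (mfderiv 𝓘(ℝ, E4) 𝓘(ℝ, E4) φ x v) := by
  have key : ∀ y, y = x → ∀ u v : E4, (show E4 →L[ℝ] E4 →L[ℝ] ℝ from g.inner y) u v =
      (show E4 →L[ℝ] E4 →L[ℝ] ℝ from g.inner x) u v := by
    rintro _ rfl u v
    rfl
  have hinv : ∀ u : E4, mfderiv 𝓘(ℝ, E4) 𝓘(ℝ, E4) φ.symm (φ x)
      (mfderiv 𝓘(ℝ, E4) 𝓘(ℝ, E4) φ x u) = u := fun u ↦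
    congrArg (fun A : E4 →L[ℝ] E4 ↦ A u) (h.mdifferentiable.symm_comp_deriv hx)
  exact ((key _ (φ.left_inv hx) _ _).trans (congrArg₂
    (fun u v : E4 ↦ (show E4 →L[ℝ] E4 →L[ℝ] ℝ from g.inner x) u v) (hinv u) (hinv v))).symm

end IsSmoothChart

end ChartTransfer

/-! ### The generated Lie algebra of vector fields -/

section GeneratedAlgebra

open Set Topology

variable {M : Type*} [TopologicalSpace M] [ChartedSpace E4 M] [IsManifold 𝓘(ℝ, E4) ∞ M]
  {K ξ X Y : VField M} {x : M}

lemma VField.SmoothAt.bracket (hX : X.SmoothAt x) (hY : Y.SmoothAt x) :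
    (X.bracket Y).SmoothAt x := by
  have : IsManifold 𝓘(ℝ, E4) 2 M := IsManifold.of_le (n := ∞) (WithTop.coe_le_coe.2 le_top)
  have : IsManifold 𝓘(ℝ, E4) (minSmoothness ℝ 2) M := by simpa
  have : IsManifold 𝓘(ℝ, E4) (((⊤ : ℕ∞) : ℕ∞ω) + 1) M := by simpa
  exact ContMDiffAt.mlieBracket_vectorField (m := ⊤) (n := ⊤) hX hY (by simp)

lemma VField.SmoothAt.const_smul (c : ℝ) (hX : X.SmoothAt x) :
    VField.SmoothAt (fun y ↦ c • X y) x :=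
  ContMDiffAt.const_smul_section hX

lemma InGeneratedAlgebra.smoothAt (hK : K.SmoothAt x) (hξ : ξ.SmoothAt x)
    (hX : InGeneratedAlgebra K ξ X) : X.SmoothAt x := by
  induction hX with
  | left => exact hK
  | right => exact hξ
  | add _ _ h1 h2 => exact ContMDiffAt.add_section h1 h2
  | smul c _ h1 => exact h1.const_smul c
  | bracket _ _ h1 h2 => exact h1.bracket h2

/-- If `ξ` is a constant multiple of `K` on an open set, then so are all the fields that `K` and `ξ`
generate. -/
lemma InGeneratedAlgebra.exists_eq_smul {V : Set M} (hV : IsOpen V) (hK : ∀ x, K.SmoothAt x)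
    {c : ℝ} (hξ : ∀ x ∈ V, ξ x = c • K x) (hX : InGeneratedAlgebra K ξ X) :
    ∃ d : ℝ, ∀ x ∈ V, X x = d • K x := by
  have : IsManifold 𝓘(ℝ, E4) 2 M := IsManifold.of_le (n := ∞) (WithTop.coe_le_coe.2 le_top)
  induction hX with
  | left => exact ⟨1, fun x _ ↦ (one_smul ℝ (K x)).symm⟩
  | right => exact ⟨c, hξ⟩
  | add _ _ h1 h2 =>
    obtain ⟨d₁, h1⟩ := h1
    obtain ⟨d₂, h2⟩ := h2
    exact ⟨d₁ + d₂, fun x hx ↦ by simp only [h1 x hx, h2 x hx, add_smul]⟩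
  | smul a _ h1 =>
    obtain ⟨d, h1⟩ := h1
    exact ⟨a * d, fun x hx ↦ by simp only [h1 x hx, mul_smul]⟩
  | bracket _ _ h1 h2 =>
    obtain ⟨d₁, h1⟩ := h1
    obtain ⟨d₂, h2⟩ := h2
    refine ⟨0, fun x hx ↦ ?_⟩
    have e1 := Filter.EventuallyEq.mlieBracket_vectorField_eq
      ((show Set.EqOn _ (d₁ • K) V from h1).eventuallyEq_of_mem (hV.mem_nhds hx))
      ((show Set.EqOn _ (d₂ • K) V from h2).eventuallyEq_of_mem (hV.mem_nhds hx))
      (I := 𝓘(ℝ, E4))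
    have hKd := (hK x).mdifferentiableAt (by simp)
    refine e1.trans ?_
    rw [VectorField.mlieBracket_const_smul_left hKd, VectorField.mlieBracket_const_smul_right hKd,
      VectorField.mlieBracket_self]
    simp

/-- If the orbits are two-dimensional, `ξ` is not a constant multiple of `K` on any open set. -/
lemma exists_ne_smul_of_finrank {V : Set M} (hV : IsOpen V) (hne : V.Nonempty)
    (hK : ∀ x, K.SmoothAt x) (hrank : ∀ x, Module.finrank ℝ (orbitTangent K ξ x) = 2) (c : ℝ) :
    ∃ x ∈ V, ξ x ≠ c • K x := by
  by_contra! hcon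
  obtain ⟨x, hx⟩ := hne
  have hle : orbitTangent K ξ x ≤ Submodule.span ℝ {K x} := by
    refine Submodule.span_le.2 ?_
    rintro _ ⟨X, hX, rfl⟩
    obtain ⟨d, hd⟩ := hX.exists_eq_smul hV hK hcon
    exact Submodule.mem_span_singleton.2 ⟨d, (hd x hx).symm⟩
  have : FiniteDimensional ℝ (TangentSpace 𝓘(ℝ, E4) x) := inferInstanceAs (FiniteDimensional ℝ E4)
  have h1 := Submodule.finrank_mono hle
  have h2 := finrank_span_le_card (R := ℝ) ({K x} : Set (TangentSpace 𝓘(ℝ, E4) x))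
  rw [hrank x] at h1
  simp at h2
  omega

variable {φ : OpenPartialHomeomorph M E4} {z : E4}

omit [IsManifold 𝓘(ℝ, E4) ∞ M] in
lemma IsSmoothChart.finrank_coordField (h : IsSmoothChart φ) (hz : z ∈ φ.target) :
    Module.finrank ℝ (Submodule.span ℝ
      ((fun X : E4 → E4 ↦ X z) '' {X | ∃ Y, InGeneratedAlgebra K ξ Y ∧ coordField φ Y = X})) =
    Module.finrank ℝ (orbitTangent K ξ (φ.symm z)) := by
  let L : E4 ≃ₗ[ℝ] E4 := (h.mdifferentiable.symm.mfderiv hz).toLinearEquiv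
  have key : (Submodule.span ℝ ((fun X : E4 → E4 ↦ X z) ''
      {X | ∃ Y, InGeneratedAlgebra K ξ Y ∧ coordField φ Y = X})).map (L : E4 →ₗ[ℝ] E4) =
      orbitTangent K ξ (φ.symm z) := by
    rw [Submodule.map_span, orbitTangent]
    refine congrArg (Submodule.span ℝ : Set E4 → Submodule ℝ E4) ?_
    ext v
    constructor
    · rintro ⟨_, ⟨_, ⟨X, hX, rfl⟩, rfl⟩, rfl⟩
      exact ⟨X, hX, (h.mfderiv_symm_coordField X hz).symm⟩
    · rintro ⟨X, hX, rfl⟩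
      exact ⟨_, ⟨_, ⟨X, hX, rfl⟩, rfl⟩, h.mfderiv_symm_coordField X hz⟩
  exact (LinearEquiv.finrank_map_eq L _).symm.trans
    (congrArg (fun W : Submodule ℝ E4 ↦ Module.finrank ℝ W) key)

end GeneratedAlgebra

lemma isSmoothChart_chartAt {M : Type*} [TopologicalSpace M] [ChartedSpace E4 M]
    [IsManifold 𝓘(ℝ, E4) ∞ M] (p : M) : IsSmoothChart (chartAt E4 p) :=
  ⟨contMDiffOn_chart, contMDiffOn_chart_symm⟩

theorem proposition2p1 {M : Type*} [TopologicalSpace M] [ChartedSpace E4 M]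
    [IsManifold 𝓘(ℝ, E4) ∞ M] (g : LorentzMetric M) (hg : g.IsGenericMultiStatic) (p : M) :
    ∃ (S₀ S₁ : Set E2) (γ₀ γ₁ : PlaneForm) (w : E2 → ℝ)
      (Φ : PartialDiffeomorph 𝓘(ℝ, E4) 𝓘(ℝ, E2 × E2) M (E2 × E2) ∞),
      IsOpen S₀ ∧ IsOpen S₁ ∧ p ∈ Φ.source ∧ Φ.target = S₀ ×ˢ S₁ ∧
      γ₀.IsLorentzianOn S₀ ∧ γ₀.HasConstantCurvatureOn S₀ ∧
      γ₁.IsRiemannianOn S₁ ∧ ContDiffOn ℝ ∞ w S₁ ∧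
      ∀ x ∈ Φ.source, ∀ u v : TangentSpace 𝓘(ℝ, E4) x,
        g.inner x u v =
          warpedProduct w γ₀ γ₁ (Φ x) (mvfderiv 𝓘(ℝ, E4) Φ x u) (mvfderiv 𝓘(ℝ, E4) Φ x v) := by
  obtain ⟨K, ξ, hK, hξ, -, hrank⟩ := hg
  set φ := chartAt E4 p
  have hφ : IsSmoothChart φ := isSmoothChart_chartAt p
  have hpφ : p ∈ φ.source := mem_chart_source E4 p
  obtain ⟨Ω, F, P, a, b, hΩ, hpΩ, hfr⟩ := exists_adaptedFrame (G := coordMetric φ g)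
    (K := coordField φ K) (ξ := coordField φ ξ) φ.open_target
    (A := {X | ∃ Y, InGeneratedAlgebra K ξ Y ∧ coordField φ Y = X}) hφ.smooth_coordMetric
    (fun z hz ↦ hφ.isLorentzForm_coordMetric hz)
    (by rintro _ ⟨X, hX, rfl⟩
        exact hφ.smooth_coordField fun x _ ↦ hX.smoothAt (hK.smooth x) (hξ.smooth x))
    ⟨K, .left, rfl⟩ ⟨ξ, .right, rfl⟩
    (by rintro _ ⟨X, hX, rfl⟩
        exact ⟨_, ⟨_, .bracket .left hX, rfl⟩, fun z hz ↦ hφ.coordField_bracket (hK.smooth _)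
          (hX.smoothAt (hK.smooth _) (hξ.smooth _)) hz⟩)
    (fun z hz ↦ by rw [hφ.finrank_coordField hz, hrank])
    (fun U hU hUo hUne c ↦ by
      obtain ⟨x, ⟨z, hz, rfl⟩, hne⟩ := exists_ne_smul_of_finrank (K := K) (ξ := ξ)
        (φ.symm.isOpen_image_of_subset_source hUo hU) (hUne.image _) hK.smooth hrank c
      refine ⟨z, hz, fun h0 ↦ hne ?_⟩
      have h1 : mfderiv 𝓘(ℝ, E4) 𝓘(ℝ, E4) φ.symm z (c • coordField φ K z) = c • K (φ.symm z) :=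
        (ContinuousLinearMap.map_smul _ c _).trans
          (congrArg (c • ·) (hφ.mfderiv_symm_coordField K (hU hz)))
      rw [← hφ.mfderiv_symm_coordField ξ (hU hz), h0, h1])
    (fun z hz ↦ by rw [hφ.coordMetric_coordField _ _ hz]; exact hK.timelike _)
    (fun z hz ↦ by rw [hφ.coordMetric_coordField _ _ hz]; exact hξ.timelike _)
    (hφ.isKillingOn (fun x _ ↦ hK.smooth x) hK.killing)
    (hφ.isKillingOn (fun x _ ↦ hξ.smooth x) hξ.killing)
    (hφ.isHypersurfaceOrthogonalOn (fun x _ ↦ hK.smooth x) hK.hso)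
    (hφ.isHypersurfaceOrthogonalOn (fun x _ ↦ hξ.smooth x) hξ.hso) (φ.map_source hpφ)
  obtain ⟨S₀, S₁, γ₀, γ₁, w, e, hS₀, hS₁, hpe, heΩ, het, hes, hes', hγ₀, hγ₀c, hγ₁, hw, hmetric⟩ :=
    hfr.exists_warped (by simp) (fun z hz ↦ hφ.isLorentzForm_coordMetric (hΩ hz)) hpΩ
  have hsub : e.source ⊆ φ.target := heΩ.trans hΩ
  have hsrc : (φ.trans e).source ⊆ φ.source := by
    rw [OpenPartialHomeomorph.trans_source]
    exact Set.inter_subset_left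
  have htar : (φ.trans e).target = e.target := by
    rw [OpenPartialHomeomorph.trans_target]
    exact Set.inter_eq_left.2 fun q hq ↦ hsub (e.map_target hq)
  have hes1 : ContMDiffOn 𝓘(ℝ, E4) 𝓘(ℝ, E2 × E2) ∞ e e.source := contMDiffOn_iff_contDiffOn.2 hes
  let Φ : PartialDiffeomorph 𝓘(ℝ, E4) 𝓘(ℝ, E2 × E2) M (E2 × E2) ∞ :=
    { (φ.trans e).toPartialEquiv with
      open_source := (φ.trans e).open_source
      open_target := (φ.trans e).open_target
      contMDiffOn_toFun := hes1.comp (hφ.smooth.mono hsrc) fun x hx ↦ by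
        rw [OpenPartialHomeomorph.trans_source] at hx
        exact hx.2
      contMDiffOn_invFun := hφ.smooth_symm.comp
        ((contMDiffOn_iff_contDiffOn.2 hes').mono htar.le) fun q hq ↦
          hsub (e.map_target (htar.le hq)) }
  refine ⟨S₀, S₁, γ₀, γ₁, w, Φ, hS₀, hS₁, ?_, htar.trans het, hγ₀, hγ₀c, hγ₁, hw, fun x hx u v ↦ ?_⟩
  · exact ⟨hpφ, hpe⟩
  · have hx' : x ∈ φ.source := hsrc hx
    have hxe : φ x ∈ e.source := hx.2
    have hd : ∀ u : TangentSpace 𝓘(ℝ, E4) x, mvfderiv 𝓘(ℝ, E4) Φ x u =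
        fderiv ℝ e (φ x) (mfderiv 𝓘(ℝ, E4) 𝓘(ℝ, E4) φ x u) := by
      intro u
      have h1 := mfderiv_comp x
        ((hes1.contMDiffAt (e.open_source.mem_nhds hxe)).mdifferentiableAt (by simp))
        (hφ.mdifferentiable.mdifferentiableAt hx')
      rw [mfderiv_eq_fderiv] at h1
      exact congrArg (fun A : E4 →L[ℝ] E2 × E2 ↦ A u) h1
    rw [hd, hd]
    exact (hφ.inner_eq_coordMetric hx' u v).trans (hmetric (φ x) hxe _ _)
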